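/- A canonical hypergroup is a set $H$ with an element $0$ and a hyperaddition assigning to all $x,y\in H$ a non-empty subset $x+y\subseteq H$, such that the hyperaddition is commutative and associative (where $A+B=\bigcup_{a\in A,\,b\in B}(a+b)$), $0+x=\{x\}$ for all $x$, for every $x$ there is a unique $-x$ with $0\in x+(-x)$, and $x\in y+z$ implies $z\in x-y$. A commutative hyperfield is a canonical hypergroup $\mathbb H$ with a commutative multiplication that has a unit $1\neq 0$, satisfies $r\cdot 0=0$ and $r(s+t)=rs+rt$, and makes $\mathbb H^\times=\mathbb H\setminus\{0\}$ a group. An isomorphism of hyperfields is a multiplicative bijection $f$ with $f(a+b)=f(a)+f(b)$ (equality of subsets) for all $a,b$. The Krasner hyperfield is $\mathbf K=\{0,1\}$ with the usual multiplication, neutral element $0$ and $1+1=\{0,1\}$; $\mathbb H$ is an extension of $\mathbf K$ if it contains $\mathbf K$ as a sub-hyperfield. The geometry of an extension $\mathbb H$ of $\mathbf K$ has the elements of $\mathbb H^\times$ as points and the sets $L(x,y)=(x+y)\cup\{x,y\}$, for $x\neq y$ in $\mathbb H^\times$, as lines. A collineation of a geometry is a permutation of its points that maps lines to lines, and so does its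 inverse. **Theorem.** Let $\mathbb H\supset\mathbf K$ be a finite commutative hyperfield extension of $\mathbf K$. Then (at least) one of the following holds. 1. There is a finite abelian group $G$ of order at least $4$ such that $\mathbb H$ is isomorphic to $\mathbf K[G]$, the hyperfield $G\cup\{0\}$ whose multiplication extends that of $G$ by $0\cdot g=g\cdot 0=0$, and whose hyperaddition is given by $x+0=0+x=\{x\}$, $x+x=\{0,x\}$, and $x+y=(G\cup\{0\})\setminus\{0,x,y\}$ for distinct non-zero $x,y$. 2. There is an extension of finite fields $\mathbb F_q\subset\mathbb F_{q^m}$ with $m\geq 1$ such that $\mathbb H$ is isomorphic to $\mathbb F_{q^m}/\mathbb F_q^\times$, the set of orbits of $\mathbb F_q^\times$ acting on $\mathbb F_{q^m}$ by multiplication, with the multiplication induced from $\mathbb F_{q^m}$, and in which the sum of two orbits is the set of all orbits contained in their sum as subsets of $\mathbb F_{q^m}$. 3. There are a finite non-Desarguesian projective plane $\mathcal P$ and an abelian group $G$ of collineations of $\mathcal P$, acting simply transitively on the points of $\mathcal P$, such that $G$ with $\mathcal P$ is the incidence group of $\mathbb H$: there are a group isomorphism $e:\mathbb H^\times\to G$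 and a bijection $f$ from $\mathbb H^\times$ onto the points of $\mathcal P$ under which the lines of the geometry of $\mathbb H$ correspond exactly to the lines of $\mathcal P$, with $f(ab)=e(a)(f(b))$ for all $a,b\in\mathbb H^\times$. -/

import Mathlib

universe u v

/-- A canonical hypergroup: a set with an element `0` and a commutative hyperaddition `hadd`,
whose values are non-empty subsets, subject to the usual axioms. -/
class CanonicalHypergroup (H : Type u) extends Zero H where
  hadd : H → H → Set H
  hadd_nonempty : ∀ x y : H, (hadd x y).Nonempty
  hadd_comm : ∀ x y : H, hadd x y = hadd y x
  hadd_assoc : ∀ x y z : H, (⋃ w ∈ hadd x y, hadd w z) = ⋃ w ∈ hadd y z, hadd x w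
  zero_hadd : ∀ x : H, hadd 0 x = {x}
  /-- every `x` has a unique opposite -/
  existsUnique_neg : ∀ x : H, ∃! y : H, 0 ∈ hadd x y
  /-- reversibility: `x ∈ y + z` implies `z ∈ x - y`, where `y' = - y` -/
  reversible : ∀ x y z y' : H, 0 ∈ hadd y y' → x ∈ hadd y z → z ∈ hadd x y'

infixl:65 " +ₕ " => CanonicalHypergroup.hadd

/-- A hyperring: a canonical hypergroup with a (single-valued) associative unital multiplication
that distributes over the hyperaddition, with `0` absorbing and `0 ≠ 1`. -/
class Hyperring (R : Type u) extends CanonicalHypergroup R, MonoidWithZero R, Nontrivial R where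
  mul_hadd : ∀ r s t : R, (fun x => r * x) '' (s +ₕ t) = (r * s) +ₕ (r * t)
  hadd_mul : ∀ r s t : R, (fun x => x * r) '' (s +ₕ t) = (s * r) +ₕ (t * r)

/-- A commutative hyperfield: a hyperring with commutative multiplication in which the non-zero
elements form a group. -/
class CommHyperfield (H : Type u) extends Hyperring H, CommGroupWithZero H

/-- Isomorphisms of hyperrings: bijections `f` with `f (a b) = f a * f b` and
`f (a + b) = f a + f b` (an equality of subsets). -/
structure HyperringIso (R : Type u) (S : Type v) [Hyperring R] [Hyperring S] extends R ≃* S where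
  map_hadd : ∀ a b : R, toFun '' (a +ₕ b) = toFun a +ₕ toFun b

/-! ### The Krasner hyperfield and its extensions -/

/-- The underlying set `{0, 1}` of the Krasner hyperfield. -/
inductive KrasnerK : Type
  | zero
  | one

namespace KrasnerK

/-- The usual multiplication of `{0, 1}`. -/
def mul : KrasnerK → KrasnerK → KrasnerK
  | one, one => one
  | _, _ => zero

/-- `0` is neutral and `1 + 1 = {0, 1}`. -/
def add : KrasnerK → KrasnerK → Set KrasnerK
  | zero, y => {y}
  | one, zero => {one}
  | one, one => Set.univ

theorem exists_iff {p : KrasnerK → Prop} : (∃ x, p x) ↔ p zero ∨ p one :=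
  ⟨fun ⟨x, hx⟩ => by cases x <;> simp [hx], fun h => h.elim (fun h => ⟨_, h⟩) fun h => ⟨_, h⟩⟩

instance : CommHyperfield KrasnerK where
  zero := zero
  one := one
  mul := mul
  inv := id
  hadd := add
  mul_assoc := by rintro (_ | _) (_ | _) (_ | _) <;> rfl
  one_mul := by rintro (_ | _) <;> rfl
  mul_one := by rintro (_ | _) <;> rfl
  zero_mul := by rintro (_ | _) <;> rfl
  mul_zero := by rintro (_ | _) <;> rfl
  mul_comm := by rintro (_ | _) (_ | _) <;> rfl
  inv_zero := rfl
  mul_inv_cancel := by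
    rintro (_ | _) h
    · exact absurd rfl h
    · rfl
  exists_pair_ne := ⟨zero, one, by simp⟩
  hadd_nonempty := by rintro (_ | _) (_ | _) <;> first | exact ⟨one, rfl⟩ | exact ⟨zero, rfl⟩ | exact ⟨zero, trivial⟩
  hadd_comm := by rintro (_ | _) (_ | _) <;> simp [add]
  hadd_assoc := by
    intro x y z
    ext w
    simp only [Set.mem_iUnion, exists_prop, exists_iff]
    revert x y z w
    rintro (_ | _) (_ | _) (_ | _) (_ | _) <;> simp [add]
  zero_hadd := by rintro (_ | _) <;> rfl
  existsUnique_neg := by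
    rintro (_ | _)
    · refine ⟨zero, rfl, ?_⟩
      rintro (_ | _) h
      · rfl
      · exact h.symm
    · refine ⟨one, trivial, ?_⟩
      rintro (_ | _) h
      · exact (KrasnerK.noConfusion h)
      · rfl
  reversible := by
    rintro (_ | _) (_ | _) (_ | _) (_ | _) <;> intro h h' <;>
      first | rfl | trivial
  mul_hadd := by
    intro x y z
    ext w
    simp only [Set.mem_image, exists_iff]
    revert x y z w
    rintro (_ | _) (_ | _) (_ | _) (_ | _) <;> simp [add, HMul.hMul, mul]
  hadd_mul := by
    intro x y z
    ext w
    simp only [Set.mem_image, exists_iff]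
    revert x y z w
    rintro (_ | _) (_ | _) (_ | _) (_ | _) <;> simp [add, HMul.hMul, mul]

end KrasnerK

/-- `R` contains the Krasner hyperfield as a sub-hyperring, that is, `R` has a subset `{0, 1}`
on which the operations of `R` restrict to those of the Krasner hyperfield. -/
def IsKrasnerExtension (R : Type u) [Hyperring R] : Prop :=
  ∃ ι : KrasnerK → R, Function.Injective ι ∧ ι 0 = 0 ∧ ι 1 = 1 ∧
    (∀ a b, ι (a * b) = ι a * ι b) ∧ ∀ a b, ι '' (a +ₕ b) = ι a +ₕ ι b

/-! ### The hyperfield `K[G]` of a group of order at least four -/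

namespace KrasnerGroup

open Classical in
/-- The hyperaddition of `K[G]` on the set `G ∪ {0}`. -/
noncomputable def add {G : Type u} (x y : WithZero G) : Set (WithZero G) :=
  if y = 0 then {x} else if x = 0 then {y} else if x = y then {0, x} else {0, x, y}ᶜ

theorem mem_add {G : Type u} (x y z : WithZero G) :
    z ∈ add x y ↔ (x = 0 ∧ y = z) ∨ (y = 0 ∧ x = z) ∨ (z = 0 ∧ x = y) ∨ (x = y ∧ y = z) ∨
      (x ≠ 0 ∧ y ≠ 0 ∧ z ≠ 0 ∧ x ≠ y ∧ y ≠ z ∧ x ≠ z) := by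
  unfold add
  split_ifs <;> simp only [Set.mem_singleton_iff, Set.mem_insert_iff, Set.mem_compl_iff] <;> grind

theorem add_comm {G : Type u} (x y : WithZero G) : add x y = add y x := by
  ext z
  simp only [mem_add]
  grind

theorem exists_ne {G : Type u} (hG : 4 ≤ ENat.card G) (x y z : WithZero G) :
    ∃ w : WithZero G, w ≠ 0 ∧ w ≠ x ∧ w ≠ y ∧ w ≠ z := by
  by_contra! h
  have h1 : Set.range ((↑) : G → WithZero G) ⊆ {x, y, z} := by
    rintro _ ⟨g, rfl⟩
    have h0 := h g WithZero.coe_ne_zero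
    simp only [Set.mem_insert_iff, Set.mem_singleton_iff]
    grind
  have h2 := Set.encard_le_encard h1
  have h3 : ({x, y, z} : Set (WithZero G)).encard ≤ 3 := by
    have a2 := Set.encard_insert_le ({y, z} : Set (WithZero G)) x
    have a3 := Set.encard_insert_le ({z} : Set (WithZero G)) y
    rw [Set.encard_singleton] at a3
    calc _ ≤ _ := a2
      _ ≤ 1 + 1 + 1 := by gcongr
      _ = 3 := by norm_num
  have h4 : (Set.range ((↑) : G → WithZero G)).encard = ENat.card G := by
    rw [← Set.image_univ, WithZero.coe_injective.encard_image, Set.encard_univ]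
  have h5 : (4 : ℕ∞) ≤ 3 := hG.trans (h4 ▸ h2.trans h3)
  exact absurd h5 (by decide)

theorem add_assoc_aux {G : Type u} (hG : 4 ≤ ENat.card G) (x y z w : WithZero G)
    (h : ∃ u ∈ add x y, w ∈ add u z) : ∃ v ∈ add y z, w ∈ add x v := by
  simp only [mem_add] at h ⊢
  obtain ⟨u, hu, hw⟩ := h
  obtain ⟨a, ha⟩ := exists_ne hG x y z
  obtain ⟨b, hb⟩ := exists_ne hG x y w
  obtain ⟨c, hc⟩ := exists_ne hG y z w
  by_contra hn
  have hn' : ∀ v, ¬ (_ ∧ _) := fun v hv => hn ⟨v, hv⟩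
  have n0 := hn' 0
  have n1 := hn' x
  have n2 := hn' y
  have n3 := hn' z
  have n4 := hn' w
  have n5 := hn' u
  have n6 := hn' a
  have n7 := hn' b
  have n8 := hn' c
  clear hn hn' hG
  grind (splits := 40)

theorem add_nonempty {G : Type u} (hG : 4 ≤ ENat.card G) (x y : WithZero G) :
    (add x y).Nonempty := by
  obtain ⟨w, hw⟩ := exists_ne hG x y 0
  by_cases hx : x = 0
  · exact ⟨y, (mem_add _ _ _).2 (by grind)⟩
  by_cases hy : y = 0
  · exact ⟨x, (mem_add _ _ _).2 (by grind)⟩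
  by_cases hxy : x = y
  · exact ⟨x, (mem_add _ _ _).2 (by grind)⟩
  · exact ⟨w, (mem_add _ _ _).2 (by grind)⟩

theorem mul_add {G : Type u} [CommGroup G] (hG : 4 ≤ ENat.card G) (r s t : WithZero G) :
    (fun x => r * x) '' add s t = add (r * s) (r * t) := by
  rcases eq_or_ne r 0 with rfl | hr
  · simp [(add_nonempty hG s t).image_const, add]
  ext z
  have hi : ∀ a b : WithZero G, r * a = r * b ↔ a = b := fun a b => mul_right_inj' hr
  have h0 : ∀ a : WithZero G, r * a = 0 ↔ a = 0 := fun a => by simp [hr]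
  obtain ⟨z, rfl⟩ : ∃ z', z = r * z' := ⟨r⁻¹ * z, (mul_inv_cancel_left₀ hr z).symm⟩
  simp only [Set.mem_image, hi, exists_eq_right, mem_add, h0, ne_eq]

end KrasnerGroup

/-- The hyperfield `K[G]` on `G ∪ {0}`, for an abelian group `G` of order at least four:
`x + x = {0, x}`, and `x + y` is the complement of `{0, x, y}` for distinct non-zero `x, y`. -/
@[reducible] noncomputable def krasnerGroupHyperfield (G : Type u) [CommGroup G]
    (hG : 4 ≤ ENat.card G) : CommHyperfield (WithZero G) where
  __ := (inferInstance : CommGroupWithZero (WithZero G))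
  hadd := KrasnerGroup.add
  hadd_nonempty := KrasnerGroup.add_nonempty hG
  hadd_comm := KrasnerGroup.add_comm
  hadd_assoc x y z := by
    ext w
    simp only [Set.mem_iUnion, exists_prop]
    refine ⟨KrasnerGroup.add_assoc_aux hG x y z w, fun h => ?_⟩
    have hc := fun a b : WithZero G => KrasnerGroup.add_comm a b
    obtain ⟨v, hv, hw⟩ := h
    obtain ⟨u, hu, hw'⟩ :=
      KrasnerGroup.add_assoc_aux hG z y x w ⟨v, hc y z ▸ hv, hc x v ▸ hw⟩
    exact ⟨u, hc y x ▸ hu, hc z u ▸ hw'⟩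
  zero_hadd x := by
    ext z
    simp only [KrasnerGroup.mem_add, Set.mem_singleton_iff]
    grind
  existsUnique_neg x := by
    refine ⟨x, ?_, fun y hy => ?_⟩ <;> simp only [KrasnerGroup.mem_add] at * <;> grind
  reversible x y z y' := by
    simp only [KrasnerGroup.mem_add]
    grind
  mul_hadd := KrasnerGroup.mul_add hG
  hadd_mul r s t := by
    simp only [mul_comm _ r]
    exact KrasnerGroup.mul_add hG r s t

/-! ### The hyperfield `F / G` -/

section Quotient

variable {F : Type u} [Field F]

/-- The multiplicative congruence on a field whose classes are the orbits `x G`. -/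
def orbitCon (G : Subgroup Fˣ) : Con F where
  r x y := ∃ g ∈ G, x * (g : Fˣ) = y
  iseqv :=
    { refl := fun x => ⟨1, G.one_mem, by simp⟩
      symm := by
        rintro x _ ⟨g, hg, rfl⟩
        exact ⟨g⁻¹, G.inv_mem hg, by simp⟩
      trans := by
        rintro x _ _ ⟨g, hg, rfl⟩ ⟨h, hh, rfl⟩
        exact ⟨g * h, G.mul_mem hg hh, by simp [mul_assoc]⟩ }
  mul' := by
    rintro x _ y _ ⟨g, hg, rfl⟩ ⟨h, hh, rfl⟩
    exact ⟨g * h, G.mul_mem hg hh, by push_cast; ring⟩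

/-- The set `F / G` of orbits of a subgroup `G` of the multiplicative group of a field `F`. -/
abbrev KrasnerQuotient (G : Subgroup Fˣ) : Type u := (orbitCon G).Quotient

namespace KrasnerQuotient

variable {G : Subgroup Fˣ}

/-- The class `x G` of `x`. -/
def mk (G : Subgroup Fˣ) (x : F) : KrasnerQuotient G := (x : (orbitCon G).Quotient)

theorem mk_eq {x y : F} : mk G x = mk G y ↔ ∃ g ∈ G, x * (g : Fˣ) = y :=
  (orbitCon G).eq

theorem mk_surjective (a : KrasnerQuotient G) : ∃ x : F, mk G x = a :=
  Quotient.exists_rep a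

/-- `x G + y G` is the set of all classes contained in the sum of the subsets `x G` and `y G`. -/
def add (a b : KrasnerQuotient G) : Set (KrasnerQuotient G) :=
  {c | ∃ x y : F, mk G x = a ∧ mk G y = b ∧ mk G (x + y) = c}

theorem mem_add {x y z : F} :
    mk G z ∈ add (mk G x) (mk G y) ↔ ∃ g ∈ G, ∃ h ∈ G, x * (g : Fˣ) + y * (h : Fˣ) = z := by
  constructor
  · rintro ⟨x', y', hx, hy, hz⟩
    obtain ⟨g, hg, rfl⟩ := mk_eq.1 hx.symm
    obtain ⟨h, hh, rfl⟩ := mk_eq.1 hy.symm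
    obtain ⟨k, hk, rfl⟩ := mk_eq.1 hz
    exact ⟨g * k, G.mul_mem hg hk, h * k, G.mul_mem hh hk, by push_cast; ring⟩
  · rintro ⟨g, hg, h, hh, rfl⟩
    exact ⟨_, _, (mk_eq.2 ⟨g, hg, rfl⟩).symm, (mk_eq.2 ⟨h, hh, rfl⟩).symm, rfl⟩

theorem mk_eq_zero {x : F} : mk G x = mk G 0 ↔ x = 0 := by
  rw [mk_eq]
  refine ⟨?_, fun h => ⟨1, G.one_mem, by simp [h]⟩⟩
  rintro ⟨g, -, h⟩
  simpa using h

theorem add_comm (a b : KrasnerQuotient G) : add a b = add b a := by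
  ext c
  constructor <;>
  · rintro ⟨x, y, hx, hy, hz⟩
    exact ⟨y, x, hy, hx, by rwa [_root_.add_comm]⟩

theorem mul_add (r s t : KrasnerQuotient G) :
    (fun x => r * x) '' add s t = add (r * s) (r * t) := by
  obtain ⟨r, rfl⟩ := mk_surjective r
  obtain ⟨s, rfl⟩ := mk_surjective s
  obtain ⟨t, rfl⟩ := mk_surjective t
  ext c
  obtain ⟨c, rfl⟩ := mk_surjective c
  constructor
  · rintro ⟨d, hd, h⟩
    obtain ⟨d, rfl⟩ := mk_surjective d
    obtain ⟨g, hg, k, hk, rfl⟩ := mem_add.1 hd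
    rw [← h]
    exact mem_add.2 ⟨g, hg, k, hk, by ring⟩
  · intro h
    obtain ⟨g, hg, k, hk, rfl⟩ := mem_add.1 h
    exact ⟨mk G (s * (g : Fˣ) + t * (k : Fˣ)), mem_add.2 ⟨g, hg, k, hk, rfl⟩,
      congrArg (mk G) (by ring)⟩

noncomputable instance (G : Subgroup Fˣ) : CommHyperfield (KrasnerQuotient G) where
  __ := (inferInstance : CommMonoid (orbitCon G).Quotient)
  zero := mk G 0
  inv a := Con.liftOn (c := orbitCon G) a (fun x => mk G x⁻¹) (by
    rintro x _ ⟨g, hg, rfl⟩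
    exact mk_eq.2 ⟨g⁻¹, G.inv_mem hg, by simp [mul_comm]⟩)
  hadd := add
  zero_mul a := by
    obtain ⟨x, rfl⟩ := mk_surjective a
    exact congrArg (mk G) (zero_mul x)
  mul_zero a := by
    obtain ⟨x, rfl⟩ := mk_surjective a
    exact congrArg (mk G) (mul_zero x)
  inv_zero := congrArg (mk G) inv_zero
  mul_inv_cancel a ha := by
    obtain ⟨x, rfl⟩ := mk_surjective a
    exact congrArg (mk G) (mul_inv_cancel₀ fun h => ha (congrArg (mk G) h))
  exists_pair_ne := ⟨mk G 1, mk G 0, fun h => one_ne_zero (mk_eq_zero.1 h)⟩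
  hadd_nonempty a b := by
    obtain ⟨x, rfl⟩ := mk_surjective a
    obtain ⟨y, rfl⟩ := mk_surjective b
    exact ⟨_, x, y, rfl, rfl, rfl⟩
  hadd_comm := add_comm
  hadd_assoc a b c := by
    obtain ⟨x, rfl⟩ := mk_surjective a
    obtain ⟨y, rfl⟩ := mk_surjective b
    obtain ⟨z, rfl⟩ := mk_surjective c
    ext d
    obtain ⟨d, rfl⟩ := mk_surjective d
    simp only [Set.mem_iUnion, exists_prop]
    constructor
    · rintro ⟨u, hu, hd⟩
      obtain ⟨u, rfl⟩ := mk_surjective u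
      obtain ⟨g, hg, h, hh, rfl⟩ := mem_add.1 hu
      obtain ⟨k, hk, l, hl, rfl⟩ := mem_add.1 hd
      exact ⟨mk G (y * (h * k : Fˣ) + z * (l : Fˣ)),
        mem_add.2 ⟨_, G.mul_mem hh hk, _, hl, rfl⟩,
        mem_add.2 ⟨_, G.mul_mem hg hk, 1, G.one_mem, by push_cast; ring⟩⟩
    · rintro ⟨u, hu, hd⟩
      obtain ⟨u, rfl⟩ := mk_surjective u
      obtain ⟨g, hg, h, hh, rfl⟩ := mem_add.1 hu
      obtain ⟨k, hk, l, hl, rfl⟩ := mem_add.1 hd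
      exact ⟨mk G (x * (k : Fˣ) + y * (g * l : Fˣ)),
        mem_add.2 ⟨_, hk, _, G.mul_mem hg hl, rfl⟩,
        mem_add.2 ⟨1, G.one_mem, _, G.mul_mem hh hl, by push_cast; ring⟩⟩
  zero_hadd a := by
    obtain ⟨x, rfl⟩ := mk_surjective a
    ext d
    obtain ⟨d, rfl⟩ := mk_surjective d
    constructor
    · intro h
      obtain ⟨g, hg, k, hk, rfl⟩ := mem_add.1 h
      exact (mk_eq.2 ⟨k, hk, by simp⟩).symm
    · intro h
      rw [Set.mem_singleton_iff.1 h]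
      exact mem_add.2 ⟨1, G.one_mem, 1, G.one_mem, by simp⟩
  existsUnique_neg a := by
    obtain ⟨x, rfl⟩ := mk_surjective a
    refine ⟨mk G (-x), mem_add.2 ⟨1, G.one_mem, 1, G.one_mem, by simp⟩, fun b hb => ?_⟩
    obtain ⟨y, rfl⟩ := mk_surjective b
    obtain ⟨g, hg, h, hh, e⟩ := mem_add.1 hb
    refine mk_eq.2 ⟨h * g⁻¹, G.mul_mem hh (G.inv_mem hg), ?_⟩
    have e' : y * (h : Fˣ) = -(x * (g : Fˣ)) := by linear_combination e
    push_cast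
    rw [← mul_assoc, e']
    simp
  reversible a b c b' h0 h := by
    obtain ⟨x, rfl⟩ := mk_surjective a
    obtain ⟨y, rfl⟩ := mk_surjective b
    obtain ⟨z, rfl⟩ := mk_surjective c
    obtain ⟨y', rfl⟩ := mk_surjective b'
    obtain ⟨g, hg, k, hk, e⟩ := mem_add.1 h0
    obtain ⟨l, hl, m, hm, rfl⟩ := mem_add.1 h
    refine mem_add.2 ⟨m⁻¹, G.inv_mem hm, k * g⁻¹ * l * m⁻¹, G.mul_mem (G.mul_mem
      (G.mul_mem hk (G.inv_mem hg)) hl) (G.inv_mem hm), ?_⟩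
    have hg0 : ((g : Fˣ) : F) ≠ 0 := g.ne_zero
    have hm0 : ((m : Fˣ) : F) ≠ 0 := m.ne_zero
    push_cast
    field_simp
    linear_combination (l : F) * e
  mul_hadd := mul_add
  hadd_mul r s t := by
    simp only [mul_comm _ r]
    exact mul_add r s t

end KrasnerQuotient

end Quotient

/-- The subgroup `K^×` of `F^×`, for a field extension `F` of `K`. -/
def unitsSubgroup (K : Type v) (F : Type u) [Field K] [Field F] [Algebra K F] : Subgroup Fˣ :=
  (Units.map (algebraMap K F).toMonoidHom).range

/-! ### Geometries -/

/-- A geometry on a set of points: a family of subsets, called lines. -/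
structure Geometry (P : Type u) where
  lines : Set (Set P)

namespace Geometry

variable {P : Type u} {Q : Type v}

/-- The type of lines of a geometry. -/
def Line (g : Geometry P) : Type u := {l : Set P // l ∈ g.lines}

instance (g : Geometry P) : Membership P g.Line := ⟨fun l p => p ∈ l.1⟩

/-- The geometry is a projective plane. -/
def IsProjectivePlane (g : Geometry P) : Prop :=
  Nonempty (Configuration.ProjectivePlane P g.Line)

def Collinear (g : Geometry P) (x y z : P) : Prop :=
  ∃ l ∈ g.lines, x ∈ l ∧ y ∈ l ∧ z ∈ l

/-- Desargues' property of a projective plane: if two triangles `a b c` and `a' b' c'` are in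
perspective from a point `o` (with distinct lines `o a`, `o b`, `o c`, and vertices distinct from
`o` and from the corresponding vertices), then the points of intersection `x`, `y`, `z` of the
corresponding sides are collinear. -/
def IsDesarguesian (g : Geometry P) : Prop :=
  ∀ o a b c a' b' c' x y z : P,
    ¬ g.Collinear o a b → ¬ g.Collinear o b c → ¬ g.Collinear o c a →
    ¬ g.Collinear a b c → ¬ g.Collinear a' b' c' →
    a' ≠ o → b' ≠ o → c' ≠ o → a ≠ a' → b ≠ b' → c ≠ c' →
    g.Collinear o a a' → g.Collinear o b b' → g.Collinear o c c' →
    g.Collinear b c x → g.Collinear b' c' x →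
    g.Collinear c a y → g.Collinear c' a' y →
    g.Collinear a b z → g.Collinear a' b' z →
    g.Collinear x y z

/-- Isomorphisms of geometries: bijections of the points under which lines correspond to lines. -/
def IsIso (g : Geometry P) (g' : Geometry Q) (f : P ≃ Q) : Prop :=
  ∀ l : Set P, f '' l ∈ g'.lines ↔ l ∈ g.lines

/-- The group of collineations, i.e. of automorphisms of the geometry. -/
def collineations (g : Geometry P) : Subgroup (Equiv.Perm P) where
  carrier := {s | g.IsIso g s}
  one_mem' := fun l => by simp
  mul_mem' := fun {s t} hs ht l => by
    rw [← ht l, ← hs (t '' l), Set.image_image]; rfl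
  inv_mem' := fun {s} hs l => by
    rw [← hs, Set.image_image]; simp

end Geometry

/-- The geometry of a commutative hyperfield `H` (used for extensions of the Krasner hyperfield):
the points are the non-zero elements, and the lines are the sets
`L(x, y) = (x + y) ∪ {x, y}` for `x ≠ y`. -/
def hyperfieldGeometry (H : Type u) [CommHyperfield H] : Geometry Hˣ where
  lines := {l | ∃ x y : Hˣ, x ≠ y ∧ l = {z : Hˣ | (z : H) ∈ (x : H) +ₕ (y : H)} ∪ {x, y}}

/-!
Let `H` be a finite commutative hyperfield that contains the Krasner hyperfield. Distributivity
turns `1 + 1 = {0, 1}` into `x + x = {0, x}`, so that the relation `z ∈ x + y` is symmetric, and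
associativity becomes the axiom of Veblen and Young: the non-zero elements of `H` are the points of
a projective geometry whose lines have at least four points. Multiplication by a non-zero element
is an automorphism of this geometry, and `H^×` acts simply transitively on the points. The proof
distinguishes cases by the dimension of the geometry.

* If there is only one point, `H` is the Krasner hyperfield, the quotient of the field with three
  elements by its multiplicative group (`isFiniteFieldQuotient_of_forall_eq`).
* If all points are on one line, then `x + y` consists of all other points whenever `x ≠ y`, and
  `H` is `K[H^×]` (`exists_hyperringIso_withZero`).
* If the geometry is a plane in which Desargues' theorem fails, then `H^×` is a simply transitive
  abelian group of collineations of a non-Desarguesian plane (`isProjectivePlane`,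
  `exists_collineations`).
* Otherwise Desargues' theorem holds. It does so in every geometry that is not a plane
  (`desargues_of_not_linesMeet`), since a plane configuration lifts to one in space.

The last case is the main part. Fix a hyperplane `M`, that is, a maximal proper subspace. Desargues'
theorem provides all perspectivities with axis `M` (`exists_perspectivity`). Those with center on
`M` are the translations of the affine space outside of `M`; they form an abelian group `W` that is
regular on its points. Those with center `o` outside of `M` act on `W` by conjugation, and the
endomorphisms of `W` that preserve all directions form a finite division ring, hence a field `K`
(`exists_field`). Thus `H` is the set of orbits of `K^×` on the vector space `V = W × K`, compatibly
with addition (`exists_isCoord`).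

By the fundamental theorem of projective geometry (`IsCoord.exists_lift`), every multiplication of
`H` lifts to an additive, and in fact semilinear, map of `V`. Two lifts commute up to a scalar,
because multiplications commute. The decisive fact is that they commute exactly and are linear
(`IsCoord.commute_of_isMulBy`). To see it for a lift `M` of the multiplication by `g ≠ 1`, choose a
lift `N` that maps some vector `e` to `e + M e`. Every `N z` is a combination of `z` and `M z`, and
comparing the coefficients for several `z` forces `N = 1 + M`. If now `h` is another lift,
`h M = m M h` and `h N = n N h`, then `h + h M = h N = n (1 + M) h = n h + n m⁻¹ h M`, so that
`n = 1` and `m = 1`. Since the lifts commute and are transitive on the non-zero vectors, they form,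
with `0`, a finite field `F`; it contains `K`, and evaluation at a vector over `1` identifies `F`
with `V`, and `F / K^×` with `H` (`IsCoord.isFiniteFieldQuotient`).
-/

universe w

namespace ProjHyper

open CanonicalHypergroup

/-! ### Hypergroups with `x + x = {0, x}` as projective geometries -/

section

/-- A canonical hypergroup in which `x + x = {0, x}`: a projective geometry whose points are the
non-zero elements, three distinct points `x`, `y`, `z` being collinear when `z ∈ x + y`. -/
class IsProjectiveHypergroup (H : Type u) [CanonicalHypergroup H] : Prop where
  hadd_self : ∀ x : H, x +ₕ x = {0, x}

variable {H : Type u} [CanonicalHypergroup H]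

/-- `z ∈ x + y`, seen as a ternary relation; it is symmetric in the three variables when `- x = x`
for all `x`. -/
def Tri (x y z : H) : Prop := z ∈ x +ₕ y

/-- Collinearity of three elements, in the form that includes coincidences. -/
def Col (x y z : H) : Prop := x = y ∨ y = z ∨ x = z ∨ Tri x y z

theorem exists_tri (x y : H) : ∃ z, Tri x y z := hadd_nonempty x y

theorem Tri.swap {x y z : H} (h : Tri x y z) : Tri y x z := by
  unfold Tri at *; rwa [hadd_comm]

theorem tri_zero_left {x y : H} : Tri 0 x y ↔ x = y := by
  unfold Tri; rw [zero_hadd, Set.mem_singleton_iff, eq_comm]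

theorem Tri.assoc {x y z u w : H} (h : Tri x y u) (h' : Tri u z w) :
    ∃ v, Tri y z v ∧ Tri x v w := by
  have : w ∈ ⋃ w ∈ x +ₕ y, w +ₕ z := Set.mem_biUnion h h'
  rw [hadd_assoc] at this
  simpa [Tri] using this

variable [IsProjectiveHypergroup H]

theorem tri_self {x y : H} : Tri x x y ↔ y = 0 ∨ y = x := by
  unfold Tri; rw [IsProjectiveHypergroup.hadd_self]; rfl

theorem Tri.rot {x y z : H} (h : Tri x y z) : Tri z x y :=
  reversible z x y x (tri_self.2 (Or.inl rfl)) h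

theorem tri_rot_iff {x y z : H} : Tri x y z ↔ Tri z x y := ⟨Tri.rot, fun h => h.rot.rot⟩

/-- The axiom of Pasch (or Veblen–Young): two lines of a plane meet. -/
theorem Tri.pasch {o a a' b b' : H} (h : Tri o a a') (h' : Tri o b b') :
    ∃ c, Tri a b c ∧ Tri a' b' c := by
  obtain ⟨v, hv, hv'⟩ := Tri.assoc h.rot.rot.swap h'
  exact ⟨v, hv, hv'.rot.swap⟩

theorem tri_zero_right {x y : H} : Tri x y 0 ↔ x = y := by
  rw [tri_rot_iff, tri_zero_left]

/-- Two points on the line through `a` and `b` span, with `a`, a line with the same points. -/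
theorem Tri.exch {a b c d : H} (h : Tri a b c) (h' : Tri a b d) : c = d ∨ Tri a c d := by
  obtain ⟨v, hv, hv'⟩ := Tri.pasch h.rot.rot h'.rot.rot
  rcases tri_self.1 hv' with rfl | rfl
  · exact Or.inl (tri_zero_right.1 hv)
  · exact Or.inr hv.rot

omit [IsProjectiveHypergroup H] in
theorem Col.swap {a b c : H} (h : Col a b c) : Col b a c := by
  rcases h with h | h | h | h
  exacts [Or.inl h.symm, Or.inr (Or.inr (Or.inl h)), Or.inr (Or.inl h),
    Or.inr (Or.inr (Or.inr h.swap))]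

theorem Col.rot {a b c : H} (h : Col a b c) : Col c a b := by
  rcases h with h | h | h | h
  exacts [Or.inr (Or.inl h), Or.inr (Or.inr (Or.inl h.symm)), Or.inl h.symm,
    Or.inr (Or.inr (Or.inr h.rot))]

omit [IsProjectiveHypergroup H] in
theorem Tri.col {a b c : H} (h : Tri a b c) : Col a b c := Or.inr (Or.inr (Or.inr h))

theorem Col.trans {a b c d : H} (h : Col a b c) (h' : Col a b d) (hab : a ≠ b) : Col a c d := by
  rcases h with h | rfl | rfl | h
  · exact absurd h hab
  · exact h'
  · exact Or.inl rfl
  · rcases h' with h' | rfl | rfl | h'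
    · exact absurd h' hab
    · exact h.rot.swap.col
    · exact Or.inr (Or.inr (Or.inl rfl))
    · rcases h.exch h' with h | h
      exacts [Or.inr (Or.inl h), h.col]

theorem Col.trans₃ {x y a b c : H} (hxy : x ≠ y) (ha : Col x y a) (hb : Col x y b)
    (hc : Col x y c) : Col a b c := by
  by_cases hxa : x = a
  · exact hxa ▸ hb.trans hc hxy
  · exact (ha.trans hb hxy).swap.trans (ha.trans hc hxy).swap (Ne.symm hxa)

/-- Lines have at least four points. -/
theorem Tri.exists_ne {a b c : H} (h : Tri a b c) (ha : a ≠ 0) (hac : a ≠ c) :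
    ∃ d, Tri a b d ∧ d ≠ c := by
  obtain ⟨v, hv, hv'⟩ := Tri.assoc (tri_self.2 (Or.inr rfl)) h
  refine ⟨v, hv, ?_⟩
  rintro rfl
  rcases tri_self.1 hv'.rot.rot with h | h
  exacts [ha h, hac h]

/-! ### Subspaces and hyperplanes -/

/-- A subspace: a subset containing `0` and closed under hyperaddition. -/
structure IsSubspace (M : Set H) : Prop where
  zero_mem : (0 : H) ∈ M
  mem_of_tri : ∀ {x y z : H}, x ∈ M → y ∈ M → Tri x y z → z ∈ M

omit [IsProjectiveHypergroup H] in
theorem isSubspace_zero : IsSubspace ({0} : Set H) where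
  zero_mem := rfl
  mem_of_tri := by
    rintro _ _ z rfl rfl h
    exact (tri_zero_left.1 h).symm

/-- The subspace spanned by a subspace `M` and a point `p`; as `M` contains `0`, the second part
includes `p` itself. -/
def joinPt (M : Set H) (p : H) : Set H := M ∪ {x | ∃ m ∈ M, Tri m p x}

omit [IsProjectiveHypergroup H] in
theorem subset_joinPt (M : Set H) (p : H) : M ⊆ joinPt M p := Set.subset_union_left

omit [IsProjectiveHypergroup H] in
theorem IsSubspace.mem_joinPt {M : Set H} (hM : IsSubspace M) (p : H) : p ∈ joinPt M p :=
  Or.inr ⟨0, hM.zero_mem, tri_zero_left.2 rfl⟩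

theorem IsSubspace.joinPt {M : Set H} (hM : IsSubspace M) (p : H) :
    IsSubspace (ProjHyper.joinPt M p) where
  zero_mem := Or.inl hM.zero_mem
  mem_of_tri := by
    have key : ∀ {x y z : H}, x ∈ M → y ∈ ProjHyper.joinPt M p → Tri x y z →
        z ∈ ProjHyper.joinPt M p := by
      rintro x y z hx (hy | ⟨m, hm, hy⟩) h
      · exact Or.inl (hM.mem_of_tri hx hy h)
      · obtain ⟨v, hv, hv'⟩ := Tri.assoc hy.swap h.swap
        exact Or.inr ⟨v, hM.mem_of_tri hm hx hv, hv'.swap⟩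
    rintro x y z (hx | ⟨m, hm, hx⟩) hy h
    · exact key hx hy h
    · rcases hy with hy | ⟨m', hm', hy⟩
      · exact key hy (Or.inr ⟨m, hm, hx⟩) h.swap
      -- `z ∈ (m + p) + (p + m') = m + ({0, p} + m')`
      · obtain ⟨v, hv, hv'⟩ := Tri.assoc hx h
        obtain ⟨w, hw, hw'⟩ := Tri.assoc hy hv.swap
        rcases tri_self.1 hw with rfl | rfl
        · rw [← tri_zero_right.1 hw'.rot.swap] at hv'
          exact Or.inl (hM.mem_of_tri hm hm' hv')
        · exact key hm (Or.inr ⟨m', hm', hw'⟩) hv'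

/-- A hyperplane: a proper subspace that meets every line. -/
structure IsHyperplane (M : Set H) : Prop extends IsSubspace M where
  exists_notMem : ∃ p, p ∉ M
  exists_tri : ∀ p x : H, p ∉ M → x ∉ M → ∃ m ∈ M, Tri p x m

/-- A maximal proper subspace is a hyperplane. -/
theorem exists_isHyperplane [Finite H] {N : Set H} (hN : IsSubspace N) (hN' : N ≠ Set.univ) :
    ∃ M, N ⊆ M ∧ IsHyperplane M := by
  obtain ⟨M, hNM, hM⟩ := (Set.toFinite {M : Set H | IsSubspace M ∧ M ≠ Set.univ}).exists_le_maximal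
    (a := N) ⟨hN, hN'⟩
  have hs := hM.prop.1
  have hne := hM.prop.2
  have hj : ∀ p ∉ M, ∀ x, x ∈ joinPt M p := by
    intro p hp x
    by_contra hx
    exact hp (hM.le_of_ge ⟨hs.joinPt p, fun h => hx (h ▸ Set.mem_univ x)⟩ (subset_joinPt M p)
      (hs.mem_joinPt p))
  refine ⟨M, hNM, hs, by simpa [Set.ne_univ_iff_exists_notMem] using hne, fun p x hp hx => ?_⟩
  obtain ⟨m, hm, h⟩ := (hj p hp x).resolve_left hx
  exact ⟨m, hm, h.rot.rot⟩

/-- A line that is not contained in a subspace meets it in at most one point. -/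
theorem IsSubspace.eq_of_tri {M : Set H} (hM : IsSubspace M) {p q m m' : H} (hp : p ∉ M)
    (hm : m ∈ M) (hm' : m' ∈ M) (h : Tri p q m) (h' : Tri p q m') : m = m' := by
  rcases h.exch h' with h | h
  · exact h
  · exact absurd (hM.mem_of_tri hm hm' h.rot.rot) hp

/-! ### Desargues' theorem -/

/-- Desargues' property in terms of the hyperaddition, restricted to the configurations in which
the sides of the triangles meet outside of the vertices. -/
def Desargues (H : Type u) [CanonicalHypergroup H] : Prop :=
  ∀ o a b c a' b' c' x y z : H, o ≠ 0 → a ≠ 0 → b ≠ 0 → c ≠ 0 → a' ≠ 0 → b' ≠ 0 → c' ≠ 0 →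
    ¬ Col o a b → ¬ Col o b c → ¬ Col o c a → ¬ Col a b c → ¬ Col a' b' c' →
    a' ≠ o → b' ≠ o → c' ≠ o → a ≠ a' → b ≠ b' → c ≠ c' →
    Tri o a a' → Tri o b b' → Tri o c c' → Tri b c x → Tri b' c' x →
    Tri c a y → Tri c' a' y → Tri a b z → Tri a' b' z → Col x y z

/-- The subspace spanned by three points. -/
def plane (a b c : H) : Set H := joinPt (joinPt (joinPt {0} a) b) c

theorem isSubspace_plane (a b c : H) : IsSubspace (plane a b c) :=
  ((isSubspace_zero.joinPt a).joinPt b).joinPt c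

omit [IsProjectiveHypergroup H] in
theorem left_mem_plane (a b c : H) : a ∈ plane a b c :=
  subset_joinPt _ _ (subset_joinPt _ _ (isSubspace_zero.mem_joinPt a))

theorem mid_mem_plane (a b c : H) : b ∈ plane a b c :=
  subset_joinPt _ _ ((isSubspace_zero.joinPt a).mem_joinPt b)

theorem right_mem_plane (a b c : H) : c ∈ plane a b c :=
  ((isSubspace_zero.joinPt a).joinPt b).mem_joinPt c

/-- Two lines through points of distinct lines through `o` meet in at most one point. -/
theorem eq_of_tri_of_tri {o a b a' b' z w : H} (h : ¬ Col o a b) (haa : a ≠ a')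
    (hoa : Tri o a a') (h1 : Tri a b z) (h2 : Tri a' b' z) (h3 : Tri a b w)
    (h4 : Tri a' b' w) : w = z := by
  by_contra hne
  have h5 := (h3.exch h1).resolve_left hne
  have h6 := (h4.exch h2).resolve_left hne
  have h7 := (h5.rot.rot.exch h6.rot.rot).resolve_left haa
  rcases h7.rot.rot.exch hoa.rot.rot with rfl | h8
  · exact h (Or.inr (Or.inr (Or.inr h3.rot)))
  · rcases h8.exch h3.rot.swap with rfl | h9
    · exact h (by simp [Col])
    · exact h (Or.inr (Or.inr (Or.inr h9.swap)))

/-- Desargues' theorem holds if no plane is the whole geometry: triangles in distinct planes have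
their sides meet on the common line of these planes, and triangles in one plane are projections of a
triangle outside of it, whose plane meets theirs in a line. -/
theorem desargues_of_forall_plane_ne_univ (h : ∀ a b c : H, a ≠ 0 → b ≠ 0 → c ≠ 0 →
    ¬ Col a b c → ∃ p, p ∉ plane a b c) :
    Desargues H := by
  intro o a b c a' b' c' x y z ho ha hb hc ha' hb' hc' hab hbc hca habc habc' hao hbo hco haa hbb
    hcc hoa hob hoc hx hx' hy hy' hz hz'
  have hS := isSubspace_plane o a b
  set S := plane o a b with hSdef
  have oS : o ∈ S := left_mem_plane o a b
  have aS : a ∈ S := mid_mem_plane o a b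
  have bS : b ∈ S := right_mem_plane o a b
  have aS' : a' ∈ S := hS.mem_of_tri oS aS hoa
  have bS' : b' ∈ S := hS.mem_of_tri oS bS hob
  have zS : z ∈ S := hS.mem_of_tri aS bS hz
  have huniq : ∀ w, Tri a b w → Tri a' b' w → w = z := fun w h3 h4 =>
    eq_of_tri_of_tri hab haa hoa hz hz' h3 h4
  refine Or.inr (Or.inr (Or.inr ?_))
  by_cases cS : c ∈ S
  · have cS' : c' ∈ S := hS.mem_of_tri oS cS hoc
    have xS : x ∈ S := hS.mem_of_tri bS cS hx
    have yS : y ∈ S := hS.mem_of_tri cS aS hy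
    -- lift the triangles to a triangle `A B C` outside of the plane `S`
    obtain ⟨p, hp⟩ := h o a b ho ha hb hab
    obtain ⟨p', hp'⟩ := exists_tri o p
    obtain ⟨A, hA, hA'⟩ := hoa.pasch hp'
    obtain ⟨B, hB, hB'⟩ := hob.pasch hp'
    obtain ⟨C, hC, hC'⟩ := hoc.pasch hp'
    have notMem : ∀ {s t : H}, s ∈ S → Tri s p t → t ∉ S := fun hs ht htS =>
      hp (hS.mem_of_tri hs htS ht.rot.swap)
    have lift : ∀ {a b a' b' z A B : H}, a ∈ S → b ∈ S → a' ∈ S → b' ∈ S →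
        Tri a p A → Tri a' p' A → Tri b p B → Tri b' p' B →
        (∀ w, Tri a b w → Tri a' b' w → w = z) → Tri A B z := by
      intro a b a' b' z A B aS bS aS' bS' hA hA' hB hB' hu
      have hA0 := notMem aS hA
      obtain ⟨w, hw, hw2⟩ := Tri.pasch (hA.swap) hB.swap
      obtain ⟨w', hw', hw2'⟩ := Tri.pasch (hA'.swap) hB'.swap
      have := hS.eq_of_tri hA0 (hS.mem_of_tri aS bS hw) (hS.mem_of_tri aS' bS' hw') hw2 hw2'
      subst this
      rwa [← hu w hw hw']
    have hABz := lift aS bS aS' bS' hA hA' hB hB' huniq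
    have hBCx : Tri B C x := lift bS cS bS' cS'
      hB hB' hC hC' fun w h3 h4 => eq_of_tri_of_tri hbc hbb hob hx hx' h3 h4
    have hCAy : Tri C A y := lift cS aS cS' aS'
      hC hC' hA hA' fun w h3 h4 => eq_of_tri_of_tri hca hcc hoc hy hy' h3 h4
    obtain ⟨w, hw, hw'⟩ := Tri.pasch hBCx.swap.rot.swap hCAy.rot.swap
    rwa [← hS.eq_of_tri (notMem aS hA) (hS.mem_of_tri xS yS hw) zS hw'.swap hABz]
  · have xS : x ∉ S := fun hxS => cS (hS.mem_of_tri bS hxS hx.rot.swap)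
    obtain ⟨w, hw, hw'⟩ := Tri.pasch hx.swap.rot.swap hy.rot.swap
    obtain ⟨w', hw2, hw2'⟩ := Tri.pasch hx'.swap.rot.swap hy'.rot.swap
    have := hS.eq_of_tri xS (hS.mem_of_tri bS aS hw') (hS.mem_of_tri bS' aS' hw2') hw hw2
    subst this
    rwa [← huniq w hw'.swap hw2'.swap]

end

section

variable {H : Type u} [CanonicalHypergroup H]

/-! ### The affine space of a hyperplane -/

/-- The points outside of a hyperplane `M`. -/
abbrev Aff (M : Set H) : Type u := {p : H // p ∉ M}

/-- The direction of the line through `p` and `q`: its point at infinity, or `0` if `p = q`. -/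
noncomputable def dir {M : Set H} (hM : IsHyperplane M) (p q : Aff M) : H :=
  (hM.exists_tri p q p.2 q.2).choose

variable {M : Set H} (hM : IsHyperplane M)

theorem dir_mem (p q : Aff M) : dir hM p q ∈ M := (hM.exists_tri p q p.2 q.2).choose_spec.1

theorem tri_dir (p q : Aff M) : Tri (p : H) q (dir hM p q) :=
  (hM.exists_tri p q p.2 q.2).choose_spec.2

variable [IsProjectiveHypergroup H]

theorem dir_eq {p q : Aff M} {m : H} (hm : m ∈ M) (h : Tri (p : H) q m) : dir hM p q = m :=
  hM.eq_of_tri p.2 (dir_mem hM p q) hm (tri_dir hM p q) h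

theorem dir_self (p : Aff M) : dir hM p p = 0 :=
  dir_eq hM hM.zero_mem (tri_self.2 (Or.inl rfl))

theorem dir_eq_zero {p q : Aff M} : dir hM p q = 0 ↔ p = q := by
  refine ⟨fun h => ?_, fun h => h ▸ dir_self hM p⟩
  have := tri_dir hM p q
  rw [h] at this
  exact Subtype.ext (tri_zero_right.1 this)

theorem dir_comm (p q : Aff M) : dir hM p q = dir hM q p :=
  dir_eq hM (dir_mem hM q p) (tri_dir hM q p).swap

theorem tri_dir_dir (p q r : Aff M) : Tri (dir hM p q) (dir hM q r) (dir hM p r) := by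
  obtain ⟨c, hc, hc'⟩ := Tri.pasch (tri_dir hM p q).swap (tri_dir hM q r)
  rwa [dir_eq hM (hM.mem_of_tri (dir_mem hM p q) (dir_mem hM q r) hc') hc]

/-- The line through `p` with direction `m` meets the line through `r` with direction `m'`, if both
are in a plane. -/
theorem exists_dir {p r : Aff M} {m m' : H} (hm : m ∈ M) (hm' : m' ∈ M)
    (h : Tri m m' (dir hM p r)) : ∃ q, dir hM p q = m ∧ dir hM q r = m' := by
  obtain ⟨q, hq, hq'⟩ := Tri.pasch (tri_dir hM p r).rot h.rot
  have hqM : q ∉ M := fun h => p.2 (hM.mem_of_tri hm h hq.rot.rot)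
  exact ⟨⟨q, hqM⟩, dir_eq hM hm hq.rot.swap, dir_eq hM hm' hq'.rot⟩

theorem exists_dir_eq (p : Aff M) {m : H} (hm : m ∈ M) : ∃ q, dir hM p q = m := by
  obtain ⟨q, hq, -⟩ := exists_dir hM (p := p) (r := p) hm hm
    (by rw [dir_self, tri_self]; exact Or.inl rfl)
  exact ⟨q, hq⟩

/-- A point is determined by the directions, if distinct, of the lines that join it to two given
points. -/
theorem eq_of_dir_eq {p r q q' : Aff M} (h : dir hM p q = dir hM p q')
    (h' : dir hM r q = dir hM r q') (hne : dir hM p q ≠ dir hM r q) : q = q' := by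
  have h1 := tri_dir_dir hM q p q'
  have h2 := tri_dir_dir hM q r q'
  rw [dir_comm hM q p, ← h, tri_self] at h1
  rw [dir_comm hM q r, ← h', tri_self] at h2
  rw [← dir_eq_zero hM]
  grind

/-! ### Perspectivities -/

/-- `y` is the image of `x` under the perspectivity with axis `M` and center `k` that maps `p`
to `p'`, provided that `x` is not on the line through `k`, `p` and `p'`. -/
def IsImg (k : H) (p p' x y : Aff M) : Prop :=
  Tri k (x : H) y ∧ dir hM p' y = dir hM p x

omit [IsProjectiveHypergroup H] in
theorem Aff.ne_zero (hM : IsHyperplane M) (p : Aff M) : (p : H) ≠ 0 :=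
  fun h => p.2 (h ▸ hM.zero_mem)

theorem ne_of_tri_of_ne {k x y : H} (hk : k ≠ 0) (hx : x ≠ 0) (h : Tri k x y) (hkx : x ≠ k) :
    y ≠ k ∧ y ≠ x := by
  constructor
  · rintro rfl
    rcases tri_self.1 h.rot with h | h
    exacts [hx h, hkx h]
  · rintro rfl
    rcases tri_self.1 h.rot.rot with h | h
    exacts [hk h, hkx h.symm]

theorem not_col_of_tri {k p p' x x' : H} (hk : k ≠ 0) (hp : p ≠ 0) (hx : x ≠ 0)
    (hpp : Tri k p p') (hxx : Tri k x x') (h : ¬ Col k p x) : ¬ Col k p' x' := by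
  intro h'
  have hpk := (ne_of_tri_of_ne hk hp hpp fun e => h (Or.inl e.symm)).1
  have hxk := (ne_of_tri_of_ne hk hx hxx fun e => h (Or.inr (Or.inr (Or.inl e.symm)))).1
  have h1 : Col k p' x := (h'.rot.swap.trans hxx.col.rot.swap hxk.symm)
  exact h (hpp.col.rot.swap.trans h1 hpk.symm)

theorem dir_eq_of_col {p q : Aff M} {m : H} (hm : m ∈ M) (hpq : p ≠ q) (h : Col (p : H) q m) :
    dir hM p q = m := by
  rcases h with h | h | h | h
  · exact absurd (Subtype.ext h) hpq
  · exact absurd (h ▸ hm) q.2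
  · exact absurd (h ▸ hm) p.2
  · exact dir_eq hM hm h

variable {k : H} (hk : k ≠ 0)

theorem exists_isImg {p p' x : Aff M} (hpp : Tri k (p : H) p') : ∃ y, IsImg hM k p p' x y := by
  obtain ⟨y, hy, hy'⟩ := Tri.pasch hpp.swap (tri_dir hM p x)
  have hyM : y ∉ M := fun h => p'.2 (hM.mem_of_tri (dir_mem hM p x) h hy'.rot.rot)
  exact ⟨⟨y, hyM⟩, hy, dir_eq hM (dir_mem hM p x) hy'.rot.swap⟩

include hk in
theorem IsImg.unique {p p' x y y' : Aff M} (hpp : Tri k (p : H) p')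
    (hx : ¬ Col k (p : H) x) (hy : IsImg hM k p p' x y) (hy' : IsImg hM k p p' x y') :
    y = y' := by
  by_contra hne
  have hpk : (p : H) ≠ k := fun h => hx (Or.inl h.symm)
  have hxk : (x : H) ≠ k := fun h => hx (Or.inr (Or.inr (Or.inl h.symm)))
  have hpk' := (ne_of_tri_of_ne hk (p.ne_zero hM) hpp hpk).1
  have hyk := (ne_of_tri_of_ne hk (x.ne_zero hM) hy.1 hxk).1
  have hne' : (y : H) ≠ y' := fun h => hne (Subtype.ext h)
  have h1 : Col k (y : H) y' := hy.1.col.trans hy'.1.col hxk.symm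
  have h2 : Col (p' : H) y y' := by
    have e1 := (tri_dir hM p' y).col
    have e2 := (tri_dir hM p' y').col
    rw [hy'.2, ← hy.2] at e2
    exact (e1.rot.swap).trans (e2.rot.swap) (fun h => p'.2 (h ▸ dir_mem hM _ _))
  have h3 : Col (y : H) k p' := Col.trans h1.rot.rot h2.rot.rot hne'
  have h4 : Col k (p' : H) x := h3.swap.trans hy.1.col.rot.swap hyk.symm
  exact hx ((hpp.col.rot.swap).trans h4 hpk'.symm)

include hk in
/-- The Desarguesian step: images under a perspectivity preserve directions. -/
theorem dir_eq_of_isImg (hD : Desargues H) {p p' x x' y y' : Aff M} (hpp : Tri k (p : H) p')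
    (hx : ¬ Col k (p : H) x) (hy : ¬ Col k (p : H) y) (hx' : IsImg hM k p p' x x')
    (hy' : IsImg hM k p p' y y') : dir hM x' y' = dir hM x y := by
  have hpk : (p : H) ≠ k := fun h => hx (Or.inl h.symm)
  have hxk : (x : H) ≠ k := fun h => hx (Or.inr (Or.inr (Or.inl h.symm)))
  have hyk : (y : H) ≠ k := fun h => hy (Or.inr (Or.inr (Or.inl h.symm)))
  obtain ⟨hpk', hpp'⟩ := (ne_of_tri_of_ne hk (p.ne_zero hM) hpp hpk)
  obtain ⟨hxk', hxx'⟩ := (ne_of_tri_of_ne hk (x.ne_zero hM) hx'.1 hxk)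
  obtain ⟨hyk', hyy'⟩ := (ne_of_tri_of_ne hk (y.ne_zero hM) hy'.1 hyk)
  by_cases hxy0 : x = y
  · subst hxy0
    rw [hx'.unique hM hk hpp hx hy', dir_self, dir_self]
  have hxy1 : (x : H) ≠ y := fun h => hxy0 (Subtype.ext h)
  have hx2 := not_col_of_tri hk (p.ne_zero hM) (x.ne_zero hM) hpp hx'.1 hx
  have hy2 := not_col_of_tri hk (p.ne_zero hM) (y.ne_zero hM) hpp hy'.1 hy
  have hxy' : x' ≠ y' := by
    rintro rfl
    exact hxy0 (IsImg.unique hM hk hpp.rot.swap hx2 ⟨hx'.1.rot.swap, hx'.2.symm⟩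
      ⟨hy'.1.rot.swap, hy'.2.symm⟩)
  by_cases hkxy : Col k (x : H) y
  -- both lines are the line through `k`, `x` and `y`
  · refine dir_eq_of_col hM (dir_mem hM x y) hxy' (Col.trans₃ hxk.symm hx'.1.col ?_ ?_)
    · exact hkxy.rot.swap.trans hy'.1.col hyk.symm
    · exact (hkxy.rot.rot.trans (tri_dir hM x y).col hxy1).swap
  have hpx : p ≠ x := fun h => hx (Or.inr (Or.inl (congrArg _ h)))
  have hpy : p ≠ y := fun h => hy (Or.inr (Or.inl (congrArg _ h)))
  by_cases hpxy : dir hM p x = dir hM p y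
  -- both lines have the direction of the line through `p`, `x` and `y`
  · have h1 := tri_dir_dir hM x p y
    have h2 := tri_dir_dir hM x' p' y'
    rw [dir_comm hM x p, ← hpxy, tri_self, dir_eq_zero] at h1
    rw [dir_comm hM x' p', hx'.2, hy'.2, ← hpxy, tri_self, dir_eq_zero] at h2
    rw [h1.resolve_left hxy0, h2.resolve_left hxy']
  obtain ⟨z, hz, hz'⟩ := Tri.pasch hx'.1 hy'.1
  have hpx' : p' ≠ x' := fun h => hx2 (Or.inr (Or.inl (congrArg _ h)))
  have hpy' : p' ≠ y' := fun h => hy2 (Or.inr (Or.inl (congrArg _ h)))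
  have hcol : ∀ {a b c : Aff M}, a ≠ b → a ≠ c → Col (a : H) b c → dir hM a c = dir hM a b :=
    fun {a b c} hab hac h => dir_eq_of_col hM (dir_mem hM a b) hac
      (h.trans (tri_dir hM a b).col fun e => hab (Subtype.ext e))
  have hzM : z ∈ M := by
    have := hD k p x y p' x' y' z (dir hM p y) (dir hM p x) hk (p.ne_zero hM) (x.ne_zero hM)
      (y.ne_zero hM) (p'.ne_zero hM) (x'.ne_zero hM) (y'.ne_zero hM) hx hkxy
      (fun h => hy h.rot.swap) (fun h => hpxy (hcol hpx hpy h).symm)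
      (fun h => hpxy (hx'.2 ▸ hy'.2 ▸ (hcol hpx' hpy' h).symm))
      hpk' hxk' hyk' hpp'.symm hxx'.symm hyy'.symm hpp hx'.1 hy'.1 hz hz'
      (tri_dir hM p y).swap (hy'.2 ▸ (tri_dir hM p' y').swap) (tri_dir hM p x)
      (hx'.2 ▸ (tri_dir hM p' x'))
    rcases this with h | h | h | h
    · exact h ▸ dir_mem hM _ _
    · exact absurd h.symm hpxy
    · exact h ▸ dir_mem hM _ _
    · exact hM.mem_of_tri (dir_mem hM _ _) (dir_mem hM _ _) h.rot.rot
  rw [dir_eq hM hzM hz, dir_eq hM hzM hz']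

/-- The hyperplane `M` contains at least a line. -/
def HasTwoPoints (M : Set H) : Prop := ∃ m ∈ M, ∃ m' ∈ M, m ≠ 0 ∧ m' ≠ 0 ∧ m ≠ m'

include hM in
/-- There are three lines through `k`, the first of which passes through `p`. -/
theorem exists_three_lines (h2 : HasTwoPoints M) (p : Aff M) (hpk : (p : H) ≠ k) :
    ∃ s : Fin 3 → Aff M, s 0 = p ∧ ∀ i j, i ≠ j → ¬ Col k (s i : H) (s j) := by
  obtain ⟨m, hm, hm0, hkm⟩ : ∃ m ∈ M, m ≠ 0 ∧ ¬ Col k (p : H) m := by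
    obtain ⟨m, hm, m', hm', h0, h0', hne⟩ := h2
    by_contra! hcon
    have h1 := hcon m hm h0
    have h2 := hcon m' hm' h0'
    rcases h1.swap.trans h2.swap hpk with h | h | h | h
    · exact p.2 (h ▸ hm)
    · exact hne h
    · exact p.2 (h ▸ hm')
    · exact p.2 (hM.mem_of_tri hm hm' h.rot.rot)
  obtain ⟨q, hq⟩ := exists_dir_eq hM p hm
  have hpq : p ≠ q := fun h => hm0 (hq ▸ (dir_eq_zero hM).2 h)
  have hpq' : (p : H) ≠ q := fun h => hpq (Subtype.ext h)
  have hT := tri_dir hM p q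
  rw [hq] at hT
  obtain ⟨r, hr, hrm⟩ := hT.exists_ne (p.ne_zero hM) (fun h => p.2 (h ▸ hm))
  have hrM : r ∉ M := fun h => hrm (hM.eq_of_tri p.2 h hm hr hT)
  have hpr := ne_of_tri_of_ne (p.ne_zero hM) (q.ne_zero hM) hr hpq'.symm
  have h01 : ¬ Col k (p : H) q := fun h => hkm (h.rot.rot.trans hT.col hpq').swap
  have h02 : ¬ Col k (p : H) r := fun h =>
    hkm (h.rot.rot.trans (hr.col.trans hT.col hpq') hpr.1.symm).swap
  have h12 : ¬ Col k (q : H) r := fun h => hkm (Col.trans₃ hpr.2.symm h.rot.rot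
    hr.col.rot.rot (hr.col.swap.trans hT.col.swap hpq'.symm))
  have hsymm : ∀ {a b : H}, ¬ Col k a b → ¬ Col k b a := fun h h' => h h'.rot.swap
  refine ⟨![p, q, ⟨r, hrM⟩], rfl, fun i j hij => ?_⟩
  fin_cases i <;> fin_cases j <;> first | exact absurd rfl hij | skip
  exacts [h01, h02, hsymm h01, h12, hsymm h02, hsymm h12]

include hk in
/-- A Desarguesian space has all perspectivities with axis `M`. The image of a point is constructed
from any of three lines through the center `k` that does not contain the point; of these three
lines, one avoids two given points, and Desargues' theorem shows that the choice is immaterial. -/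
theorem exists_perspectivity (hD : Desargues H) (h2 : HasTwoPoints M)
    {p p' : Aff M} (hpk : (p : H) ≠ k) (hpp : Tri k (p : H) p') :
    ∃ σ : Aff M → Aff M, (∀ x y, dir hM (σ x) (σ y) = dir hM x y) ∧ σ p = p' ∧
      (∀ x : Aff M, (x : H) = k → σ x = x) ∧ ∀ x : Aff M, (x : H) ≠ k → Tri k (x : H) (σ x) := by
  obtain ⟨s, hs0, hs⟩ := exists_three_lines hM h2 p hpk
  subst hs0
  obtain ⟨s', hs'0, hs'⟩ : ∃ s' : Fin 3 → Aff M, s' 0 = p' ∧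
      ∀ i j, i ≠ j → IsImg hM k (s i) (s' i) (s j) (s' j) := by
    obtain ⟨q', hq⟩ := exists_isImg hM (x := s 1) hpp
    obtain ⟨r', hr⟩ := exists_isImg hM (x := s 2) hpp
    have hqr := dir_eq_of_isImg hM hk hD hpp (hs 0 1 (by decide)) (hs 0 2 (by decide)) hq hr
    refine ⟨![p', q', r'], rfl, fun i j hij => ?_⟩
    fin_cases i <;> fin_cases j <;> first | exact absurd rfl hij | skip
    · exact hq
    · exact hr
    · exact ⟨hpp, by rw [dir_comm, dir_comm hM (s _)]; exact hq.2⟩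
    · exact ⟨hr.1, hqr⟩
    · exact ⟨hpp, by rw [dir_comm, dir_comm hM (s _)]; exact hr.2⟩
    · exact ⟨hq.1, by rw [dir_comm, dir_comm hM (s _)]; exact hqr⟩
  have hss : ∀ i, Tri k (s i : H) (s' i) := fun i => (hs' (i + 1) i (by fin_cases i <;> decide)).1
  have hone : ∀ {x : H}, x ≠ k → ∀ i j, Col k (s i : H) x → Col k (s j : H) x → i = j :=
    fun hx i j hi hj => by_contra fun hij =>
      hs i j hij (hi.rot.swap.trans hj.rot.swap hx.symm)
  have hoff : ∀ {x y : H}, x ≠ k → y ≠ k → ∃ i, ¬ Col k (s i : H) x ∧ ¬ Col k (s i : H) y := by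
    intro x y hx hy
    by_contra! hcon
    have hcon' : ∀ i, Col k (s i : H) x ∨ Col k (s i : H) y := fun i =>
      or_iff_not_imp_left.2 (hcon i)
    rcases hcon' 0 with h0 | h0 <;> rcases hcon' 1 with h1 | h1 <;> rcases hcon' 2 with h2 | h2 <;>
    first
    | exact absurd (hone hx 0 1 h0 h1) (by decide)
    | exact absurd (hone hx 0 2 h0 h2) (by decide)
    | exact absurd (hone hx 1 2 h1 h2) (by decide)
    | exact absurd (hone hy 0 1 h0 h1) (by decide)
    | exact absurd (hone hy 0 2 h0 h2) (by decide)
    | exact absurd (hone hy 1 2 h1 h2) (by decide)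
  have hcons : ∀ {x y : Aff M} {i j}, ¬ Col k (s i : H) x → ¬ Col k (s j : H) x →
      IsImg hM k (s i) (s' i) x y → IsImg hM k (s j) (s' j) x y := by
    intro x y i j hi hj h
    rcases eq_or_ne i j with rfl | hij
    · exact h
    · exact ⟨h.1, dir_eq_of_isImg hM hk hD (hss i) (hs i j hij) hi (hs' i j hij) h⟩
  have hex : ∀ x : Aff M, ∃ y : Aff M, ((x : H) = k → y = x) ∧
      ((x : H) ≠ k → Tri k (x : H) y ∧ ∀ i, ¬ Col k (s i : H) x → IsImg hM k (s i) (s' i) x y) := by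
    intro x
    by_cases hx : (x : H) = k
    · exact ⟨x, fun _ => rfl, fun h => absurd hx h⟩
    · obtain ⟨i, hi, -⟩ := hoff hx hx
      obtain ⟨y, hy⟩ := exists_isImg hM (x := x) (hss i)
      exact ⟨y, fun h => absurd h hx, fun _ => ⟨hy.1, fun j hj => hcons hi hj hy⟩⟩
  choose σ hσk hσ using hex
  have hcenter : ∀ x y : Aff M, (x : H) = k → (y : H) ≠ k → dir hM x (σ y) = dir hM x y := by
    intro x y hx hy
    refine dir_eq_of_col hM (dir_mem hM x y) ?_ ?_
    · rintro rfl
      exact (ne_of_tri_of_ne hk (y.ne_zero hM) (hσ y hy).1 hy).1 hx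
    · exact Col.trans (hx ▸ (hσ y hy).1.col) (tri_dir hM x y).col (fun h => hy (h ▸ hx))
  refine ⟨σ, fun x y => ?_, ?_, hσk, fun x hx => (hσ x hx).1⟩
  · by_cases hx : (x : H) = k
    · rw [hσk x hx]
      by_cases hy : (y : H) = k
      · rw [hσk y hy]
      · exact hcenter x y hx hy
    · by_cases hy : (y : H) = k
      · rw [hσk y hy, dir_comm, dir_comm hM x]
        exact hcenter y x hy hx
      · obtain ⟨i, hi, hi'⟩ := hoff hx hy
        exact dir_eq_of_isImg hM hk hD (hss i) hi hi' ((hσ x hx).2 i hi) ((hσ y hy).2 i hi')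
  · have h1 := hs 1 0 (by decide)
    exact ((hσ _ hpk).2 1 h1).unique hM hk (hss 1) h1 (hs'0 ▸ hs' 1 0 (by decide))

end

section

variable {H : Type u} [CanonicalHypergroup H] {M : Set H} (hM : IsHyperplane M)

/-! ### Translations -/

/-- Dilatations: permutations of the affine space that map lines to parallel lines. -/
def IsDil (σ : Equiv.Perm (Aff M)) : Prop := ∀ p q, dir hM (σ p) (σ q) = dir hM p q

/-- Translations: dilatations that move all points in the same direction. -/
def IsTrans (σ : Equiv.Perm (Aff M)) : Prop := IsDil hM σ ∧ ∃ c, ∀ p, dir hM p (σ p) = c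

variable {hM} in
theorem IsDil.mul {σ τ : Equiv.Perm (Aff M)} (hσ : IsDil hM σ) (hτ : IsDil hM τ) :
    IsDil hM (σ * τ) := fun p q => (hσ _ _).trans (hτ p q)

variable {hM} in
theorem IsDil.inv {σ : Equiv.Perm (Aff M)} (hσ : IsDil hM σ) : IsDil hM σ⁻¹ := fun p q => by
  have h : ∀ p, σ (σ⁻¹ p) = p := σ.apply_symm_apply
  rw [← hσ, h, h]

variable [IsProjectiveHypergroup H]

variable {hM}

theorem IsTrans.one : IsTrans hM 1 := ⟨fun _ _ => rfl, 0, fun p => dir_self hM p⟩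

theorem IsTrans.inv {σ : Equiv.Perm (Aff M)} (hσ : IsTrans hM σ) : IsTrans hM σ⁻¹ := by
  obtain ⟨h, c, hc⟩ := hσ
  refine ⟨h.inv, c, fun p => ?_⟩
  have h : σ (σ⁻¹ p) = p := σ.apply_symm_apply p
  rw [dir_comm, ← hc (σ⁻¹ p), h]

omit [IsProjectiveHypergroup H] in
theorem IsTrans.conj {σ τ : Equiv.Perm (Aff M)} (hτ : IsTrans hM τ) (hσ : IsDil hM σ) :
    IsTrans hM (σ * τ * σ⁻¹) := by
  obtain ⟨h, c, hc⟩ := hτ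
  refine ⟨(hσ.mul h).mul hσ.inv, c, fun p => ?_⟩
  have h : σ (σ⁻¹ p) = p := σ.apply_symm_apply p
  rw [← hc (σ⁻¹ p), ← hσ (σ⁻¹ p), h]
  rfl

/-- A dilatation without fixed points is a translation: two of the lines joining a point to its
image would otherwise meet in a fixed point. -/
theorem IsDil.isTrans {σ : Equiv.Perm (Aff M)} (hσ : IsDil hM σ) (hfix : ∀ p, σ p ≠ p) :
    IsTrans hM σ := by
  refine ⟨hσ, ?_⟩
  obtain ⟨p₀, hp₀⟩ := hM.exists_notMem
  suffices h : ∀ p q, dir hM p (σ p) = dir hM q (σ q) from ⟨_, fun p => h p ⟨p₀, hp₀⟩⟩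
  intro p q
  by_contra hne
  have h1 := tri_dir_dir hM p (σ p) (σ q)
  have h2 := tri_dir_dir hM p q (σ q)
  rw [hσ] at h1
  have h3 := ((h1.rot.rot).exch (h2.rot.swap)).resolve_left hne
  obtain ⟨x, hx, hx'⟩ := exists_dir hM (dir_mem hM _ _) (dir_mem hM _ _) h3.rot.rot
  have key : ∀ r, dir hM r x = dir hM r (σ r) → dir hM x (σ x) = dir hM r (σ r) := by
    intro r hr
    have h4 := tri_dir_dir hM r (σ r) (σ x)
    rw [hσ, hr, tri_self] at h4
    have h5 := tri_dir_dir hM x r (σ x)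
    have h6 : dir hM x (σ x) ≠ 0 := fun h => hfix x ((dir_eq_zero hM).1 h).symm
    rw [dir_comm hM x r, hr] at h5
    rcases h4 with h4 | h4 <;> rw [h4] at h5
    · exact (tri_zero_right.1 h5.rot.swap).symm
    · exact (tri_self.1 h5).resolve_left h6
  exact hne ((key p hx).symm.trans (key q (by rw [dir_comm, hx'])))

omit [IsProjectiveHypergroup H] in
theorem HasTwoPoints.exists_ne (h2 : HasTwoPoints M) (c : H) : ∃ m ∈ M, m ≠ 0 ∧ m ≠ c := by
  obtain ⟨m, hm, m', hm', h0, h0', hne⟩ := h2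
  by_cases h : m = c
  · exact ⟨m', hm', h0', fun h' => hne (h.trans h'.symm)⟩
  · exact ⟨m, hm, h0, h⟩

/-- A translation is determined by the image of one point. -/
theorem IsTrans.eq (h2 : HasTwoPoints M) {σ τ : Equiv.Perm (Aff M)} (hσ : IsTrans hM σ)
    (hτ : IsTrans hM τ) {p : Aff M} (h : σ p = τ p) : σ = τ := by
  obtain ⟨hσ, c, hc⟩ := hσ
  obtain ⟨hτ, c', hc'⟩ := hτ
  obtain rfl : c = c' := by rw [← hc p, ← hc' p, h]
  have key : ∀ p q, σ p = τ p → dir hM p q ≠ c → σ q = τ q := by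
    intro p q h hpq
    refine eq_of_dir_eq hM (p := q) (r := σ p) (by rw [hc, hc']) ?_ ?_
    · rw [hσ, h, hτ]
    · rw [hc, hσ]
      exact hpq.symm
  ext1 q
  by_cases hpq : dir hM p q = c
  · obtain ⟨m, hm, hm0, hmc⟩ := h2.exists_ne c
    obtain ⟨r, hr⟩ := exists_dir_eq hM p hm
    refine key r q (key p r h (by rwa [hr])) fun hrq => ?_
    have := tri_dir_dir hM p q r
    rw [hpq, dir_comm hM q r, hrq, tri_self, hr] at this
    tauto
  · exact key p q h hpq

theorem IsTrans.mul (h2 : HasTwoPoints M) {σ τ : Equiv.Perm (Aff M)} (hσ : IsTrans hM σ)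
    (hτ : IsTrans hM τ) : IsTrans hM (σ * τ) := by
  by_cases h : ∃ p, σ (τ p) = p
  · obtain ⟨p, hp⟩ := h
    have : τ = σ⁻¹ := hτ.eq h2 hσ.inv (p := p) (Equiv.Perm.eq_inv_iff_eq.2 hp)
    rw [this, mul_inv_cancel]
    exact .one
  · push Not at h
    exact (hσ.1.mul hτ.1).isTrans h

variable (hM) in
/-- The group of translations. -/
def transGroup (h2 : HasTwoPoints M) : Subgroup (Equiv.Perm (Aff M)) where
  carrier := {σ | IsTrans hM σ}
  mul_mem' := IsTrans.mul h2
  one_mem' := .one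
  inv_mem' := IsTrans.inv

/-- Translations in different directions commute. -/
theorem IsTrans.commute_of_ne {σ τ : Equiv.Perm (Aff M)} (hσ : IsTrans hM σ) (hτ : IsTrans hM τ)
    (p : Aff M) (h : dir hM p (σ p) ≠ dir hM p (τ p)) : σ (τ p) = τ (σ p) := by
  obtain ⟨hσ, c, hc⟩ := hσ
  obtain ⟨hτ, c', hc'⟩ := hτ
  -- both are the fourth vertex of the parallelogram on `p`, `σ p` and `τ p`
  refine eq_of_dir_eq hM (p := τ p) (r := σ p) ?_ ?_ ?_
  · rw [hc, hτ, hc]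
  · rw [hσ, hc', hc']
  · rw [hc, hσ, hc']
    rwa [hc, hc'] at h

/-- The translation group is regular on the points, if Desargues' property holds. -/
theorem exists_isTrans [Finite H] (hD : Desargues H) (h2 : HasTwoPoints M) (p p' : Aff M) :
    ∃ σ, IsTrans hM σ ∧ σ p = p' := by
  by_cases hpp : p = p'
  · exact ⟨1, .one, hpp⟩
  have hk : dir hM p p' ≠ 0 := fun h => hpp ((dir_eq_zero hM).1 h)
  have hne : ∀ x : Aff M, (x : H) ≠ dir hM p p' := fun x h => x.2 (h ▸ dir_mem hM p p')
  obtain ⟨σ, hσ, hp, -, hk'⟩ := exists_perspectivity hM hk hD h2 (hne p) (tri_dir hM p p').rot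
  have hinj : Function.Injective σ := fun x y h => by
    rw [← dir_eq_zero hM, ← hσ, h, dir_self]
  refine ⟨Equiv.ofBijective σ hinj.bijective_of_finite, ⟨hσ, dir hM p p', fun x => ?_⟩, hp⟩
  exact dir_eq hM (dir_mem hM p p') (hk' x (hne x)).rot.rot

/-- The dilatations that fix `o` act transitively on the points of each line through `o`, if
Desargues' property holds. -/
theorem exists_isDil [Finite H] (hD : Desargues H) (h2 : HasTwoPoints M) {o p p' : Aff M}
    (hpo : p ≠ o) (h : dir hM o p = dir hM o p') :
    ∃ σ, IsDil hM σ ∧ σ o = o ∧ σ p = p' := by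
  by_cases hpp : p = p'
  · exact ⟨1, fun _ _ => rfl, rfl, hpp⟩
  have ht : Tri (o : H) p p' := ((tri_dir hM o p).rot.swap.exch
    (h ▸ (tri_dir hM o p').rot.swap)).resolve_left fun h => hpp (Subtype.ext h)
  obtain ⟨σ, hσ, hp, ho, -⟩ := exists_perspectivity hM (o.ne_zero hM) hD h2
    (fun h => hpo (Subtype.ext h)) ht
  have hinj : Function.Injective σ := fun x y h => by
    rw [← dir_eq_zero hM, ← hσ, h, dir_self]
  exact ⟨Equiv.ofBijective σ hinj.bijective_of_finite, hσ, ho o rfl, hp⟩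

/-- Any two translations commute: for a common direction, compare with a translation in another
direction. -/
theorem IsTrans.commute [Finite H] (hD : Desargues H) (h2 : HasTwoPoints M)
    {σ τ : Equiv.Perm (Aff M)} (hσ : IsTrans hM σ) (hτ : IsTrans hM τ) : σ * τ = τ * σ := by
  obtain ⟨p₀, hp₀⟩ := hM.exists_notMem
  set p : Aff M := ⟨p₀, hp₀⟩
  have key : ∀ {σ τ}, IsTrans hM σ → IsTrans hM τ → dir hM p (σ p) ≠ dir hM p (τ p) →
      σ * τ = τ * σ := fun hσ hτ h =>
    (hσ.mul h2 hτ).eq h2 (hτ.mul h2 hσ) (p := p) (hσ.commute_of_ne hτ p h)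
  by_cases h : dir hM p (σ p) = dir hM p (τ p)
  · obtain ⟨m, hm, hm0, hmc⟩ := h2.exists_ne (dir hM p (σ p))
    obtain ⟨q, hq⟩ := exists_dir_eq hM p hm
    obtain ⟨ρ, hρ, hρp⟩ := exists_isTrans (hM := hM) hD h2 p q
    have h3 : σ * ρ = ρ * σ := key hσ hρ (by rw [hρp, hq]; exact hmc.symm)
    by_cases hτ1 : τ p = p
    · rw [hτ.eq h2 IsTrans.one hτ1]; simp
    -- `τ ρ` and `ρ` have a direction different from the one of `σ`
    have h4 : σ * (τ * ρ) = (τ * ρ) * σ := by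
      refine key hσ (hτ.mul h2 hρ) fun h5 => ?_
      have h6 := tri_dir_dir hM p (τ p) (τ (ρ p))
      rw [hτ.1, hρp, hq, ← h] at h6
      rw [Equiv.Perm.mul_apply, hρp] at h5
      rw [← h5] at h6
      have := tri_self.1 h6.rot.swap
      tauto
    rw [mul_assoc, ← h3, ← mul_assoc, ← mul_assoc] at h4
    exact mul_right_cancel h4
  · exact key hσ hτ h

/-! ### Affine coordinates -/

/-- Affine coordinates: the points outside of the hyperplane `M` are parametrized by an abelian
group `W`, and `δ` maps a difference of two points to the direction of the line that joins them. -/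
structure AffineCoords (M : Set H) (W : Type u) [AddCommGroup W] where
  /-- the point with given coordinates -/
  pt : W → H
  /-- the direction of a vector -/
  δ : W → H
  pt_injective : Function.Injective pt
  range_pt : Set.range pt = Mᶜ
  δ_mem : ∀ a, δ a ∈ M
  tri_pt : ∀ a b, Tri (pt a) (pt b) (δ (a - b))
  δ_eq_zero : ∀ {a}, δ a = 0 ↔ a = 0
  δ_neg : ∀ a, δ (-a) = δ a
  tri_δ : ∀ a b, Tri (δ a) (δ b) (δ (a + b))
  /-- a vector decomposes along two directions that are on a line with its own -/
  exists_add : ∀ {m m' c}, m ∈ M → m' ∈ M → Tri m m' (δ c) → ∃ a b, δ a = m ∧ δ b = m' ∧ a + b = c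
  /-- vectors with the same direction differ by an endomorphism that preserves all directions -/
  exists_hom : ∀ {a b}, a ≠ 0 → δ a = δ b → ∃ φ : W →+ W, (∀ x, δ (φ x) = δ x) ∧ φ a = b

/-- The translation group `W` provides affine coordinates. A dilatation that fixes the origin acts
on `W` by conjugation. -/
theorem exists_affineCoords [Finite H] (hM : IsHyperplane M) (hD : Desargues H)
    (h2 : HasTwoPoints M) :
    ∃ (W : Type u) (_ : AddCommGroup W) (_ : Finite W), Nonempty (AffineCoords M W) := by
  obtain ⟨p₀, hp₀⟩ := hM.exists_notMem
  set o : Aff M := ⟨p₀, hp₀⟩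
  let T := transGroup hM h2
  let _ : CommGroup T := { (inferInstance : Group T) with
    mul_comm := fun σ τ => Subtype.ext (σ.2.commute hD h2 τ.2) }
  let pt : T → Aff M := fun σ => σ.1 o
  have hpt : Function.Bijective pt := by
    refine ⟨fun σ τ h => Subtype.ext (σ.2.eq h2 τ.2 h), fun p => ?_⟩
    obtain ⟨σ, hσ, h⟩ := exists_isTrans (hM := hM) hD h2 o p
    exact ⟨⟨σ, hσ⟩, h⟩
  have hdir : ∀ σ τ : T, dir hM (pt σ) (pt τ) = dir hM o (pt (σ⁻¹ * τ)) := fun σ τ => by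
    rw [← σ.2.1 o]
    simp [pt]
  have hdir' : ∀ σ τ : T, dir hM (pt σ) (pt (σ * τ)) = dir hM o (pt τ) := fun σ τ => by
    rw [hdir, inv_mul_cancel_left]
  refine ⟨Additive T, inferInstance, inferInstance, ⟨{
    pt := fun a => (pt a.toMul : H)
    δ := fun a => dir hM o (pt a.toMul)
    pt_injective := fun a b h => hpt.1 (Subtype.ext h)
    range_pt := ?_
    δ_mem := fun a => dir_mem hM _ _
    tri_pt := ?_
    δ_eq_zero := ?_
    δ_neg := ?_
    tri_δ := ?_
    exists_add := ?_
    exists_hom := ?_ }⟩⟩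
  · ext x
    constructor
    · rintro ⟨a, rfl⟩
      exact (pt a.toMul).2
    · intro hx
      obtain ⟨σ, hσ⟩ := hpt.2 ⟨x, hx⟩
      exact ⟨Additive.ofMul σ, congrArg Subtype.val hσ⟩
  · intro a b
    have := tri_dir hM (pt b.toMul) (pt a.toMul)
    rw [hdir, mul_comm, ← div_eq_mul_inv] at this
    exact this.swap
  · intro a
    rw [dir_eq_zero]
    exact ⟨fun h => hpt.1 (h.symm.trans rfl : pt a.toMul = pt 1), fun h => by subst h; rfl⟩
  · intro a
    have := hdir' a.toMul (a.toMul)⁻¹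
    rw [mul_inv_cancel] at this
    exact this.symm.trans (dir_comm hM _ _)
  · intro a b
    have := tri_dir_dir hM o (pt a.toMul) (pt (a.toMul * b.toMul))
    rwa [hdir'] at this
  · intro m m' c hm hm' h
    obtain ⟨q, hq, hq'⟩ := exists_dir hM hm hm' h
    obtain ⟨σ, rfl⟩ := hpt.2 q
    refine ⟨Additive.ofMul σ, Additive.ofMul (σ⁻¹ * c.toMul), hq, ?_, ?_⟩
    · rw [← hq', hdir]; rfl
    · exact mul_inv_cancel_left σ c.toMul
  · intro a b ha h
    obtain ⟨Φ, hΦ, hΦo, hΦa⟩ := exists_isDil (hM := hM) hD h2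
      (fun h => ha (hpt.1 h : a.toMul = 1)) h
    let φ : T →* T :=
      { toFun := fun τ => ⟨Φ * τ.1 * Φ⁻¹, τ.2.conj hΦ⟩
        map_one' := Subtype.ext (by simp)
        map_mul' := fun σ τ => Subtype.ext (by simp [mul_assoc]) }
    have hφ : ∀ τ, pt (φ τ) = Φ (pt τ) := fun τ => by
      have : Φ⁻¹ o = o := Equiv.Perm.inv_eq_iff_eq.2 hΦo.symm
      exact congrArg (fun x => Φ (τ.1 x)) this
    refine ⟨MonoidHom.toAdditive φ, fun x => ?_, hpt.1 ((hφ a.toMul).trans hΦa)⟩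
    change dir hM o (pt (φ x.toMul)) = _
    have hΦo' : Φ o = o := hΦo
    have := hΦ o (pt x.toMul)
    rwa [hΦo', ← hφ] at this

end

section

variable {H : Type u} [CanonicalHypergroup H] {M : Set H}

/-! ### The field of scalars -/

section Scalars

variable [IsProjectiveHypergroup H] {W : Type u} [AddCommGroup W] (C : AffineCoords M W)

/-- The ring of the endomorphisms of `W` that preserve all directions. -/
def scalars : Subring (AddMonoid.End W) where
  carrier := {φ | ∀ a, φ a = 0 ∨ C.δ (φ a) = C.δ a}
  mul_mem' {φ ψ} hφ hψ a := by
    rcases hψ a with h | h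
    · left; simp [h]
    · rw [← h]; exact hφ (ψ a)
  one_mem' a := Or.inr rfl
  add_mem' {φ ψ} hφ hψ a := by
    change φ a + ψ a = 0 ∨ C.δ (φ a + ψ a) = _
    rcases hφ a with h | h
    · rw [h, zero_add]; exact hψ a
    rcases hψ a with h' | h'
    · rw [h', add_zero]; exact hφ a
    have := C.tri_δ (φ a) (ψ a)
    rwa [h, h', tri_self, C.δ_eq_zero] at this
  zero_mem' a := Or.inl rfl
  neg_mem' {φ} hφ a := by
    change -φ a = 0 ∨ C.δ (-φ a) = _
    rw [C.δ_neg, neg_eq_zero]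
    exact hφ a

variable {C}

theorem AffineCoords.exists_δ_eq {m : H} (hm : m ∈ M) : ∃ a, C.δ a = m := by
  obtain ⟨a, b, ha, -⟩ := C.exists_add (c := 0) hm hm
    (by rw [C.δ_eq_zero.2 rfl]; exact tri_self.2 (Or.inl rfl))
  exact ⟨a, ha⟩

/-- A scalar that annihilates a non-zero vector is zero. -/
theorem eq_zero_of_mem_scalars (h2 : HasTwoPoints M) {φ : AddMonoid.End W} (hφ : φ ∈ scalars C)
    {a : W} (ha : a ≠ 0) (h : φ a = 0) : φ = 0 := by
  have key : ∀ {a b : W}, a ≠ 0 → φ a = 0 → C.δ b ≠ C.δ a → φ b = 0 := by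
    intro a b ha h hab
    by_contra hb
    have h1 := (hφ b).resolve_left hb
    have h2 : φ (a + b) = φ b := by rw [map_add, h, zero_add]
    have h3 := (hφ (a + b)).resolve_left (by rwa [h2])
    rw [h2, h1] at h3
    have h4 := C.tri_δ a b
    rw [← h3] at h4
    rcases tri_self.1 h4.rot.rot with h5 | h5
    · exact ha (C.δ_eq_zero.1 h5)
    · exact hab h5.symm
  ext b
  by_cases hab : C.δ b = C.δ a
  · obtain ⟨m, hm, hm0, hma⟩ := h2.exists_ne (C.δ a)
    obtain ⟨c, rfl⟩ := C.exists_δ_eq hm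
    have hc : c ≠ 0 := fun h => hm0 (C.δ_eq_zero.2 h)
    exact key hc (key ha h hma) (by rw [hab]; exact hma.symm)
  · exact key ha h hab

/-- The scalars form a finite ring without zero divisors, hence a field, by Wedderburn's theorem. -/
theorem isField_scalars [Finite W] (h2 : HasTwoPoints M) : IsField (scalars C) := by
  have : Nontrivial (scalars C) := by
    obtain ⟨m, hm, -, -, h0, -⟩ := h2
    obtain ⟨a, rfl⟩ := C.exists_δ_eq hm
    refine ⟨0, 1, fun h => h0 (C.δ_eq_zero.2 ?_)⟩
    exact (congrArg (fun φ : scalars C => φ.1 a) h).symm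
  have : NoZeroDivisors (scalars C) := by
    refine ⟨fun {φ ψ} h => or_iff_not_imp_right.2 fun hψ => ?_⟩
    obtain ⟨a, ha⟩ : ∃ a, ψ.1 a ≠ 0 := by
      by_contra! hcon
      exact hψ (Subtype.ext (AddMonoidHom.ext hcon))
    refine Subtype.ext (eq_zero_of_mem_scalars h2 φ.2 ha ?_)
    exact congrArg (fun φ : scalars C => φ.1 a) h
  have : IsDomain (scalars C) := NoZeroDivisors.to_isDomain _
  have : Finite (AddMonoid.End W) := DFunLike.finite (AddMonoid.End W)
  exact Finite.isDomain_to_isField _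

/-- The vectors with a given direction form an orbit of the multiplicative group of a field. -/
theorem exists_field [Finite W] (C : AffineCoords M W) (h2 : HasTwoPoints M) :
    ∃ (K : Type u) (_ : Field K) (_ : Module K W), Finite K ∧
      (∀ a b, C.δ a = C.δ b ↔ ∃ k : K, k ≠ 0 ∧ b = k • a) := by
  let _ : Field (scalars C) := (isField_scalars (C := C) h2).toField
  refine ⟨scalars C, inferInstance, inferInstanceAs (Module (scalars C) W), ?_,
    fun a b => ⟨fun h => ?_, ?_⟩⟩
  · have : Finite (AddMonoid.End W) := DFunLike.finite (AddMonoid.End W)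
    infer_instance
  · by_cases ha : a = 0
    · have : C.δ b = 0 := by rw [← h, C.δ_eq_zero, ha]
      exact ⟨1, one_ne_zero, by rw [C.δ_eq_zero.1 this, ha, smul_zero]⟩
    · obtain ⟨φ, hφ, rfl⟩ := C.exists_hom ha h
      refine ⟨⟨φ, fun x => Or.inr (hφ x)⟩, fun h0 => ?_, rfl⟩
      have h1 : φ a = 0 := congrArg (fun φ : scalars C => φ.1 a) h0
      exact ha (C.δ_eq_zero.1 (by rw [← hφ, h1, C.δ_eq_zero]))
  · rintro ⟨k, hk, rfl⟩
    by_cases ha : a = 0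
    · rw [ha, smul_zero]
    · exact ((k.2 a).resolve_left fun h =>
        hk (Subtype.ext (eq_zero_of_mem_scalars h2 k.2 ha h))).symm

end Scalars

/-! ### Homogeneous coordinates -/

/-- Homogeneous coordinates: a map `π` from a vector space `V` over `K` that identifies the
hypergroup `H` with the set of orbits of `K^×` on `V`, the sum of two orbits being the set of the
orbits contained in their sum. -/
structure IsCoord {H : Type u} [CanonicalHypergroup H] (K : Type v) {V : Type v} [Field K]
    [AddCommGroup V] [Module K V] (π : V → H) : Prop where
  surjective : Function.Surjective π
  map_zero : π 0 = 0
  eq_iff : ∀ {u v}, π u = π v ↔ ∃ k : K, k ≠ 0 ∧ v = k • u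
  tri_iff : ∀ {u v w}, Tri (π u) (π v) (π w) ↔ ∃ k l : K, k ≠ 0 ∧ l ≠ 0 ∧ w = k • u + l • v

section Homogeneous

variable [IsProjectiveHypergroup H] {W : Type u} [AddCommGroup W] (C : AffineCoords M W)
  {K : Type u} [Field K] [Module K W]

open Classical in
/-- The point with homogeneous coordinates `(a, t)`. -/
noncomputable def homPt (v : W × K) : H := if v.2 = 0 then C.δ v.1 else C.pt (v.2⁻¹ • v.1)

/-- Up to a scalar, the last coordinate is `0` or `1`. -/
theorem exists_normal_form (v : W × K) :
    ∃ k : K, k ≠ 0 ∧ ∃ a : W, v = k • (a, (0 : K)) ∨ v = k • (a, (1 : K)) := by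
  by_cases h : v.2 = 0
  · exact ⟨1, one_ne_zero, v.1, Or.inl (by ext <;> simp [h])⟩
  · exact ⟨v.2, h, v.2⁻¹ • v.1, Or.inr (by ext <;> simp [h])⟩

variable {C} (hM : IsHyperplane M) (hK : ∀ a b, C.δ a = C.δ b ↔ ∃ k : K, k ≠ 0 ∧ b = k • a)

omit [IsProjectiveHypergroup H] in
include hK in
theorem δ_smul {k : K} (hk : k ≠ 0) (a : W) : C.δ (k • a) = C.δ a := ((hK _ _).2 ⟨k, hk, rfl⟩).symm

omit [IsProjectiveHypergroup H] in
include hK in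
theorem homPt_smul {k : K} (hk : k ≠ 0) (v : W × K) : homPt C (k • v) = homPt C v := by
  unfold homPt
  by_cases h : v.2 = 0
  · simp [h, δ_smul hK hk]
  · have : (k • v).2 ≠ 0 := mul_ne_zero hk h
    rw [if_neg h, if_neg this]
    congr 1
    simp only [Prod.smul_fst, Prod.smul_snd, smul_eq_mul, smul_smul]
    congr 1
    field_simp

omit [IsProjectiveHypergroup H] in
theorem homPt_zero (a : W) : homPt C (a, (0 : K)) = C.δ a := if_pos rfl

omit [IsProjectiveHypergroup H] in
theorem homPt_one (a : W) : homPt C (a, (1 : K)) = C.pt a := by simp [homPt]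

omit [IsProjectiveHypergroup H] in
theorem AffineCoords.pt_notMem (a : W) : C.pt a ∉ M := by
  have : C.pt a ∈ Mᶜ := C.range_pt ▸ Set.mem_range_self a
  exact this

omit [IsProjectiveHypergroup H] in
include hK in
theorem tri_δ_iff (a b c : W) :
    Tri (C.δ a) (C.δ b) (C.δ c) ↔ ∃ k l : K, k ≠ 0 ∧ l ≠ 0 ∧ c = k • a + l • b := by
  constructor
  · intro h
    obtain ⟨a', b', ha, hb, rfl⟩ := C.exists_add (C.δ_mem a) (C.δ_mem b) h
    obtain ⟨k, hk, rfl⟩ := (hK _ _).1 ha.symm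
    obtain ⟨l, hl, rfl⟩ := (hK _ _).1 hb.symm
    exact ⟨k, l, hk, hl, rfl⟩
  · rintro ⟨k, l, hk, hl, rfl⟩
    rw [← δ_smul hK hk a, ← δ_smul hK hl b]
    exact C.tri_δ _ _

include hM in
theorem tri_pt_δ_iff (a b c : W) : Tri (C.pt a) (C.pt b) (C.δ c) ↔ C.δ (a - b) = C.δ c := by
  constructor
  · exact fun h => hM.eq_of_tri (C.pt_notMem a) (C.δ_mem _) (C.δ_mem _) (C.tri_pt a b) h
  · exact fun h => h ▸ C.tri_pt a b

include hM hK in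
theorem tri_pt_iff (h2 : HasTwoPoints M) (a b c : W) : Tri (C.pt a) (C.pt b) (C.pt c) ↔
    ∃ k l : K, k ≠ 0 ∧ l ≠ 0 ∧ k + l = 1 ∧ c = k • a + l • b := by
  have hpt0 : ∀ a, C.pt a ≠ 0 := fun a h => C.pt_notMem a (h ▸ hM.zero_mem)
  have hself : Tri (C.pt a) (C.pt a) (C.pt c) ↔ c = a := by
    rw [tri_self, or_iff_right (hpt0 c)]
    exact C.pt_injective.eq_iff
  constructor
  · intro h
    by_cases hab : a = b
    · subst hab
      obtain rfl := hself.1 h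
      -- lines have at least four points, hence `K` has more than two elements
      obtain ⟨m, hm, -, -, h0, -⟩ := h2
      obtain ⟨d, rfl⟩ := C.exists_δ_eq hm
      obtain ⟨k, l, hk, hl, hd⟩ := (tri_δ_iff hK d d d).1 (tri_self.2 (Or.inr rfl))
      have hkl : (k + l - 1) • d = 0 := by rw [sub_smul, add_smul, ← hd, one_smul, sub_self]
      have hkl : k + l = 1 := sub_eq_zero.1
        ((smul_eq_zero.1 hkl).resolve_right fun h => h0 (C.δ_eq_zero.2 h))
      exact ⟨k, l, hk, hl, hkl, by rw [← add_smul, hkl, one_smul]⟩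
    · have h3 := ((C.tri_pt a b).exch h).resolve_left
        fun h => C.pt_notMem c (h ▸ C.δ_mem _)
      obtain ⟨l, hl, hc⟩ := (hK _ _).1 ((tri_pt_δ_iff hM a c (a - b)).1 h3.rot.swap).symm
      have hc' : c = (1 - l) • a + l • b := by
        rw [sub_smul, one_smul, sub_add, ← smul_sub, ← hc, sub_sub_cancel]
      refine ⟨1 - l, l, fun hl1 => ?_, hl, by ring, hc'⟩
      rw [← sub_eq_zero.1 hl1, sub_self, zero_smul, one_smul, zero_add] at hc'
      subst hc'
      rcases tri_self.1 h.rot.rot with h | h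
      exacts [hpt0 a h, hab (C.pt_injective h)]
  · rintro ⟨k, l, hk, hl, hkl, hc⟩
    by_cases hab : a = b
    · subst hab
      exact hself.2 (by rw [hc, ← add_smul, hkl, one_smul])
    · have h1 : a - c = l • (a - b) := by
        obtain rfl : k = 1 - l := eq_sub_of_add_eq hkl
        rw [hc]
        module
      have h3 : Tri (C.pt a) (C.pt c) (C.δ (a - b)) := by
        rw [tri_pt_δ_iff hM, h1, δ_smul hK hl]
      refine ((C.tri_pt a b).rot.swap.exch h3.rot.swap).resolve_left fun h => hab ?_
      have h4 : k • (a - b) = c - b := by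
        obtain rfl : k = 1 - l := eq_sub_of_add_eq hkl
        rw [hc]
        module
      rw [C.pt_injective h, sub_self] at h4
      rw [C.pt_injective h]
      exact sub_eq_zero.1 ((smul_eq_zero.1 h4).resolve_left hk)

include hM hK in
theorem isCoord_homPt (h2 : HasTwoPoints M) : IsCoord K (homPt C : W × K → H) where
  surjective x := by
    by_cases hx : x ∈ M
    · obtain ⟨a, rfl⟩ := C.exists_δ_eq hx
      exact ⟨(a, 0), homPt_zero a⟩
    · have : x ∈ Set.range C.pt := by rw [C.range_pt]; exact hx
      obtain ⟨a, rfl⟩ := this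
      exact ⟨(a, 1), homPt_one a⟩
  map_zero := (homPt_zero 0).trans (C.δ_eq_zero.2 rfl)
  eq_iff {u v} := by
    constructor
    · intro h
      obtain ⟨k, hk, a, hu⟩ := exists_normal_form u
      obtain ⟨l, hl, b, hv⟩ := exists_normal_form v
      suffices h' : ∃ j : K, j ≠ 0 ∧ l⁻¹ • v = j • k⁻¹ • u by
        obtain ⟨j, hj, h'⟩ := h'
        refine ⟨l * (j * k⁻¹), mul_ne_zero hl (mul_ne_zero hj (inv_ne_zero hk)), ?_⟩
        rw [mul_smul, mul_smul, ← h', smul_inv_smul₀ hl]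
      rcases hu with rfl | rfl <;> rcases hv with rfl | rfl <;>
        simp only [homPt_smul hK hk, homPt_smul hK hl, homPt_zero, homPt_one,
          inv_smul_smul₀ hk, inv_smul_smul₀ hl] at h ⊢
      · obtain ⟨j, hj, rfl⟩ := (hK _ _).1 h
        exact ⟨j, hj, by simp⟩
      · exact absurd (h ▸ C.δ_mem a) (C.pt_notMem b)
      · exact absurd (h ▸ C.δ_mem b) (C.pt_notMem a)
      · exact ⟨1, one_ne_zero, by rw [C.pt_injective h, one_smul]⟩
    · rintro ⟨k, hk, rfl⟩
      exact (homPt_smul hK hk u).symm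
  tri_iff {u v w} := by
    obtain ⟨k, hk, a, hu⟩ := exists_normal_form u
    obtain ⟨l, hl, b, hv⟩ := exists_normal_form v
    obtain ⟨j, hj, c, hw⟩ := exists_normal_form w
    have hscale : ∀ {u' v' w' : W × K}, u = k • u' → v = l • v' → w = j • w' →
        ((∃ k l : K, k ≠ 0 ∧ l ≠ 0 ∧ w = k • u + l • v) ↔
          ∃ k l : K, k ≠ 0 ∧ l ≠ 0 ∧ w' = k • u' + l • v') := by
      rintro u' v' w' rfl rfl rfl
      constructor
      · rintro ⟨p, q, hp, hq, h⟩
        refine ⟨j⁻¹ * (p * k), j⁻¹ * (q * l), by positivity, by positivity, ?_⟩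
        rw [mul_smul, mul_smul, mul_smul, mul_smul, ← smul_add, ← h, inv_smul_smul₀ hj]
      · rintro ⟨p, q, hp, hq, rfl⟩
        refine ⟨j * (p * k⁻¹), j * (q * l⁻¹), by positivity, by positivity, ?_⟩
        rw [smul_add, mul_smul, mul_smul, mul_smul, mul_smul, inv_smul_smul₀ hk, inv_smul_smul₀ hl]
    have hpδδ : ∀ a b c, ¬ Tri (C.pt a) (C.δ b) (C.δ c) := fun a b c h =>
      C.pt_notMem a (hM.mem_of_tri (C.δ_mem b) (C.δ_mem c) h.rot.rot)
    have hδpp : ∀ a b c, Tri (C.δ a) (C.pt b) (C.pt c) ↔ ∃ k : K, k ≠ 0 ∧ c = k • a + b := by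
      intro a b c
      rw [tri_rot_iff, tri_rot_iff, tri_pt_δ_iff hM, eq_comm, hK]
      constructor
      · rintro ⟨k, hk, h⟩
        exact ⟨-k, neg_ne_zero.2 hk, by rw [neg_smul, ← h]; abel⟩
      · rintro ⟨k, hk, rfl⟩
        exact ⟨-k, neg_ne_zero.2 hk, by module⟩
    rcases hu with hu | hu <;> rcases hv with hv | hv <;> rcases hw with hw | hw <;>
      rw [hscale hu hv hw] <;> subst hu hv hw <;>
      rw [homPt_smul hK hk, homPt_smul hK hl, homPt_smul hK hj] <;>
      simp only [homPt_zero, homPt_one, Prod.smul_mk, Prod.mk_add_mk, Prod.mk.injEq, smul_eq_mul, mul_zero,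
        mul_one, add_zero, zero_add, and_true]
    · exact tri_δ_iff hK a b c
    · exact iff_of_false (fun h => hpδδ _ _ _ h.rot) (by simp)
    · exact iff_of_false (fun h => hpδδ _ _ _ h.swap) (by grind)
    · rw [hδpp]
      constructor
      · rintro ⟨k, hk, h⟩
        exact ⟨k, 1, hk, one_ne_zero, by rw [h, one_smul], rfl⟩
      · rintro ⟨k, _, hk, -, h, rfl⟩
        exact ⟨k, hk, by rw [h, one_smul]⟩
    · exact iff_of_false (hpδδ _ _ _) (by grind)
    · rw [show Tri (C.pt a) (C.δ b) (C.pt c) ↔ Tri (C.δ b) (C.pt a) (C.pt c) from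
        ⟨Tri.swap, Tri.swap⟩, hδpp]
      constructor
      · rintro ⟨k, hk, h⟩
        exact ⟨1, k, one_ne_zero, hk, by rw [h, one_smul, add_comm], rfl⟩
      · rintro ⟨_, k, -, hk, h, rfl⟩
        exact ⟨k, hk, by rw [h, one_smul, add_comm]⟩
    · rw [tri_pt_δ_iff hM, hK]
      constructor
      · rintro ⟨k, hk, h⟩
        exact ⟨k, -k, hk, neg_ne_zero.2 hk, by rw [h]; module, by simp⟩
      · rintro ⟨k, l, hk, -, h, hkl⟩
        obtain rfl : l = -k := eq_neg_of_add_eq_zero_right hkl.symm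
        exact ⟨k, hk, by rw [h]; module⟩
    · rw [tri_pt_iff hM hK h2]
      simp only [and_comm, eq_comm]

end Homogeneous

/-- A finite Desarguesian geometry of dimension at least two has homogeneous coordinates. -/
theorem exists_isCoord [IsProjectiveHypergroup H] [Finite H] (hM : IsHyperplane M)
    (hD : Desargues H) (h2 : HasTwoPoints M) :
    ∃ (K V : Type u) (_ : Field K) (_ : AddCommGroup V) (_ : Module K V) (π : V → H),
      Finite V ∧ IsCoord K π := by
  obtain ⟨W, _, _, ⟨C⟩⟩ := exists_affineCoords hM hD h2
  obtain ⟨K, _, _, _, hK⟩ := exists_field C h2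
  exact ⟨K, W × K, _, _, _, homPt C, inferInstance, isCoord_homPt hM hK h2⟩

end

/-! ### Lifting automorphisms of the geometry to additive maps -/

section

section LinearAlgebra

variable {K : Type v} {V : Type w} [Field K] [AddCommGroup V] [Module K V]

theorem linearIndependent_triple_iff {x y z : V} : LinearIndependent K ![x, y, z] ↔
    ∀ a b c : K, a • x + b • y + c • z = 0 → a = 0 ∧ b = 0 ∧ c = 0 := by
  rw [Fintype.linearIndependent_iff]
  constructor
  · intro h a b c hs
    have := h ![a, b, c] (by simpa [Fin.sum_univ_three] using hs)
    exact ⟨this 0, this 1, this 2⟩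
  · intro h g hs i
    have := h (g 0) (g 1) (g 2) (by simpa [Fin.sum_univ_three] using hs)
    fin_cases i
    exacts [this.1, this.2.1, this.2.2]

theorem LinearIndependent.exists_eq_of_not_triple {e x y : V} (hx : LinearIndependent K ![e, x])
    (h : ¬ LinearIndependent K ![e, x, y]) : ∃ a b : K, y = a • e + b • x := by
  by_contra! hcon
  refine h (linearIndependent_triple_iff.2 fun a b c habc => ?_)
  have hc : c = 0 := by
    by_contra hc
    refine hcon (-(c⁻¹ * a)) (-(c⁻¹ * b)) ?_
    have : c • y = -(a • e + b • x) := eq_neg_of_add_eq_zero_right habc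
    rw [← inv_smul_smul₀ hc y, this]
    module
  subst hc
  have := LinearIndependent.pair_iff.1 hx a b (by simpa using habc)
  tauto

theorem LinearIndependent.triple_combination {e x w : V} (h : LinearIndependent K ![e, x, w])
    {a b : K} (hb : b ≠ 0) : LinearIndependent K ![e, a • e + b • x, w] :=
  linearIndependent_triple_iff.2 fun p q r h' => by
    obtain ⟨h1, h2, rfl⟩ := linearIndependent_triple_iff.1 h (p + q * a) (q * b) r
      (by rw [← h']; module)
    obtain rfl := (mul_eq_zero.1 h2).resolve_right hb
    exact ⟨by simpa using h1, rfl, rfl⟩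

theorem LinearIndependent.triple_add {e x w : V} (h : LinearIndependent K ![e, x, w]) (a b : K) :
    LinearIndependent K ![e, x, a • e + b • x + w] :=
  linearIndependent_triple_iff.2 fun p q r h' => by
    obtain ⟨h1, h2, rfl⟩ := linearIndependent_triple_iff.1 h (p + r * a) (q + r * b) r
      (by rw [← h']; module)
    exact ⟨by simpa using h1, by simpa using h2, rfl⟩

theorem LinearIndependent.pair_combination {e x : V} (h : LinearIndependent K ![e, x])
    {a b : K} (hb : b ≠ 0) : LinearIndependent K ![e, a • e + b • x] :=
  LinearIndependent.pair_iff.2 fun p q h' => by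
    obtain ⟨h1, h2⟩ := LinearIndependent.pair_iff.1 h (p + q * a) (q * b) (by rw [← h']; module)
    obtain rfl := (mul_eq_zero.1 h2).resolve_right hb
    exact ⟨by simpa using h1, rfl⟩

theorem LinearIndependent.ne_zero_of_pair_combination {e x : V} {a b : K}
    (h : LinearIndependent K ![e, a • e + b • x]) : b ≠ 0 := by
  rintro rfl
  have := LinearIndependent.pair_iff.1 h a (-1) (by module)
  exact one_ne_zero (neg_eq_zero.1 this.2)

theorem LinearIndependent.pair_of_triple {e x w : V} (h : LinearIndependent K ![e, x, w]) :
    LinearIndependent K ![e, x] :=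
  LinearIndependent.pair_iff.2 fun p q h' => by
    have := linearIndependent_triple_iff.1 h p q 0 (by simpa using h')
    exact ⟨this.1, this.2.1⟩

theorem LinearIndependent.triple_swap {e x w : V} (h : LinearIndependent K ![e, x, w]) :
    LinearIndependent K ![e, w, x] :=
  linearIndependent_triple_iff.2 fun p q r h' => by
    have := linearIndependent_triple_iff.1 h p r q (by rw [← h']; abel)
    tauto

/-- A map defined off a subgroup `E`, and additive as far as this makes sense, extends to an
additive map. -/
theorem exists_addMonoidHom_of_notMem {V V' : Type*} [AddCommGroup V] [AddCommGroup V']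
    (E : AddSubgroup V) (f₀ : V → V')
    (hf : ∀ x y, x ∉ E → y ∉ E → x + y ∉ E → f₀ (x + y) = f₀ x + f₀ y)
    (hE : ∀ x y, x ∉ E → y ∉ E → ∃ w, w ∉ E ∧ x + w ∉ E ∧ y + w ∉ E) (hE' : ∃ w, w ∉ E) :
    ∃ f : V →+ V', ∀ x, x ∉ E → f x = f₀ x := by
  obtain ⟨w₀, hw₀⟩ := hE'
  have hadd : ∀ {x w}, x ∈ E → w ∉ E → x + w ∉ E := fun hx hw h =>
    hw ((E.add_mem_cancel_left hx).1 h)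
  -- the value `f₀ (x + w) - f₀ w` for `x ∈ E` does not depend on `w`
  have hindep : ∀ x w w', x ∈ E → w ∉ E → w' ∉ E → f₀ (x + w) - f₀ w = f₀ (x + w') - f₀ w' := by
    have key : ∀ x w w', x ∈ E → w ∉ E → w' ∉ E → w + w' ∉ E →
        f₀ (x + w) - f₀ w = f₀ (x + w') - f₀ w' := by
      intro x w w' hx hw hw' hww
      have h1 := hf (x + w) w' (hadd hx hw) hw' (by rw [add_assoc]; exact hadd hx hww)
      have h2 := hf (x + w') w (hadd hx hw') hw (by rw [add_assoc, add_comm w']; exact hadd hx hww)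
      rw [add_right_comm, h1] at h2
      rw [sub_eq_sub_iff_add_eq_add, h2]
    intro x w w' hx hw hw'
    obtain ⟨z, hz, hwz, hwz'⟩ := hE w w' hw hw'
    rw [key x w z hx hw hz hwz, key x w' z hx hw' hz hwz']
  classical
  let f : V → V' := fun x => if x ∈ E then f₀ (x + w₀) - f₀ w₀ else f₀ x
  have hin : ∀ {x} w, x ∈ E → w ∉ E → f x = f₀ (x + w) - f₀ w := fun {x} w hx hw => by
    rw [show f x = f₀ (x + w₀) - f₀ w₀ from if_pos hx, hindep x w₀ w hx hw₀ hw]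
  have hout : ∀ {x}, x ∉ E → f x = f₀ x := fun hx => if_neg hx
  have hmix : ∀ x y, x ∈ E → y ∉ E → f (x + y) = f x + f y := fun x y hx hy => by
    rw [hout (hadd hx hy), hout hy, hin y hx hy, sub_add_cancel]
  refine ⟨AddMonoidHom.mk' f fun x y => ?_, fun x hx => hout hx⟩
  by_cases hx : x ∈ E <;> by_cases hy : y ∈ E
  · rw [hin w₀ (E.add_mem hx hy) hw₀, hin (y + w₀) hx (hadd hy hw₀), hin w₀ hy hw₀, add_assoc]
    abel
  · exact hmix x y hx hy
  · rw [add_comm, hmix y x hy hx, add_comm]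
  · by_cases hxy : x + y ∈ E
    · obtain ⟨w, hw, -, hyw⟩ := hE x y hx hy
      rw [hin w hxy hw, hout hx, hout hy, add_assoc,
        hf x (y + w) hx hyw (by rw [← add_assoc]; exact hadd hxy hw), hf y w hy hw hyw]
      abel
    · rw [hout hxy, hout hx, hout hy, hf x y hx hy hxy]

end LinearAlgebra

variable {H : Type u} [CanonicalHypergroup H] {K : Type v} {V : Type v} [Field K] [AddCommGroup V]
  [Module K V] {π : V → H}

namespace IsCoord

theorem map_eq_zero (hπ : IsCoord K π) {v : V} : π v = 0 ↔ v = 0 := by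
  rw [eq_comm, ← hπ.map_zero, hπ.eq_iff]
  exact ⟨fun ⟨k, _, h⟩ => by rw [h, smul_zero], fun h => ⟨1, one_ne_zero, by rw [h, smul_zero]⟩⟩

theorem map_smul (hπ : IsCoord K π) {k : K} (hk : k ≠ 0) (v : V) : π (k • v) = π v :=
  (hπ.eq_iff.2 ⟨k, hk, rfl⟩).symm

theorem tri_add (hπ : IsCoord K π) (u v : V) : Tri (π u) (π v) (π (u + v)) :=
  hπ.tri_iff.2 ⟨1, 1, one_ne_zero, one_ne_zero, by simp⟩

theorem linearIndependent_pair_iff (hπ : IsCoord K π) {u v : V} :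
    LinearIndependent K ![u, v] ↔ π u ≠ 0 ∧ π v ≠ 0 ∧ π u ≠ π v := by
  rw [LinearIndependent.pair_iff, Ne, Ne, Ne, hπ.map_eq_zero, hπ.map_eq_zero, hπ.eq_iff]
  constructor
  · intro h
    refine ⟨?_, ?_, ?_⟩
    · rintro rfl
      exact one_ne_zero (h 1 0 (by simp)).1
    · rintro rfl
      exact one_ne_zero (h 0 1 (by simp)).2
    · rintro ⟨k, -, rfl⟩
      exact one_ne_zero (neg_eq_zero.1 (h k (-1) (by simp)).2)
  · rintro ⟨hu, hv, huv⟩ a b h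
    by_cases hb : b = 0
    · subst hb
      simp only [zero_smul, add_zero, smul_eq_zero] at h
      exact ⟨h.resolve_right hu, rfl⟩
    · by_cases ha : a = 0
      · subst ha
        simp only [zero_smul, zero_add, smul_eq_zero] at h
        exact ⟨rfl, h.resolve_right hv⟩
      · refine absurd ⟨-(b⁻¹ * a), by simp [ha, hb], ?_⟩ huv
        rw [neg_smul, mul_smul, eq_neg_of_add_eq_zero_left h, smul_neg, inv_smul_smul₀ hb, neg_neg]

theorem linearIndependent_triple_iff (hπ : IsCoord K π) {u v w : V} :
    LinearIndependent K ![u, v, w] ↔ LinearIndependent K ![u, v] ∧ LinearIndependent K ![v, w] ∧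
      LinearIndependent K ![u, w] ∧ ¬ Tri (π u) (π v) (π w) := by
  simp only [ProjHyper.linearIndependent_triple_iff, LinearIndependent.pair_iff, hπ.tri_iff]
  constructor
  · intro h
    refine ⟨fun s t e => ?_, fun s t e => ?_, fun s t e => ?_, ?_⟩
    · have := h s t 0 (by simpa using e); tauto
    · have := h 0 s t (by simpa using e); tauto
    · have := h s 0 t (by simpa using e); tauto
    · rintro ⟨k, l, hk, -, rfl⟩
      exact hk (h k l (-1) (by module)).1
  · rintro ⟨h1, h2, h3, h4⟩ a b c h
    by_cases hc : c = 0
    · subst hc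
      have := h1 a b (by simpa using h); tauto
    by_cases ha : a = 0
    · subst ha
      have := h2 b c (by simpa using h); tauto
    by_cases hb : b = 0
    · subst hb
      have := h3 a c (by simpa using h); tauto
    refine absurd ⟨-(c⁻¹ * a), -(c⁻¹ * b), by simp [ha, hc], by simp [hb, hc], ?_⟩ h4
    have : c • w = -(a • u + b • v) := eq_neg_of_add_eq_zero_right h
    rw [← inv_smul_smul₀ hc w, this]
    module

/-- The fundamental theorem of projective geometry, for automorphisms: in dimension at least three,
an automorphism of the geometry is induced by an additive map, which may be prescribed on one
vector. -/
theorem exists_lift (hπ : IsCoord K π) (hdim : ∀ u v : V, LinearIndependent K ![u, v] →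
    ∃ w, LinearIndependent K ![u, v, w]) (hdim' : ∀ u : V, u ≠ 0 → ∃ v, LinearIndependent K ![u, v])
    {γ : H → H} (hγ0 : γ 0 = 0) (hγi : Function.Injective γ)
    (hγ : ∀ x y z, Tri (γ x) (γ y) (γ z) ↔ Tri x y z) {e e' : V} (he : e ≠ 0)
    (he' : π e' = γ (π e)) :
    ∃ f : V →+ V, f e = e' ∧ ∀ v, π (f v) = γ (π v) := by
  have hp2 : ∀ {u v u' v' : V}, LinearIndependent K ![u, v] → π u' = γ (π u) → π v' = γ (π v) →
      LinearIndependent K ![u', v'] := by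
    intro u v u' v' h hu hv
    rw [hπ.linearIndependent_pair_iff] at h ⊢
    rw [hu, hv, ← hγ0, hγi.ne_iff, hγi.ne_iff, hγi.ne_iff]
    exact h
  have hp3 : ∀ {u v w u' v' w' : V}, LinearIndependent K ![u, v, w] → π u' = γ (π u) →
      π v' = γ (π v) → π w' = γ (π w) → LinearIndependent K ![u', v', w'] := by
    intro u v w u' v' w' h hu hv hw
    rw [hπ.linearIndependent_triple_iff] at h ⊢
    refine ⟨hp2 h.1 hu hv, hp2 h.2.1 hv hw, hp2 h.2.2.1 hu hw, ?_⟩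
    rw [hu, hv, hw, hγ]
    exact h.2.2.2
  -- the image of a sum is a combination of the images
  have himg : ∀ {u v s u' v' s' : V}, π u' = γ (π u) → π v' = γ (π v) → π s' = γ (π s) →
      Tri (π u) (π v) (π s) → ∃ a b : K, a ≠ 0 ∧ b ≠ 0 ∧ s' = a • u' + b • v' := by
    intro u v s u' v' s' hu hv hs h
    rw [← hγ, ← hu, ← hv, ← hs, hπ.tri_iff] at h
    exact h
  have hex : ∀ x, ∃ y, LinearIndependent K ![e, x] →
      π y = γ (π x) ∧ π (e' + y) = γ (π (e + x)) := by
    intro x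
    obtain ⟨y, hy⟩ := hπ.surjective (γ (π x))
    obtain ⟨s, hs⟩ := hπ.surjective (γ (π (e + x)))
    obtain ⟨a, b, ha, hb, h⟩ := himg he' hy hs (hπ.tri_add e x)
    refine ⟨a⁻¹ • b • y, fun _ => ⟨?_, ?_⟩⟩
    · rw [hπ.map_smul (inv_ne_zero ha), hπ.map_smul hb, hy]
    · rw [← hs, h, ← hπ.map_smul (inv_ne_zero ha) (a • e' + b • y), smul_add, inv_smul_smul₀ ha]
  -- off the line `K e`, the lift is normalized by `π (e' + f₀ x) = γ (π (e + x))`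
  choose f₀ hf₀ using hex
  have huniq : ∀ {x y}, LinearIndependent K ![e, x] → π y = γ (π x) → π (e' + y) = γ (π (e + x)) →
      f₀ x = y := by
    intro x y hx hy hy'
    obtain ⟨h1, h2⟩ := hf₀ x hx
    obtain ⟨c, hc, h3⟩ := hπ.eq_iff.1 (hy.trans h1.symm)
    obtain ⟨d, hd, h4⟩ := hπ.eq_iff.1 (hy'.trans h2.symm)
    have h5 := LinearIndependent.pair_iff.1 (hp2 hx he' hy) (1 - d) (c - d) (by
      rw [h3] at h4
      rw [sub_smul, sub_smul, one_smul, sub_add_sub_comm, h4, smul_add, sub_self])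
    rw [h3, sub_eq_zero.1 h5.2, ← sub_eq_zero.1 h5.1, one_smul]
  have hadd3 : ∀ {x y}, LinearIndependent K ![e, x, y] → f₀ (x + y) = f₀ x + f₀ y := by
    intro x y hxy
    obtain ⟨hx, -, hy, -⟩ := hπ.linearIndependent_triple_iff.1 hxy
    have hlin := ProjHyper.linearIndependent_triple_iff.1 hxy
    have hexy : LinearIndependent K ![e, x + y] := LinearIndependent.pair_iff.2 fun s t h => by
      have := hlin s t t (by rw [← h]; module)
      tauto
    have hlin' := ProjHyper.linearIndependent_triple_iff.1 (hp3 hxy he' (hf₀ x hx).1 (hf₀ y hy).1)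
    obtain ⟨s, hs⟩ := hπ.surjective (γ (π (e + x + y)))
    obtain ⟨t, ht⟩ := hπ.surjective (γ (π (x + y)))
    obtain ⟨a, b, ha, hb, h1⟩ := himg (hf₀ x hx).2 (hf₀ y hy).1 hs (hπ.tri_add _ _)
    obtain ⟨c, d, hc, hd, h2⟩ := himg (hf₀ y hy).2 (hf₀ x hx).1 hs
      (by rw [add_right_comm]; exact hπ.tri_add _ _)
    have h3 : s = a • (e' + (f₀ x + f₀ y)) := by
      have := hlin' (a - c) (a - d) (b - c) (by
        rw [← sub_eq_zero.2 (h1.symm.trans h2)]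
        module)
      rw [h1, sub_eq_zero.1 this.2.2, sub_eq_zero.1 this.1]
      module
    obtain ⟨p, q, hp, hq, h4⟩ := himg (hf₀ x hx).1 (hf₀ y hy).1 ht (hπ.tri_add _ _)
    obtain ⟨m, n, hm, hn, h5⟩ := himg he' ht hs (by rw [add_assoc]; exact hπ.tri_add _ _)
    have h6 : a • (f₀ x + f₀ y) = n • t := by
      have := hlin' (a - m) (a - n * p) (a - n * q) (by
        rw [← sub_eq_zero.2 (h3.symm.trans h5), h4]
        module)
      rw [h4, smul_add, smul_add, smul_smul, smul_smul, ← sub_eq_zero.1 this.2.1,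
        ← sub_eq_zero.1 this.2.2]
    refine huniq hexy ?_ ?_
    · rw [← hπ.map_smul ha, h6, hπ.map_smul hn, ht]
    · rw [← hπ.map_smul ha, ← h3, hs, add_assoc]
  -- the general case of additivity, by means of an auxiliary vector
  have hadd : ∀ {x y}, LinearIndependent K ![e, x] → LinearIndependent K ![e, y] →
      LinearIndependent K ![e, x + y] → f₀ (x + y) = f₀ x + f₀ y := by
    intro x y hx hy hxy
    by_cases h : LinearIndependent K ![e, x, y]
    · exact hadd3 h
    obtain ⟨w, hw⟩ := hdim e x hx
    obtain ⟨a, b, rfl⟩ := LinearIndependent.exists_eq_of_not_triple hx h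
    have hb := LinearIndependent.ne_zero_of_pair_combination hy
    have hxab : x + (a • e + b • x) = a • e + (1 + b) • x := by module
    have hb1 : 1 + b ≠ 0 := LinearIndependent.ne_zero_of_pair_combination (hxab ▸ hxy)
    have h1 : LinearIndependent K ![e, x + (a • e + b • x), w] :=
      hxab ▸ LinearIndependent.triple_combination hw hb1
    have h2 := LinearIndependent.triple_add hw a b
    have h3 := LinearIndependent.triple_combination (a := a) hw hb
    have h4 := hadd3 h1
    rw [add_assoc, hadd3 h2, hadd3 h3, ← add_assoc] at h4
    exact (add_right_cancel h4).symm
  have hE : ∀ {x}, x ∉ (K ∙ e).toAddSubgroup ↔ LinearIndependent K ![e, x] := by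
    intro x
    rw [Submodule.mem_toAddSubgroup, Submodule.mem_span_singleton, LinearIndependent.pair_iff' he]
    simp
  obtain ⟨w, hw⟩ := hdim' e he
  obtain ⟨z, hz⟩ := hdim e w hw
  obtain ⟨f, hf⟩ := exists_addMonoidHom_of_notMem (K ∙ e).toAddSubgroup f₀
    (fun x y hx hy hxy => hadd (hE.1 hx) (hE.1 hy) (hE.1 hxy)) (fun x y hx hy => by
      simp only [hE] at hx hy ⊢
      by_cases h : LinearIndependent K ![e, x, y]
      · have hly := ProjHyper.linearIndependent_triple_iff.1 h
        refine ⟨x + y, ?_, ?_, ?_⟩ <;> refine LinearIndependent.pair_iff.2 fun s t h => ?_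
        · have := hly s t t (by rw [← h]; module); tauto
        · have := hly s (t + t) t (by rw [← h]; module); tauto
        · have := hly s t (t + t) (by rw [← h]; module); tauto
      · obtain ⟨w, hw⟩ := hdim e x hx
        obtain ⟨a, b, rfl⟩ := LinearIndependent.exists_eq_of_not_triple hx h
        have h1 := LinearIndependent.triple_add hw 0 1
        rw [zero_smul, zero_add, one_smul] at h1
        exact ⟨w, LinearIndependent.pair_of_triple (LinearIndependent.triple_swap hw),
          LinearIndependent.pair_of_triple (LinearIndependent.triple_swap h1),
          LinearIndependent.pair_of_triple (LinearIndependent.triple_swap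
            (LinearIndependent.triple_add hw a b))⟩) ⟨w, hE.2 hw⟩
  have hf' : ∀ {x}, LinearIndependent K ![e, x] → f x = f₀ x := fun hx => hf _ (hE.2 hx)
  have hze := LinearIndependent.pair_of_triple (LinearIndependent.triple_swap hz)
  have hlin := ProjHyper.linearIndependent_triple_iff.1 (hp3 hz he' (hf₀ w hw).1 (hf₀ z hze).1)
  have hfe : f e = e' := by
    have hew : LinearIndependent K ![e, e + w] := by
      simpa using LinearIndependent.pair_combination (a := (1 : K)) (b := 1) hw one_ne_zero
    have hewz : LinearIndependent K ![e, e + w, z] := by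
      simpa using LinearIndependent.triple_combination (a := (1 : K)) (b := 1) hz one_ne_zero
    have hwz : LinearIndependent K ![e, w + z] := by
      have := LinearIndependent.triple_add (LinearIndependent.triple_swap
        (LinearIndependent.triple_add hz 0 1)) 0 0
      simp only [zero_smul, zero_add, one_smul] at this
      exact LinearIndependent.pair_of_triple this
    obtain ⟨c, hc, h1⟩ := hπ.eq_iff.1 ((hf₀ w hw).2.trans (hf₀ _ hew).1.symm)
    have hewz' : LinearIndependent K ![e, e + w + z] := by
      have := LinearIndependent.triple_swap (LinearIndependent.triple_add hewz 0 1)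
      simp only [zero_smul, zero_add, one_smul] at this
      exact LinearIndependent.pair_of_triple this
    have h2 := (hf₀ _ hwz).2
    rw [← add_assoc, ← (hf₀ _ hewz').1, hadd3 hewz, hadd3 hz, h1] at h2
    obtain ⟨d, hd, h3⟩ := hπ.eq_iff.1 h2
    have h4 := hlin (c - d) (c - d) (1 - d) (by
      rw [← sub_eq_zero.2 h3]
      module)
    have h5 : f (e + w) = e' + f w := by
      rw [hf' hew, hf' hw, h1, sub_eq_zero.1 h4.1, ← sub_eq_zero.1 h4.2.2, one_smul]
    rw [map_add] at h5
    exact add_right_cancel h5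
  refine ⟨f, hfe, fun x => ?_⟩
  by_cases hx : LinearIndependent K ![e, x]
  · rw [hf' hx, (hf₀ x hx).1]
  obtain ⟨k, rfl⟩ : ∃ k : K, k • e = x := by
    have := hE.not.2 hx
    rwa [not_not, Submodule.mem_toAddSubgroup, Submodule.mem_span_singleton] at this
  by_cases hk : k = 0
  · rw [hk, zero_smul, f.map_zero, hπ.map_zero, hγ0]
  -- `f (k • e)` is in the span of `e'` and `f₀ w` for all `w` independent of `e`
  have key : ∀ w, LinearIndependent K ![e, w] →
      ∃ a b : K, a ≠ 0 ∧ f (k • e) = a • e' + (b - 1) • f₀ w := by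
    intro w hw
    have hkw : LinearIndependent K ![e, k • e + w] := by
      simpa using LinearIndependent.pair_combination (a := k) (b := 1) hw one_ne_zero
    obtain ⟨a, b, ha, hb, h⟩ := himg he' (hf₀ w hw).1 (hf₀ _ hkw).1
      (hπ.tri_iff.2 ⟨k, 1, hk, one_ne_zero, by rw [one_smul]⟩)
    refine ⟨a, b, ha, ?_⟩
    rw [← hf' hkw, map_add, hf' hw] at h
    rw [eq_sub_of_add_eq h]
    module
  obtain ⟨a, b, ha, h1⟩ := key w hw
  obtain ⟨a', b', -, h2⟩ := key z hze
  have h3 := hlin (a - a') (b - 1) (-(b' - 1)) (by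
    rw [← sub_eq_zero.2 (h1.symm.trans h2)]
    module)
  rw [h1, h3.2.1, zero_smul, add_zero, hπ.map_smul ha, hπ.map_smul hk, he']

end IsCoord

end

/-! ### The group of the lifted multiplications is commutative -/

section

/-- A functional equation for two endomorphisms of a field. -/
theorem eq_one_of_forall_add_mul_eq {K : Type v} [Field K] (τ ρ : K →+* K) {a b : K} (hb : b ≠ 0)
    (h : ∀ k, ρ k + b * (k * τ k) = k * ρ k + a * k) : (∀ k, τ k = k) ∧ a = 1 ∧ b = 1 := by
  have hab : a = b := by
    have := h 1
    simp only [map_one, mul_one] at this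
    linear_combination -this
  subst hab
  -- comparing the equations for `k` and `k + 1`
  have h1 : ∀ k, a * τ k = (a - 1) * k ^ 2 + k := by
    intro k
    have e1 := h k
    have e2 := h (k + 1)
    simp only [map_add, map_one] at e2
    linear_combination (1 - k) * (e2 - e1) + e1
  have ha : a = 1 := by
    by_contra hne
    have h01 : ∀ k : K, k = 0 ∨ k = 1 := by
      intro k
      have e1 := h1 k
      have e2 := h1 (k ^ 2)
      rw [map_pow] at e2
      have e3 : (a - 1) * (k ^ 2 * (k - 1) ^ 2) = 0 := by
        linear_combination (a * τ k + ((a - 1) * k ^ 2 + k)) * e1 - a * e2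
      have e4 := (mul_eq_zero.1 e3).resolve_left (sub_ne_zero.2 hne)
      rcases mul_eq_zero.1 e4 with e | e
      · exact Or.inl (pow_eq_zero_iff two_ne_zero |>.1 e)
      · exact Or.inr (sub_eq_zero.1 (pow_eq_zero_iff two_ne_zero |>.1 e))
    rcases h01 a with h | h
    exacts [hb h, hne h]
  subst ha
  exact ⟨fun k => by simpa using h1 k, rfl, rfl⟩

variable {H : Type u} [CommHyperfield H] {K : Type v} {V : Type v} [Field K] [AddCommGroup V]
  [Module K V] {π : V → H}

/-- The additive map `f` lifts the multiplication by `g`. -/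
def IsMulBy (π : V → H) (f : V →+ V) (g : H) : Prop := ∀ v, π (f v) = g * π v

theorem tri_mul_iff {g x y z : H} (hg : g ≠ 0) : Tri (g * x) (g * y) (g * z) ↔ Tri x y z := by
  unfold Tri
  rw [← Hyperring.mul_hadd]
  constructor
  · rintro ⟨w, hw, h⟩
    rwa [← mul_left_cancel₀ hg h]
  · exact fun h => ⟨z, h, rfl⟩

namespace IsCoord

variable (hπ : IsCoord K π)

include hπ in
theorem linearIndependent_map {f : V →+ V} {g : H} (hg : g ≠ 0) (hf : IsMulBy π f g) {u v : V}
    (h : LinearIndependent K ![u, v]) : LinearIndependent K ![f u, f v] := by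
  rw [hπ.linearIndependent_pair_iff] at h ⊢
  rw [hf, hf]
  exact ⟨mul_ne_zero hg h.1, mul_ne_zero hg h.2.1, fun h' => h.2.2 (mul_left_cancel₀ hg h')⟩

include hπ in
theorem linearIndependent_self_map {f : V →+ V} {g : H} (hg : g ≠ 0) (hg1 : g ≠ 1)
    (hf : IsMulBy π f g) {v : V} (hv : v ≠ 0) : LinearIndependent K ![v, f v] := by
  have hv' : π v ≠ 0 := fun h => hv (hπ.map_eq_zero.1 h)
  rw [hπ.linearIndependent_pair_iff, hf]
  exact ⟨hv', mul_ne_zero hg hv', fun h => hg1 (mul_right_cancel₀ hv' (by rw [one_mul, ← h]))⟩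

include hπ in
/-- Two lifts of the same multiplication are proportional. -/
theorem exists_eq_smul (hdim' : ∀ u : V, u ≠ 0 → ∃ v, LinearIndependent K ![u, v])
    {f f' : V →+ V} {g : H} (hg : g ≠ 0) (hf : IsMulBy π f g) (hf' : IsMulBy π f' g) :
    ∃ k : K, k ≠ 0 ∧ ∀ v, f v = k • f' v := by
  have h1 : ∀ v, ∃ k : K, k ≠ 0 ∧ f v = k • f' v := fun v =>
    hπ.eq_iff.1 ((hf' v).trans (hf v).symm)
  choose κ hκ0 hκ using h1
  have h2 : ∀ {u v}, LinearIndependent K ![u, v] → κ u = κ v := by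
    intro u v huv
    have := LinearIndependent.pair_iff.1 (hπ.linearIndependent_map hg hf' huv)
      (κ (u + v) - κ u) (κ (u + v) - κ v) (by
        have h := hκ (u + v)
        rw [map_add, map_add, hκ u, hκ v] at h
        rw [← sub_eq_zero.2 h.symm]
        module)
    rw [← sub_eq_zero.1 this.1, sub_eq_zero.1 this.2]
  by_cases hV : ∀ u : V, u = 0
  · exact ⟨1, one_ne_zero, fun v => by rw [hV v, _root_.map_zero, _root_.map_zero, smul_zero]⟩
  push Not at hV
  obtain ⟨u, hu⟩ := hV
  refine ⟨κ u, hκ0 u, fun v => ?_⟩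
  by_cases hv : v = 0
  · rw [hv, _root_.map_zero, _root_.map_zero, smul_zero]
  suffices κ v = κ u by rw [← this, hκ v]
  obtain ⟨w, hw⟩ := hdim' u hu
  by_cases huv : LinearIndependent K ![u, v]
  · exact (h2 huv).symm
  · rw [h2 hw]
    refine h2 ?_
    have hw' := hπ.linearIndependent_pair_iff.1 hw
    rw [hπ.linearIndependent_pair_iff] at huv ⊢
    have hv' : π v ≠ 0 := fun h => hv (hπ.map_eq_zero.1 h)
    have : π u = π v := by tauto
    exact ⟨hv', hw'.2.1, this ▸ hw'.2.2⟩

include hπ in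
/-- A lift of a multiplication is semilinear. -/
theorem exists_ringHom (hdim' : ∀ u : V, u ≠ 0 → ∃ v, LinearIndependent K ![u, v])
    {f : V →+ V} {g : H} (hg : g ≠ 0) (hf : IsMulBy π f g) {u : V} (hu : u ≠ 0) :
    ∃ σ : K →+* K, ∀ k v, f (k • v) = σ k • f v := by
  have h1 : ∀ k : K, ∃ k' : K, ∀ v, f (k • v) = k' • f v := by
    intro k
    by_cases hk : k = 0
    · exact ⟨0, fun v => by rw [hk, zero_smul, zero_smul, _root_.map_zero]⟩
    · obtain ⟨k', -, h⟩ := hπ.exists_eq_smul hdim' (f := f.comp (DistribSMul.toAddMonoidHom V k))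
        hg (fun v => by
          change π (f (k • v)) = _
          rw [hf, hπ.map_smul hk]) hf
      exact ⟨k', h⟩
  choose σ hσ using h1
  have hfu : f u ≠ 0 := fun h => by
    have := hf u
    rw [h, hπ.map_zero, eq_comm, mul_eq_zero, hπ.map_eq_zero] at this
    tauto
  have hinj : ∀ {a b : K}, a • f u = b • f u → a = b := fun h => smul_left_injective K hfu h
  exact ⟨{
    toFun := σ
    map_one' := hinj (by rw [← hσ, one_smul, one_smul])
    map_mul' := fun a b => hinj (by rw [← hσ, mul_smul, mul_smul, hσ, hσ])
    map_zero' := hinj (by rw [← hσ, zero_smul, zero_smul, _root_.map_zero])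
    map_add' := fun a b => hinj (by rw [← hσ, add_smul, add_smul, map_add, hσ, hσ]) }, hσ⟩

include hπ in
/-- Lifts of multiplications commute up to a scalar, since the multiplications commute. -/
theorem exists_commutator (hdim' : ∀ u : V, u ≠ 0 → ∃ v, LinearIndependent K ![u, v])
    {f f' : V →+ V} {g g' : H} (hg : g ≠ 0) (hg' : g' ≠ 0) (hf : IsMulBy π f g)
    (hf' : IsMulBy π f' g') : ∃ k : K, k ≠ 0 ∧ ∀ v, f (f' v) = k • f' (f v) :=
  hπ.exists_eq_smul hdim' (f := f.comp f') (f' := f'.comp f) (mul_ne_zero hg hg')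
    (fun v => by
      change π (f (f' v)) = _
      rw [hf, hf', mul_assoc])
    (fun v => by
      change π (f' (f v)) = _
      rw [hf', hf, mul_left_comm, mul_assoc])

/-! #### Two lifts `M` and `N` of the multiplications by `g` and an element of `1 + g` -/

section Pair

variable {M N : V →+ V} {g g' : H} (hg : g ≠ 0) (hg1 : g ≠ 1) (hM : IsMulBy π M g)
  (hN : IsMulBy π N g') {τ ρ : K →+* K} (hτ : ∀ k v, M (k • v) = τ k • M v)
  (hρ : ∀ k v, N (k • v) = ρ k • N v)
  (hMN : ∀ z, ∃ a b : K, b ≠ 0 ∧ N z = a • z + b • M z)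

include hτ hρ hMN in
/-- If `N z = z + M z`, and `z`, `M z`, `z'`, `M z'` are independent, then `N z' = z' + M z'`, and
`M` is linear: compare the values of `N` on `z`, `z'`, `k • z'` and their sums. -/
theorem eq_add_of_independent {z z' : V} (hz : N z = z + M z)
    (hind : ∀ a b c d : K, a • z + b • M z + c • z' + d • M z' = 0 →
      a = 0 ∧ b = 0 ∧ c = 0 ∧ d = 0) :
    N z' = z' + M z' ∧ ∀ k, τ k = k := by
  have key : ∀ z', (∀ a b c d : K, a • z + b • M z + c • z' + d • M z' = 0 →
      a = 0 ∧ b = 0 ∧ c = 0 ∧ d = 0) → N z' = z' + M z' := by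
    intro z' hind
    obtain ⟨a, b, -, h1⟩ := hMN z'
    obtain ⟨c, d, -, h2⟩ := hMN (z + z')
    rw [map_add, map_add, hz, h1] at h2
    obtain ⟨e1, e2, e3, e4⟩ := hind (1 - c) (1 - d) (a - c) (b - d) (by
      rw [← sub_eq_zero.2 h2]
      module)
    rw [h1, sub_eq_zero.1 e3, sub_eq_zero.1 e4, ← sub_eq_zero.1 e1, ← sub_eq_zero.1 e2, one_smul,
      one_smul]
  refine ⟨key z' hind, fun k => ?_⟩
  by_cases hk : k = 0
  · rw [hk, _root_.map_zero]
  have h1 := key (k • z') (fun a b c d h => by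
    rw [hτ] at h
    obtain ⟨ha, hb, hc, hd⟩ := hind a b (c * k) (d * τ k) (by rw [← h]; module)
    exact ⟨ha, hb, (mul_eq_zero.1 hc).resolve_right hk,
      (mul_eq_zero.1 hd).resolve_right (by simpa using hk)⟩)
  rw [hρ, hτ, key z' hind] at h1
  obtain ⟨-, -, h2, h3⟩ := hind 0 0 (ρ k - k) (ρ k - τ k) (by
    rw [← sub_eq_zero.2 h1]
    module)
  rw [← sub_eq_zero.1 h3, sub_eq_zero.1 h2]

include hτ hρ hMN in
/-- If `N e = e + M e`, and `e`, `M e`, `M (M e)` are independent, then `M e` has the same property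
as `e`, and `M` is linear: compare the values of `N` on `e`, `M e` and `k • e + M e`. -/
theorem eq_add_of_cyclic {e : V} (he : N e = e + M e)
    (hind : LinearIndependent K ![e, M e, M (M e)]) :
    N (M e) = M e + M (M e) ∧ ∀ k, τ k = k := by
  obtain ⟨a, b, hb, h1⟩ := hMN (M e)
  obtain ⟨h2, rfl, rfl⟩ := eq_one_of_forall_add_mul_eq τ ρ (a := a) hb fun k => by
    obtain ⟨c, d, -, h2⟩ := hMN (k • e + M e)
    rw [map_add, map_add, hρ, hτ, he, h1] at h2
    obtain ⟨e1, e2, e3⟩ := ProjHyper.linearIndependent_triple_iff.1 hind (ρ k - c * k)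
      (ρ k + a - (c + d * τ k)) (b - d) (by
        rw [← sub_eq_zero.2 h2]
        module)
    linear_combination e1 - k * e2 + k * τ k * e3
  exact ⟨by rw [h1, one_smul, one_smul], h2⟩

end Pair

section Commutative

variable (hdim : ∀ u v : V, LinearIndependent K ![u, v] → ∃ w, LinearIndependent K ![u, v, w])
  (hdim' : ∀ u : V, u ≠ 0 → ∃ v, LinearIndependent K ![u, v])
  (hlift : ∀ u v : V, u ≠ 0 → v ≠ 0 → ∃ (f : V →+ V) (g : H), g ≠ 0 ∧ IsMulBy π f g ∧ f u = v)

include hπ in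
theorem ne_one_of_linearIndependent {f : V →+ V} {g : H} (hf : IsMulBy π f g) {e : V}
    (h : LinearIndependent K ![e, f e]) : g ≠ 1 := by
  rintro rfl
  rw [hπ.linearIndependent_pair_iff, hf, one_mul] at h
  exact h.2.2 rfl

include hπ in
theorem map_ne_zero {f : V →+ V} {g : H} (hg : g ≠ 0) (hf : IsMulBy π f g) {v : V} (hv : v ≠ 0) :
    f v ≠ 0 := fun h => by
  have := hf v
  rw [h, hπ.map_zero, eq_comm, mul_eq_zero, hπ.map_eq_zero] at this
  tauto

include hπ in
/-- If `N` maps one vector `e` to `e + M e`, then `N z` is a combination of `z` and `M z` for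
every `z`. -/
theorem exists_combination {M N : V →+ V} {g g' : H} (hM : IsMulBy π M g) (hN : IsMulBy π N g')
    {e : V} (he : e ≠ 0) (hNe : N e = e + M e) (z : V) :
    ∃ a b : K, b ≠ 0 ∧ N z = a • z + b • M z := by
  by_cases hz : z = 0
  · exact ⟨1, 1, one_ne_zero, by simp [hz]⟩
  have he0 : π e ≠ 0 := fun h => he (hπ.map_eq_zero.1 h)
  have hz0 : π z ≠ 0 := fun h => hz (hπ.map_eq_zero.1 h)
  have h1 := hπ.tri_add e (M e)
  rw [← hNe, hM, hN, mul_comm g, mul_comm g',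
    ← tri_mul_iff (mul_ne_zero hz0 (inv_ne_zero he0))] at h1
  simp only [mul_assoc, inv_mul_cancel_left₀ he0, inv_mul_cancel₀ he0, mul_one] at h1
  rw [mul_comm _ g, mul_comm _ g', ← hM, ← hN, hπ.tri_iff] at h1
  obtain ⟨a, b, -, hb, h⟩ := h1
  exact ⟨a, b, hb, h⟩

include hπ hdim' in
/-- If the line through `e` and `M e` is invariant under `M`, then it is disjoint from its other
translates. -/
theorem independent_of_invariant {M h : V →+ V} {g g' : H} (hg : g ≠ 0) (hM : IsMulBy π M g)
    (hg' : g' ≠ 0) (hh : IsMulBy π h g') {e : V} (he : LinearIndependent K ![e, M e])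
    (hinv : M (M e) ∈ Submodule.span K {e, M e}) (hhe : h e ∉ Submodule.span K {e, M e}) :
    ∀ a b c d : K, a • e + b • M e + c • h e + d • M (h e) = 0 →
      a = 0 ∧ b = 0 ∧ c = 0 ∧ d = 0 := by
  have he0 : e ≠ 0 := fun h0 => by
    have := (hπ.linearIndependent_pair_iff.1 he).1
    rw [h0, hπ.map_zero] at this
    exact this rfl
  obtain ⟨τ, hτ⟩ := hπ.exists_ringHom hdim' hg hM he0
  obtain ⟨σ, hσ⟩ := hπ.exists_ringHom hdim' hg' hh he0
  obtain ⟨l, hl, hMh⟩ := hπ.exists_commutator hdim' hg hg' hM hh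
  set E := Submodule.span K {e, M e} with hE
  have heE : e ∈ E := Submodule.subset_span (by simp)
  have hMeE : M e ∈ E := Submodule.subset_span (by simp)
  have hME : ∀ u ∈ E, M u ∈ E := by
    intro u hu
    obtain ⟨a, b, rfl⟩ := Submodule.mem_span_pair.1 hu
    rw [map_add, hτ, hτ]
    exact E.add_mem (E.smul_mem _ hMeE) (E.smul_mem _ hinv)
  have hlin : LinearIndependent K ![h e, M (h e)] :=
    hπ.linearIndependent_self_map hg (hπ.ne_one_of_linearIndependent hM he) hM
      (hπ.map_ne_zero hg' hh he0)
  obtain ⟨p, q, hpq⟩ : ∃ p q : K, M (M (h e)) = p • h e + q • M (h e) := by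
    obtain ⟨p, q, hpq⟩ := Submodule.mem_span_pair.1 hinv
    refine ⟨τ l * l * σ p, τ l * σ q, ?_⟩
    rw [hMh e, hτ, hMh (M e), ← hpq, map_add, hσ, hσ]
    module
  intro a b c d habcd
  have hd : d = 0 := by
    by_contra hd
    obtain ⟨x, u, hu, hx⟩ : ∃ (x : K) (u : V), u ∈ E ∧ M (h e) = x • h e + u := by
      refine ⟨-(d⁻¹ * c), -(d⁻¹ • (a • e + b • M e)), E.neg_mem (E.smul_mem _
        (E.add_mem (E.smul_mem _ heE) (E.smul_mem _ hMeE))), ?_⟩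
      have : d • M (h e) = -(a • e + b • M e + c • h e) := eq_neg_of_add_eq_zero_right habcd
      rw [← inv_smul_smul₀ hd (M (h e)), this]
      module
    have hu0 : u ≠ 0 := by
      rintro rfl
      have := LinearIndependent.pair_iff.1 hlin x (-1) (by rw [hx]; module)
      exact one_ne_zero (neg_eq_zero.1 this.2)
    -- `M` acts on `V / E`, whence `M u` is a multiple of `u`
    have h1 : M u = (p + (q - τ x) * x) • h e + (q - τ x) • u := by
      have h2 := congrArg M hx
      rw [map_add, hτ, hpq, hx] at h2
      rw [← add_right_inj (τ x • (x • h e + u)), ← h2]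
      module
    have h2 : p + (q - τ x) * x = 0 := by
      by_contra hne
      refine hhe ((E.smul_mem_iff hne).1 ?_)
      rw [eq_sub_of_add_eq h1.symm]
      exact E.sub_mem (hME u hu) (E.smul_mem _ hu)
    rw [h2, zero_smul, zero_add] at h1
    have := LinearIndependent.pair_iff.1 (hπ.linearIndependent_self_map hg
      (hπ.ne_one_of_linearIndependent hM he) hM hu0) (q - τ x) (-1) (by rw [h1]; module)
    exact one_ne_zero (neg_eq_zero.1 this.2)
  subst hd
  have hc : c = 0 := by
    by_contra hc
    refine hhe ((E.smul_mem_iff hc).1 ?_)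
    have : c • h e = -(a • e + b • M e) := eq_neg_of_add_eq_zero_right (by simpa using habcd)
    rw [this]
    exact E.neg_mem (E.add_mem (E.smul_mem _ heE) (E.smul_mem _ hMeE))
  subst hc
  have := LinearIndependent.pair_iff.1 he a b (by simpa using habcd)
  tauto

/-- A vector outside of the line through `e` and `M e`. -/
theorem exists_notMem_span_pair (hdim : ∀ u v : V, LinearIndependent K ![u, v] →
    ∃ w, LinearIndependent K ![u, v, w]) {u v : V} (huv : LinearIndependent K ![u, v]) :
    ∃ w, w ∉ Submodule.span K {u, v} := by
  obtain ⟨w, hw⟩ := hdim u v huv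
  refine ⟨w, fun h => ?_⟩
  obtain ⟨a, b, rfl⟩ := Submodule.mem_span_pair.1 h
  have := ProjHyper.linearIndependent_triple_iff.1 hw a b (-1) (by module)
  exact one_ne_zero (neg_eq_zero.1 this.2.2)

theorem mem_span_pair_of_not_triple {u v w : V} (huv : LinearIndependent K ![u, v])
    (h : ¬ LinearIndependent K ![u, v, w]) : w ∈ Submodule.span K {u, v} := by
  obtain ⟨a, b, rfl⟩ := LinearIndependent.exists_eq_of_not_triple huv h
  exact Submodule.mem_span_pair.2 ⟨a, b, rfl⟩

include hπ hdim hdim' hlift in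
/-- The lifts of the multiplications are linear. -/
theorem map_smul_of_isMulBy {f : V →+ V} {g : H} (hg : g ≠ 0) (hf : IsMulBy π f g) (k : K)
    (v : V) : f (k • v) = k • f v := by
  by_cases hv : v = 0
  · rw [hv, smul_zero, _root_.map_zero, smul_zero]
  by_cases hlin : LinearIndependent K ![v, f v]
  · obtain ⟨τ, hτ⟩ := hπ.exists_ringHom hdim' hg hf hv
    have hne : v + f v ≠ 0 := fun h => one_ne_zero
      (LinearIndependent.pair_iff.1 hlin 1 1 (by rw [one_smul, one_smul, h])).1
    obtain ⟨N, g', hg', hN, hNv⟩ := hlift v (v + f v) hv hne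
    obtain ⟨ρ, hρ⟩ := hπ.exists_ringHom hdim' hg' hN hv
    have hcomb := hπ.exists_combination hf hN hv hNv
    suffices h : ∀ k, τ k = k by rw [hτ, h]
    by_cases h3 : LinearIndependent K ![v, f v, f (f v)]
    · exact (eq_add_of_cyclic hτ hρ hcomb hNv h3).2
    · obtain ⟨w, hw⟩ := exists_notMem_span_pair hdim hlin
      obtain ⟨h, g'', hg'', hh, rfl⟩ := hlift v w hv (fun h => hw (h ▸ Submodule.zero_mem _))
      exact (eq_add_of_independent hτ hρ hcomb hNv (hπ.independent_of_invariant hdim' hg hf hg'' hh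
        hlin (mem_span_pair_of_not_triple hlin h3) hw)).2
  · have hg1 : g = 1 := by
      rw [hπ.linearIndependent_pair_iff, hf] at hlin
      have hv' : π v ≠ 0 := fun h => hv (hπ.map_eq_zero.1 h)
      have := mul_ne_zero hg hv'
      refine mul_right_cancel₀ hv' ?_
      rw [one_mul]
      tauto
    subst hg1
    obtain ⟨l, -, h⟩ := hπ.exists_eq_smul hdim' one_ne_zero hf (f' := AddMonoidHom.id V)
      fun v => (one_mul _).symm
    rw [h, h]
    exact smul_comm _ _ _

include hπ hdim' in
/-- If `h` maps a non-zero vector of the kernel of `N - 1 - M` into this kernel, then it commutes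
with `M` and `N`. -/
theorem commute_of_eq_add {M N h : V →+ V} {g g' g'' : H} (hg : g ≠ 0) (hg1 : g ≠ 1)
    (hM : IsMulBy π M g) (hg' : g' ≠ 0) (hN : IsMulBy π N g') (hg'' : g'' ≠ 0)
    (hh : IsMulBy π h g'') {s : V} (hs0 : s ≠ 0) (hs : N s = s + M s)
    (hhs : N (h s) = h s + M (h s)) : (∀ v, h (M v) = M (h v)) ∧ ∀ v, h (N v) = N (h v) := by
  obtain ⟨m, -, hm⟩ := hπ.exists_commutator hdim' hg'' hg hh hM
  obtain ⟨n, -, hn⟩ := hπ.exists_commutator hdim' hg'' hg' hh hN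
  have h1 := hn s
  rw [hs, map_add, hm, hhs] at h1
  obtain ⟨h2, h3⟩ := LinearIndependent.pair_iff.1 (hπ.linearIndependent_self_map hg hg1 hM
    (hπ.map_ne_zero hg'' hh hs0)) (1 - n) (m - n) (by
      rw [← sub_eq_zero.2 h1]
      module)
  rw [← sub_eq_zero.1 h2] at h3 hn
  rw [sub_eq_zero.1 h3] at hm
  exact ⟨fun v => by rw [hm, one_smul], fun v => by rw [hn, one_smul]⟩

include hπ hdim hdim' hlift in
/-- If `N e = e + M e` for one `e` that is not an eigenvector of `M`, then `N = 1 + M`. Either `e`,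
`M e` and `M (M e)` are independent, or the line through `e` and `M e` is invariant under `M`. -/
theorem eq_add_of_eq_add {M N : V →+ V} {g g' : H} (hg : g ≠ 0) (hM : IsMulBy π M g)
    (hg' : g' ≠ 0) (hN : IsMulBy π N g') {e : V} (he : N e = e + M e)
    (hlin : LinearIndependent K ![e, M e]) (z : V) : N z = z + M z := by
  have he0 : e ≠ 0 := fun h0 => by
    have := (hπ.linearIndependent_pair_iff.1 hlin).1
    rw [h0, hπ.map_zero] at this
    exact this rfl
  have hτ : ∀ k v, M (k • v) = RingHom.id K k • M v :=
    hπ.map_smul_of_isMulBy hdim hdim' hlift hg hM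
  have hρ : ∀ k v, N (k • v) = RingHom.id K k • N v :=
    hπ.map_smul_of_isMulBy hdim hdim' hlift hg' hN
  have hcomb := hπ.exists_combination hM hN he0 he
  have hg1 := hπ.ne_one_of_linearIndependent hM hlin
  by_cases h3 : LinearIndependent K ![e, M e, M (M e)]
  · have hMe := (eq_add_of_cyclic hτ hρ hcomb he h3).1
    have hMN := (hπ.commute_of_eq_add hdim' hg hg1 hM hg' hN hg hM he0 he hMe).2
    by_contra hz
    have hz0 : z ≠ 0 := by
      rintro rfl
      simp at hz
    obtain ⟨h, g'', hg'', hh, rfl⟩ := hlift e z he0 hz0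
    obtain ⟨m, hm0, hm⟩ := hπ.exists_commutator hdim' hg'' hg hh hM
    refine hz (eq_add_of_independent hτ hρ hcomb he fun a b c d habcd => ?_).1
    -- a relation puts `h s` into the kernel of `N - 1 - M`
    set s : V := c • e + (d * m⁻¹) • M e with hs
    have hhs : h s = -(a • e + b • M e) := by
      rw [hs, map_add, hπ.map_smul_of_isMulBy hdim hdim' hlift hg'' hh,
        hπ.map_smul_of_isMulBy hdim hdim' hlift hg'' hh, hm, smul_smul, mul_assoc,
        inv_mul_cancel₀ hm0, mul_one]
      exact eq_neg_of_add_eq_zero_right (by rw [← add_assoc, habcd])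
    have hcombo : ∀ a b : K, N (a • e + b • M e) = a • e + b • M e + M (a • e + b • M e) := by
      intro a b
      rw [map_add, map_add, hρ, hρ, hτ, hτ, he, hMe]
      simp only [RingHom.id_apply]
      module
    have hs0 : s = 0 := by
      by_contra hs0
      obtain ⟨h4, h5⟩ := hπ.commute_of_eq_add hdim' hg hg1 hM hg' hN hg'' hh hs0 (hcombo _ _) (by
        rw [hhs, map_neg, map_neg, hcombo, neg_add])
      exact hz (by rw [← h5, he, map_add, h4])
    obtain ⟨rfl, hd⟩ := LinearIndependent.pair_iff.1 hlin _ _ hs0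
    obtain rfl := (mul_eq_zero.1 hd).resolve_right (inv_ne_zero hm0)
    obtain ⟨rfl, rfl⟩ := LinearIndependent.pair_iff.1 hlin a b (by simpa using habcd)
    simp
  · have key : ∀ w, w ∉ Submodule.span K {e, M e} → N w = w + M w := by
      intro w hw
      obtain ⟨h, g'', hg'', hh, rfl⟩ := hlift e w he0 (fun h => hw (h ▸ Submodule.zero_mem _))
      exact (eq_add_of_independent hτ hρ hcomb he (hπ.independent_of_invariant hdim' hg hM hg'' hh
        hlin (mem_span_pair_of_not_triple hlin h3) hw)).1
    by_cases hz : z ∈ Submodule.span K {e, M e}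
    · obtain ⟨w, hw⟩ := exists_notMem_span_pair hdim hlin
      have h1 := key (z + w) fun h => hw ((Submodule.add_mem_iff_right _ hz).1 h)
      rw [map_add, map_add, key w hw] at h1
      have h2 : N z + (w + M w) = z + M z + (w + M w) := by rw [h1]; abel
      exact add_right_cancel h2
    · exact key z hz

include hπ hdim hdim' hlift in
/-- The lifts of the multiplications commute. -/
theorem commute_of_isMulBy {M h : V →+ V} {g g' : H} (hg : g ≠ 0) (hM : IsMulBy π M g)
    (hg' : g' ≠ 0) (hh : IsMulBy π h g') (v : V) : M (h v) = h (M v) := by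
  by_cases hv : v = 0
  · simp [hv]
  by_cases hlin : LinearIndependent K ![v, M v]
  · have hne : v + M v ≠ 0 := fun h => one_ne_zero
      (LinearIndependent.pair_iff.1 hlin 1 1 (by rw [one_smul, one_smul, h])).1
    obtain ⟨N, g'', hg'', hN, hNv⟩ := hlift v (v + M v) hv hne
    have hall := hπ.eq_add_of_eq_add hdim hdim' hlift hg hM hg'' hN hNv hlin
    exact ((hπ.commute_of_eq_add hdim' hg (hπ.ne_one_of_linearIndependent hM hlin) hM hg'' hN hg'
      hh hv (hall v) (hall (h v))).1 v).symm
  · have hv' : π v ≠ 0 := fun h => hv (hπ.map_eq_zero.1 h)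
    have hg1 : g = 1 := by
      rw [hπ.linearIndependent_pair_iff, hM] at hlin
      have := mul_ne_zero hg hv'
      refine mul_right_cancel₀ hv' ?_
      rw [one_mul]
      tauto
    subst hg1
    obtain ⟨l, -, hl⟩ := hπ.exists_eq_smul hdim' one_ne_zero hM (f' := AddMonoidHom.id V)
      fun v => (one_mul _).symm
    rw [hl, hl, AddMonoidHom.id_apply, AddMonoidHom.id_apply,
      hπ.map_smul_of_isMulBy hdim hdim' hlift hg' hh]

end Commutative

end IsCoord

end

/-! ### The field of the lifted multiplications -/

section

/-- If a field `F` that extends `K` serves as space of homogeneous coordinates of `H`, compatibly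
with the multiplications, then `H` is the quotient of `F` by `K^×`. -/
theorem nonempty_hyperringIso {H : Type u} [CommHyperfield H] {K F : Type v} [Field K] [Field F]
    [Algebra K F] {Φ : F → H} (hΦ : IsCoord K Φ) (hmul : ∀ x y, Φ (x * y) = Φ x * Φ y) :
    Nonempty (HyperringIso H (KrasnerQuotient (unitsSubgroup K F))) := by
  have hmem : ∀ g : Fˣ, g ∈ unitsSubgroup K F ↔ ∃ k : K, k ≠ 0 ∧ algebraMap K F k = g := by
    intro g
    constructor
    · rintro ⟨k, rfl⟩
      exact ⟨k, k.ne_zero, rfl⟩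
    · rintro ⟨k, hk, h⟩
      exact ⟨Units.mk0 k hk, Units.ext h⟩
  have hunit : ∀ k : K, k ≠ 0 → ∃ g ∈ unitsSubgroup K F, ((g : Fˣ) : F) = algebraMap K F k :=
    fun k hk => ⟨Units.map (algebraMap K F).toMonoidHom (Units.mk0 k hk), ⟨_, rfl⟩, rfl⟩
  have hmk : ∀ x y : F, KrasnerQuotient.mk (unitsSubgroup K F) x = KrasnerQuotient.mk _ y ↔
      Φ x = Φ y := by
    intro x y
    rw [KrasnerQuotient.mk_eq, hΦ.eq_iff]
    constructor
    · rintro ⟨g, hg, rfl⟩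
      obtain ⟨k, hk, h⟩ := (hmem g).1 hg
      exact ⟨k, hk, by rw [Algebra.smul_def, h, mul_comm]⟩
    · rintro ⟨k, hk, rfl⟩
      obtain ⟨g, hg, h⟩ := hunit k hk
      exact ⟨g, hg, by rw [h, Algebra.smul_def, mul_comm]⟩
  obtain ⟨s, hs⟩ := hΦ.surjective.hasRightInverse
  let f : H →ₙ* KrasnerQuotient (unitsSubgroup K F) :=
    { toFun := fun x => KrasnerQuotient.mk _ (s x)
      map_mul' := fun x y => by
        change _ = KrasnerQuotient.mk _ (s x * s y)
        rw [hmk, hmul, hs, hs, hs] }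
  have hf : ∀ x, f (Φ x) = KrasnerQuotient.mk _ x := fun x => (hmk _ _).2 (hs _)
  have hbij : Function.Bijective f := by
    refine ⟨fun x y h => ?_, fun c => ?_⟩
    · have := (hmk _ _).1 h
      rwa [hs, hs] at this
    · obtain ⟨x, rfl⟩ := KrasnerQuotient.mk_surjective c
      exact ⟨Φ x, hf x⟩
  refine ⟨{ MulEquiv.ofBijective f hbij with map_hadd := fun a b => ?_ }⟩
  obtain ⟨x, rfl⟩ := hΦ.surjective a
  obtain ⟨y, rfl⟩ := hΦ.surjective b
  ext c
  obtain ⟨z, rfl⟩ := KrasnerQuotient.mk_surjective c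
  change (∃ w, Tri (Φ x) (Φ y) w ∧ f w = _) ↔ _ ∈ KrasnerQuotient.add (f (Φ x)) (f (Φ y))
  rw [hf, hf, KrasnerQuotient.mem_add]
  have h1 : (∃ w, Tri (Φ x) (Φ y) w ∧ f w = KrasnerQuotient.mk _ z) ↔ Tri (Φ x) (Φ y) (Φ z) := by
    constructor
    · rintro ⟨w, hw, h⟩
      rw [← hf, hbij.1.eq_iff] at h
      rwa [← h]
    · exact fun h => ⟨Φ z, h, hf z⟩
  rw [h1, hΦ.tri_iff]
  constructor
  · rintro ⟨k, l, hk, hl, rfl⟩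
    obtain ⟨g, hg, h⟩ := hunit k hk
    obtain ⟨g', hg', h'⟩ := hunit l hl
    exact ⟨g, hg, g', hg', by rw [h, h', Algebra.smul_def, Algebra.smul_def]; ring⟩
  · rintro ⟨g, hg, g', hg', rfl⟩
    obtain ⟨k, hk, h⟩ := (hmem g).1 hg
    obtain ⟨l, hl, h'⟩ := (hmem g').1 hg'
    exact ⟨k, l, hk, hl, by rw [← h, ← h', Algebra.smul_def, Algebra.smul_def]; ring⟩

/-- `H` is the quotient of a finite field `F` by the multiplicative group of a subfield `K`; the
orders of the fields are part of the data. -/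
def IsFiniteFieldQuotient (H : Type u) [CommHyperfield H] : Prop :=
  ∃ (q m : ℕ) (K F : Type u) (_ : Field K) (_ : Field F) (_ : Algebra K F),
    0 < q ∧ 0 < m ∧ Nat.card K = q ∧ Nat.card F = q ^ m ∧
    Nonempty (HyperringIso H (KrasnerQuotient (unitsSubgroup K F)))

theorem isFiniteFieldQuotient_of_isCoord {H : Type u} [CommHyperfield H] {K F : Type u} [Field K]
    [Field F] [Finite F] [Algebra K F] {Φ : F → H} (hΦ : IsCoord K Φ)
    (hmul : ∀ x y, Φ (x * y) = Φ x * Φ y) : IsFiniteFieldQuotient H := by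
  have : Finite K := Finite.of_injective _ (algebraMap K F).injective
  have : Module.Finite K F := Module.Finite.of_finite
  exact ⟨Nat.card K, Module.finrank K F, K, F, _, _, _, Nat.card_pos, Module.finrank_pos, rfl,
    Module.natCard_eq_pow_finrank, nonempty_hyperringIso hΦ hmul⟩

section

variable {H : Type u} [CommHyperfield H] {K V : Type u} [Field K] [AddCommGroup V]
  [Module K V] {π : V → H}

namespace IsCoord

/-- A space of homogeneous coordinates of dimension at least three is a field: the lifts of the
multiplications form, with `0`, a commutative ring of endomorphisms, which is identified with `V` by
evaluation at a vector `e` over `1`. -/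
theorem isFiniteFieldQuotient [Finite V] (hπ : IsCoord K π)
    (hdim : ∀ u v : V, LinearIndependent K ![u, v] → ∃ w, LinearIndependent K ![u, v, w])
    (hdim' : ∀ u : V, u ≠ 0 → ∃ v, LinearIndependent K ![u, v]) : IsFiniteFieldQuotient H := by
  have hlift : ∀ u v : V, u ≠ 0 → v ≠ 0 →
      ∃ (f : V →+ V) (g : H), g ≠ 0 ∧ IsMulBy π f g ∧ f u = v := by
    intro u v hu hv
    have hu' : π u ≠ 0 := fun h => hu (hπ.map_eq_zero.1 h)
    have hv' : π v ≠ 0 := fun h => hv (hπ.map_eq_zero.1 h)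
    have hg : π v * (π u)⁻¹ ≠ 0 := mul_ne_zero hv' (inv_ne_zero hu')
    obtain ⟨f, hf, hf'⟩ := hπ.exists_lift hdim hdim' (γ := fun x => π v * (π u)⁻¹ * x)
      (mul_zero _) (fun x y h => mul_left_cancel₀ hg h) (fun x y z => tri_mul_iff hg) hu
      (e' := v) (by rw [mul_assoc, inv_mul_cancel₀ hu', mul_one])
    exact ⟨f, _, hg, hf', hf⟩
  obtain ⟨e, he⟩ := hπ.surjective 1
  have he0 : e ≠ 0 := fun h => one_ne_zero (by rw [← he, h, hπ.map_zero] : (1 : H) = 0)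
  have hcomm : ∀ {f f' : V →+ V} {g g' : H}, IsMulBy π f g → IsMulBy π f' g' →
      ∀ v, f (f' v) = f' (f v) := by
    have hzero : ∀ {f : V →+ V} {g : H}, IsMulBy π f g → g = 0 → ∀ v, f v = 0 := by
      rintro f _ hf rfl v
      rw [← hπ.map_eq_zero, hf, zero_mul]
    intro f f' g g' hf hf' v
    by_cases hg : g = 0
    · rw [hzero hf hg, hzero hf hg, _root_.map_zero]
    by_cases hg' : g' = 0
    · rw [hzero hf' hg', hzero hf' hg', _root_.map_zero]
    exact hπ.commute_of_isMulBy hdim hdim' hlift hg hf hg' hf' v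
  have hlift' : ∀ v, ∃ (f : V →+ V) (g : H), IsMulBy π f g ∧ f e = v := by
    intro v
    by_cases hv : v = 0
    · exact ⟨0, 0, fun v => by rw [zero_mul]; exact hπ.map_zero, hv.symm⟩
    · obtain ⟨f, g, -, hf, h⟩ := hlift e v he0 hv
      exact ⟨f, g, hf, h⟩
  have hext : ∀ {f f' : V →+ V}, (∃ g, IsMulBy π f g) → (∃ g, IsMulBy π f' g) → f e = f' e →
      f = f' := by
    rintro f f' ⟨g, hf⟩ ⟨g', hf'⟩ h
    ext v
    obtain ⟨p, g'', hp, rfl⟩ := hlift' v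
    rw [hcomm hf hp, hcomm hf' hp, h]
  -- a sum of two lifts commutes with all lifts, hence it is the lift that agrees with it on `e`
  let S : Subring (AddMonoid.End V) :=
    { carrier := {f | ∃ g, IsMulBy π f g}
      mul_mem' := by
        rintro f f' ⟨g, hf⟩ ⟨g', hf'⟩
        exact ⟨g * g', fun v => (hf _).trans (by rw [hf', mul_assoc])⟩
      one_mem' := ⟨1, fun v => (one_mul _).symm⟩
      add_mem' := by
        rintro f f' ⟨g, hf⟩ ⟨g', hf'⟩
        obtain ⟨p, g'', hp, h⟩ := hlift' (f e + f' e)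
        refine ⟨g'', ?_⟩
        suffices f + f' = p by rwa [this]
        ext v
        obtain ⟨p', g''', hp', rfl⟩ := hlift' v
        exact (congrArg₂ (· + ·) (hcomm hf hp' e) (hcomm hf' hp' e)).trans
          ((map_add p' _ _).symm.trans ((congrArg p' h.symm).trans (hcomm hp' hp e)))
      zero_mem' := ⟨0, fun v => by rw [zero_mul]; exact hπ.map_zero⟩
      neg_mem' := by
        rintro f ⟨g, hf⟩
        refine ⟨g, fun v => ?_⟩
        change π (-f v) = _
        rw [← neg_one_smul K, hπ.map_smul (neg_ne_zero.2 one_ne_zero)]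
        exact hf v }
  have hS : ∀ f : S, IsMulBy π f.1 (π (f.1 e)) := by
    rintro ⟨f, g, hf⟩ v
    exact (hf v).trans (congrArg (· * π v) ((hf e).trans (by rw [he, mul_one])).symm)
  have hSinj : Function.Injective fun f : S => f.1 e := fun f f' h => Subtype.ext (hext f.2 f'.2 h)
  have hFinite : Finite S := Finite.of_injective _ hSinj
  have : Nontrivial S := ⟨0, 1, fun h => he0 (congrArg (fun f : S => f.1 e) h).symm⟩
  have : NoZeroDivisors S := by
    refine ⟨fun {f f'} h => or_iff_not_imp_right.2 fun hf' => ?_⟩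
    have h1 : f'.1 e ≠ 0 := fun h => hf' (hSinj h)
    by_contra hf
    have h2 : f.1 e ≠ 0 := fun h => hf (hSinj h)
    have h3 : f.1 (f'.1 e) = 0 := congrArg (fun f : S => f.1 e) h
    exact hπ.map_ne_zero (fun h => h2 (hπ.map_eq_zero.1 h)) (hS f) h1 h3
  have : IsDomain S := NoZeroDivisors.to_isDomain _
  let _ : Field S := (Finite.isDomain_to_isField S).toField
  -- a non-zero scalar is a lift of the multiplication by `1`
  let ι : K →+* S := (Module.toAddMonoidEnd K V).codRestrict S fun k => by
    by_cases hk : k = 0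
    · refine ⟨0, fun v => ?_⟩
      change π (k • v) = _
      rw [hk, zero_smul, zero_mul, hπ.map_zero]
    · exact ⟨1, fun v => by rw [one_mul]; exact hπ.map_smul hk v⟩
  let _ : Algebra K S := ι.toAlgebra
  have hsmul : ∀ (k : K) (f : S), (k • f).1 e = k • f.1 e := fun k f => rfl
  refine isFiniteFieldQuotient_of_isCoord (K := K) (F := S) (Φ := fun f => π (f.1 e)) ?_ ?_
  · exact {
      surjective := fun x => by
        obtain ⟨v, rfl⟩ := hπ.surjective x
        obtain ⟨f, g, hf, rfl⟩ := hlift' v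
        exact ⟨⟨f, g, hf⟩, rfl⟩
      map_zero := hπ.map_zero
      eq_iff := fun {f f'} => by
        rw [hπ.eq_iff]
        simp only [← hsmul, hSinj.eq_iff]
      tri_iff := fun {f f' f''} => by
        rw [hπ.tri_iff]
        have : ∀ k l : K, k • f.1 e + l • f'.1 e = (k • f + l • f').1 e := fun k l => rfl
        simp only [this, hSinj.eq_iff] }
  · intro f f'
    exact hS f (f'.1 e)

end IsCoord

/-- The Krasner hyperfield is the quotient of the field with three elements by its multiplicative
group. -/
theorem isFiniteFieldQuotient_of_forall_eq [IsProjectiveHypergroup H]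
    (h : ∀ x : H, x ≠ 0 → x = 1) : IsFiniteFieldQuotient H := by
  classical
  have key : ∀ x y z : ZMod 3, (∃ k l : ZMod 3, k ≠ 0 ∧ l ≠ 0 ∧ z = k * x + l * y) ↔
      (x = 0 ∧ (y = 0 ↔ z = 0)) ∨ (y = 0 ∧ (x = 0 ↔ z = 0)) ∨ (x ≠ 0 ∧ y ≠ 0) := by
    decide
  have : Fact (Nat.Prime 3) := ⟨by norm_num⟩
  -- the field with two elements would not do, since `1 ∈ 1 + 1`
  obtain ⟨F, _, ⟨e⟩⟩ : ∃ (F : Type u) (_ : Field F), Nonempty (F ≃+* ZMod 3) :=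
    ⟨ULift (ZMod 3), inferInstance, ⟨ULift.ringEquiv⟩⟩
  have : Finite F := Finite.of_equiv _ e.toEquiv.symm
  let Φ : F → H := fun x => if x = 0 then 0 else 1
  have h11 : ∀ z : H, Tri 1 1 z := fun z => tri_self.2 (or_iff_not_imp_left.2 (h z))
  have hΦ0 : ∀ {x}, Φ x = 0 ↔ x = 0 := by simp [Φ]
  have hΦ : ∀ {x y}, Φ x = Φ y ↔ (x = 0 ↔ y = 0) := by
    intro x y
    by_cases hx : x = 0 <;> by_cases hy : y = 0 <;> simp [Φ, hx, hy]
  refine isFiniteFieldQuotient_of_isCoord (K := F) (F := F) (Φ := Φ) ?_ ?_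
  · refine ⟨fun x => ?_, hΦ0.2 rfl, fun {x y} => ?_, fun {x y z} => ?_⟩
    · by_cases hx : x = 0
      · exact ⟨0, by simp [Φ, hx]⟩
      · exact ⟨1, by simp [Φ, h x hx]⟩
    · rw [hΦ]
      constructor
      · intro hxy
        by_cases hx : x = 0
        · exact ⟨1, one_ne_zero, by simp [hx, hxy.1 hx]⟩
        · exact ⟨y / x, div_ne_zero (fun hy => hx (hxy.2 hy)) hx, by simp [hx]⟩
      · rintro ⟨k, hk, rfl⟩
        simp [hk]
    · have key' := key (e x) (e y) (e z)
      have hlhs : Tri (Φ x) (Φ y) (Φ z) ↔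
          (x = 0 ∧ (y = 0 ↔ z = 0)) ∨ (y = 0 ∧ (x = 0 ↔ z = 0)) ∨ (x ≠ 0 ∧ y ≠ 0) := by
        by_cases hx : x = 0
        · rw [hΦ0.2 hx, tri_zero_left, hΦ]
          grind
        by_cases hy : y = 0
        · rw [hΦ0.2 hy, tri_rot_iff, tri_rot_iff, tri_zero_left, hΦ]
          grind
        · rw [show Φ x = 1 from if_neg hx, show Φ y = 1 from if_neg hy]
          simp [h11, hx, hy]
      rw [hlhs]
      simp only [e.surjective.exists, ← map_mul, ← map_add, e.injective.eq_iff,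
        EmbeddingLike.map_eq_zero_iff, ne_eq] at key'
      exact key'.symm
  · intro x y
    by_cases hx : x = 0 <;> by_cases hy : y = 0 <;> simp [Φ, hx, hy]

end

end

/-! ### Subspaces of a projective plane -/

section

section Plane

variable {H : Type u} [CanonicalHypergroup H] [IsProjectiveHypergroup H]

omit [IsProjectiveHypergroup H] in
theorem IsSubspace.joinPt_subset {M S : Set H} (hS : IsSubspace S) (hM : M ⊆ S) {p : H}
    (hp : p ∈ S) : ProjHyper.joinPt M p ⊆ S := by
  rintro x (hx | ⟨m, hm, hx⟩)
  exacts [hM hx, hS.mem_of_tri (hM hm) hp hx]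

omit [IsProjectiveHypergroup H] in
theorem IsSubspace.mem_of_col {S : Set H} (hS : IsSubspace S) {x y z : H} (hxy : x ≠ y)
    (hx : x ∈ S) (hy : y ∈ S) (h : Col x y z) : z ∈ S := by
  rcases h with h | rfl | rfl | h
  exacts [absurd h hxy, hy, hx, hS.mem_of_tri hx hy h]

/-- The subspace spanned by two points. -/
def line (x y : H) : Set H := joinPt (joinPt {0} x) y

theorem isSubspace_line (x y : H) : IsSubspace (line x y) :=
  (isSubspace_zero.joinPt x).joinPt y

omit [IsProjectiveHypergroup H] in
theorem left_mem_line (x y : H) : x ∈ line x y :=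
  subset_joinPt _ _ (isSubspace_zero.mem_joinPt x)

theorem right_mem_line (x y : H) : y ∈ line x y :=
  (isSubspace_zero.joinPt x).mem_joinPt y

theorem mem_line {x y z : H} (hxy : x ≠ y) : z ∈ line x y ↔ z = 0 ∨ Col x y z := by
  constructor
  · rintro ((h | ⟨m, hm, h⟩) | ⟨m, h | ⟨m', hm', h⟩, h'⟩)
    · exact Or.inl h
    · cases (hm : m = 0)
      cases tri_zero_left.1 h
      exact Or.inr (by simp [Col])
    · cases (h : m = 0)
      cases tri_zero_left.1 h'
      exact Or.inr (by simp [Col])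
    · cases (hm' : m' = 0)
      cases tri_zero_left.1 h
      exact Or.inr h'.col
  · rintro (rfl | h)
    · exact (isSubspace_line x y).zero_mem
    · exact (isSubspace_line x y).mem_of_col hxy (left_mem_line x y) (right_mem_line x y) h

/-- A subspace that together with one point spans everything meets every line. -/
theorem IsSubspace.exists_col {S : Set H} (hS : IsSubspace S) {b : H}
    (hb : ∀ z, z ∈ ProjHyper.joinPt S b) {x y : H} (hx : x ≠ 0) (hy : y ≠ 0) (hxy : x ≠ y) :
    ∃ c ∈ S, c ≠ 0 ∧ Col x y c := by
  rcases hb x with hxS | ⟨m, hm, h⟩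
  · exact ⟨x, hxS, hx, by simp [Col]⟩
  rcases hb y with hyS | ⟨m', hm', h'⟩
  · exact ⟨y, hyS, hy, by simp [Col]⟩
  obtain ⟨c, hc, hc'⟩ := h.swap.pasch h'.swap
  refine ⟨c, hS.mem_of_tri hm hm' hc, ?_, hc'.col⟩
  rintro rfl
  exact hxy (tri_zero_right.1 hc')

/-- In a plane, every line spans everything together with a suitable point. -/
theorem exists_joinPt_line {o a b : H} (ho : o ≠ 0) (ha : a ≠ 0) (hoa : o ≠ a)
    (h : ∀ z, z ∈ plane o a b) {x y : H} (hx : x ≠ 0) (hy : y ≠ 0) (hxy : x ≠ y) :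
    ∃ d, ∀ z, z ∈ joinPt (line x y) d := by
  have key : ∀ {T : Set H}, IsSubspace T → ∀ {p q}, p ≠ 0 → q ≠ 0 → p ≠ q → p ∈ line o a →
      q ∈ line o a → p ∈ T → q ∈ T → line o a ⊆ T := by
    intro T hT p q hp hq hpq hpS hqS hpT hqT z hz
    rcases (mem_line hoa).1 hz with rfl | hz
    · exact hT.zero_mem
    · exact hT.mem_of_col hpq hpT hqT
        (Col.trans₃ hoa (((mem_line hoa).1 hpS).resolve_left hp)
          (((mem_line hoa).1 hqS).resolve_left hq) hz)
  by_cases hS : x ∈ line o a ∧ y ∈ line o a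
  · refine ⟨b, fun z => ?_⟩
    have hT := (isSubspace_line x y).joinPt b
    refine hT.joinPt_subset (key hT hx hy hxy hS.1 hS.2 ?_ ?_) ((isSubspace_line x y).mem_joinPt b)
      (h z)
    exacts [subset_joinPt _ _ (left_mem_line x y), subset_joinPt _ _ (right_mem_line x y)]
  · obtain ⟨c, hcS, hc, hc'⟩ := (isSubspace_line o a).exists_col h hx hy hxy
    obtain ⟨d, hdS, hd, hdc⟩ : ∃ d ∈ line o a, d ≠ 0 ∧ c ≠ d := by
      by_cases hco : c = o
      · exact ⟨a, right_mem_line o a, ha, hco ▸ hoa⟩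
      · exact ⟨o, left_mem_line o a, ho, hco⟩
    refine ⟨d, fun z => ?_⟩
    have hT := (isSubspace_line x y).joinPt d
    have hxT : x ∈ joinPt (line x y) d := subset_joinPt _ _ (left_mem_line x y)
    have hyT : y ∈ joinPt (line x y) d := subset_joinPt _ _ (right_mem_line x y)
    have hST := key hT hc hd hdc hcS hdS (hT.mem_of_col hxy hxT hyT hc')
      ((isSubspace_line x y).mem_joinPt d)
    obtain ⟨p, hpT, hpS⟩ : ∃ p ∈ joinPt (line x y) d, p ∉ line o a := by
      by_cases hxS : x ∈ line o a
      · exact ⟨y, hyT, fun hyS => hS ⟨hxS, hyS⟩⟩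
      · exact ⟨x, hxT, hxS⟩
    refine hT.joinPt_subset hST ?_ (h z)
    obtain ⟨m, hm, hmp⟩ := (h p).resolve_left hpS
    exact hT.mem_of_tri (hST hm) hpT hmp.rot.swap

variable (H) in
/-- Any two lines have a common point. -/
def LinesMeet : Prop :=
  ∀ x y x' y' : H, x ≠ 0 → y ≠ 0 → x' ≠ 0 → y' ≠ 0 → x ≠ y → x' ≠ y' →
    ∃ c, c ≠ 0 ∧ Col x y c ∧ Col x' y' c

/-- If one plane is the whole geometry, any two lines meet. -/
theorem linesMeet_of_plane_eq_univ {o a b : H} (ho : o ≠ 0) (ha : a ≠ 0) (hoa : o ≠ a)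
    (h : ∀ z, z ∈ plane o a b) : LinesMeet H := by
  intro x y x' y' hx hy hx' hy' hxy hxy'
  obtain ⟨d, hd⟩ := exists_joinPt_line ho ha hoa h hx hy hxy
  obtain ⟨c, hcS, hc, hc'⟩ := (isSubspace_line x y).exists_col hd hx' hy' hxy'
  exact ⟨c, hc, ((mem_line hxy).1 hcS).resolve_left hc, hc'⟩

/-- Desargues' theorem holds unless any two lines meet. -/
theorem desargues_of_not_linesMeet (h : ¬ LinesMeet H) : Desargues H := by
  refine desargues_of_forall_plane_ne_univ fun a b c ha hb _ habc => ?_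
  by_contra! hp
  exact h (linesMeet_of_plane_eq_univ ha hb (fun e => habc (Or.inl e)) hp)

/-- If the points are not all on one line, then no line contains all points. -/
theorem exists_not_col {a b c : H} (ha : a ≠ 0) (hb : b ≠ 0) (hc : c ≠ 0) (habc : ¬ Col a b c)
    {x y : H} (hxy : x ≠ y) : ∃ z, z ≠ 0 ∧ ¬ Col x y z := by
  by_contra! h
  exact habc (Col.trans₃ hxy (h a ha) (h b hb) (h c hc))

end Plane

variable {H : Type u} [CommHyperfield H]

/-- In an extension of the Krasner hyperfield, `x + x = {0, x}`. -/
theorem isProjectiveHypergroup (hK : IsKrasnerExtension H) : IsProjectiveHypergroup H := by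
  obtain ⟨ι, -, h0, h1, -, hadd⟩ := hK
  have h11 : (1 : H) +ₕ 1 = {0, 1} := by
    rw [← h1, ← hadd, ← h0]
    ext z
    constructor
    · rintro ⟨_ | _, -, rfl⟩
      exacts [Or.inl rfl, Or.inr rfl]
    · rintro (rfl | rfl)
      exacts [⟨_, trivial, rfl⟩, ⟨_, trivial, rfl⟩]
  refine ⟨fun x => ?_⟩
  have := Hyperring.mul_hadd x 1 1
  rw [h11, Set.image_pair, mul_zero, mul_one] at this
  exact this.symm

variable [IsProjectiveHypergroup H]

/-! ### The one-dimensional case -/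

/-- If all points are on one line, then `H` is the hyperfield `K[G]` of its multiplicative
group. -/
theorem exists_hyperringIso_withZero [Finite H] {a b : H} (ha : a ≠ 0) (hb : b ≠ 0)
    (hab : a ≠ b) (hcol : ∀ x y z : H, x ≠ 0 → y ≠ 0 → z ≠ 0 → Col x y z) :
    ∃ (G : Type u) (_ : CommGroup G) (_ : Finite G) (hG : 4 ≤ ENat.card G),
      letI := krasnerGroupHyperfield G hG
      Nonempty (HyperringIso H (WithZero G)) := by
  obtain ⟨c, hc⟩ := exists_tri a b
  have hc0 : c ≠ 0 := by
    rintro rfl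
    exact hab (tri_zero_right.1 hc)
  have hca := ne_of_tri_of_ne ha hb hc hab.symm
  obtain ⟨d, hd, hdc⟩ := hc.exists_ne ha hca.1.symm
  have hd0 : d ≠ 0 := by
    rintro rfl
    exact hab (tri_zero_right.1 hd)
  have hda := ne_of_tri_of_ne ha hb hd hab.symm
  have hG : 4 ≤ ENat.card Hˣ := by
    have hinj : Function.Injective ![Units.mk0 a ha, Units.mk0 b hb, Units.mk0 c hc0,
        Units.mk0 d hd0] := by
      intro i j hij
      fin_cases i <;> fin_cases j <;> simp_all [Units.ext_iff]
    simpa using ENat.card_le_card_of_injective hinj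
  refine ⟨Hˣ, inferInstance, inferInstance, hG, ?_⟩
  let _ := krasnerGroupHyperfield Hˣ hG
  classical
  let e : H ≃* WithZero Hˣ := WithZero.withZeroUnitsEquiv.symm
  have he0 : ∀ {x}, e x = 0 ↔ x = 0 := fun {x} => EmbeddingLike.map_eq_zero_iff
  refine ⟨{ e with map_hadd := fun x y => ?_ }⟩
  ext z
  obtain ⟨z, rfl⟩ := e.surjective z
  change (∃ w, Tri x y w ∧ e w = e z) ↔ e z ∈ KrasnerGroup.add (e x) (e y)
  simp only [KrasnerGroup.mem_add, e.injective.eq_iff, he0, ne_eq, exists_eq_right]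
  constructor
  · intro h
    by_cases hx : x = 0
    · rw [hx, tri_zero_left] at h
      exact Or.inl ⟨hx, h⟩
    by_cases hxy : x = y
    · rw [← hxy, tri_self] at h
      grind
    by_cases hz : z = 0
    · rw [hz, tri_zero_right] at h
      exact absurd h hxy
    by_cases hy : y = 0
    · rw [hy, tri_rot_iff, tri_rot_iff, tri_zero_left] at h
      exact Or.inr (Or.inl ⟨hy, h.symm⟩)
    have := ne_of_tri_of_ne hx hy h (Ne.symm hxy)
    grind
  · rintro (⟨rfl, rfl⟩ | ⟨rfl, rfl⟩ | ⟨rfl, rfl⟩ | ⟨rfl, rfl⟩ | ⟨hx, hy, hz, hxy, hyz, hxz⟩)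
    · exact tri_zero_left.2 rfl
    · exact (tri_zero_left.2 rfl).swap
    · exact tri_zero_right.2 rfl
    · exact tri_self.2 (Or.inr rfl)
    · rcases hcol x y z hx hy hz with h | h | h | h
      exacts [absurd h hxy, absurd h hyz, absurd h hxz, h]

/-! ### The projective plane of a hyperfield -/

omit [IsProjectiveHypergroup H] in
theorem mem_lines_iff {l : Set Hˣ} : l ∈ (hyperfieldGeometry H).lines ↔
    ∃ x y : Hˣ, x ≠ y ∧ l = {z : Hˣ | Col (x : H) y z} := by
  refine exists_congr fun x => exists_congr fun y => and_congr_right fun hxy => ?_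
  have : ({z : Hˣ | (z : H) ∈ (x : H) +ₕ (y : H)} ∪ {x, y} : Set Hˣ) =
      {z : Hˣ | Col (x : H) y z} := by
    ext z
    have hxy' : (x : H) ≠ y := fun h => hxy (Units.ext h)
    simp only [Set.mem_union, Set.mem_ofPred_eq, Set.mem_insert_iff, Set.mem_singleton_iff,
      Units.ext_iff, Col, Tri]
    grind
  rw [this]

omit [IsProjectiveHypergroup H] in
theorem line_mem_lines {x y : Hˣ} (hxy : x ≠ y) :
    {z : Hˣ | Col (x : H) y z} ∈ (hyperfieldGeometry H).lines :=
  mem_lines_iff.2 ⟨x, y, hxy, rfl⟩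

theorem col_of_collinear {x y z : Hˣ} (h : (hyperfieldGeometry H).Collinear x y z) :
    Col (x : H) y z := by
  obtain ⟨l, hl, hx, hy, hz⟩ := h
  obtain ⟨u, v, huv, rfl⟩ := mem_lines_iff.1 hl
  exact Col.trans₃ (fun h => huv (Units.ext h)) hx hy hz

omit [IsProjectiveHypergroup H] in
theorem collinear_of_col {x y z : Hˣ} (hxy : (x : H) ≠ y) (h : Col (x : H) y z) :
    (hyperfieldGeometry H).Collinear x y z :=
  ⟨_, line_mem_lines (fun e => hxy (congrArg _ e)), by simp [Col], by simp [Col], h⟩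

/-- Desargues' property of the geometry in terms of the hyperaddition. The intersections of the
sides are points, since `0 ∈ p + q` only for `p = q`. -/
theorem desargues_of_isDesarguesian (h : (hyperfieldGeometry H).IsDesarguesian) :
    Desargues H := by
  intro o a b c a' b' c' x y z ho ha hb hc ha' hb' hc' hab hbc hca habc habc' hao hbo hco haa hbb
    hcc hoa hob hoc hx hx' hy hy' hz hz'
  have ne0 : ∀ {p q r : H}, p ≠ q → Tri p q r → r ≠ 0 := by
    rintro p q _ hpq h rfl
    exact hpq (tri_zero_right.1 h)
  have n1 : ∀ {p q r : H}, ¬ Col p q r → p ≠ q := fun h e => h (Or.inl e)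
  have n2 : ∀ {p q r : H}, ¬ Col p q r → q ≠ r := fun h e => h (Or.inr (Or.inl e))
  have n3 : ∀ {p q r : H}, ¬ Col p q r → r ≠ p := fun h e => h (Or.inr (Or.inr (Or.inl e.symm)))
  lift o to Hˣ using ho.isUnit
  lift a to Hˣ using ha.isUnit
  lift b to Hˣ using hb.isUnit
  lift c to Hˣ using hc.isUnit
  lift a' to Hˣ using ha'.isUnit
  lift b' to Hˣ using hb'.isUnit
  lift c' to Hˣ using hc'.isUnit
  lift x to Hˣ using (ne0 (n2 habc) hx).isUnit
  lift y to Hˣ using (ne0 (n3 habc) hy).isUnit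
  lift z to Hˣ using (ne0 (n1 habc) hz).isUnit
  refine col_of_collinear (h o a b c a' b' c' x y z (fun h => hab (col_of_collinear h))
    (fun h => hbc (col_of_collinear h)) (fun h => hca (col_of_collinear h))
    (fun h => habc (col_of_collinear h)) (fun h => habc' (col_of_collinear h))
    (fun e => hao (congrArg _ e)) (fun e => hbo (congrArg _ e)) (fun e => hco (congrArg _ e))
    (fun e => haa (congrArg _ e)) (fun e => hbb (congrArg _ e)) (fun e => hcc (congrArg _ e))
    ?_ ?_ ?_ ?_ ?_ ?_ ?_ ?_ ?_)
  exacts [collinear_of_col (n1 hab) hoa.col, collinear_of_col (n1 hbc) hob.col,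
    collinear_of_col (n3 hbc).symm hoc.col, collinear_of_col (n2 habc) hx.col,
    collinear_of_col (n2 habc') hx'.col, collinear_of_col (n3 habc) hy.col,
    collinear_of_col (n3 habc') hy'.col, collinear_of_col (n1 habc) hz.col,
    collinear_of_col (n1 habc') hz'.col]

/-- The line through two points. -/
def lineThrough {x y : Hˣ} (hxy : x ≠ y) : (hyperfieldGeometry H).Line :=
  ⟨_, line_mem_lines hxy⟩

omit [IsProjectiveHypergroup H] in
theorem mem_lineThrough {x y : Hˣ} (hxy : x ≠ y) {p : Hˣ} :
    p ∈ lineThrough hxy ↔ Col (x : H) y p := Iff.rfl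

/-- If any two lines meet, and the points are not all on one line, the geometry of `H` is a
projective plane. -/
theorem isProjectivePlane (hL : LinesMeet H) {a b c : H} (ha : a ≠ 0) (hb : b ≠ 0) (hc : c ≠ 0)
    (habc : ¬ Col a b c) : (hyperfieldGeometry H).IsProjectivePlane := by
  classical
  have hne : ∀ {x y : Hˣ}, x ≠ y → (x : H) ≠ y := fun h e => h (Units.ext e)
  have hoff : ∀ x y : Hˣ, x ≠ y → ∃ z : Hˣ, ¬ Col (x : H) y z := by
    intro x y hxy
    obtain ⟨z, hz, h⟩ := exists_not_col ha hb hc habc (hne hxy)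
    exact ⟨Units.mk0 z hz, h⟩
  lift a to Hˣ using ha.isUnit
  lift b to Hˣ using hb.isUnit
  lift c to Hˣ using hc.isUnit
  have hab : a ≠ b := fun e => habc (Or.inl (congrArg _ e))
  have hbc : b ≠ c := fun e => habc (Or.inr (Or.inl (congrArg _ e)))
  have hac : a ≠ c := fun e => habc (Or.inr (Or.inr (Or.inl (congrArg _ e))))
  have hmeet : ∀ l₁ l₂ : (hyperfieldGeometry H).Line, ∃ p : Hˣ, p ∈ l₁ ∧ p ∈ l₂ := by
    rintro ⟨l₁, h₁⟩ ⟨l₂, h₂⟩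
    obtain ⟨x, y, hxy, rfl⟩ := mem_lines_iff.1 h₁
    obtain ⟨x', y', hxy', rfl⟩ := mem_lines_iff.1 h₂
    obtain ⟨p, hp, h, h'⟩ := hL x y x' y' x.ne_zero y.ne_zero x'.ne_zero y'.ne_zero (hne hxy)
      (hne hxy')
    exact ⟨Units.mk0 p hp, h, h'⟩
  have hjoin : ∀ x y : Hˣ, x ≠ y → ∃ l : (hyperfieldGeometry H).Line, x ∈ l ∧ y ∈ l :=
    fun x y hxy => ⟨lineThrough hxy, (mem_lineThrough hxy).2 (by simp [Col]),
      (mem_lineThrough hxy).2 (by simp [Col])⟩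
  choose P hP using hmeet
  choose L hL' using hjoin
  obtain ⟨d, hd⟩ := exists_tri (a : H) c
  obtain ⟨x, hx⟩ := exists_tri (b : H) c
  have hda := ne_of_tri_of_ne a.ne_zero c.ne_zero hd (hne hac).symm
  have hxb := ne_of_tri_of_ne b.ne_zero c.ne_zero hx (hne hbc).symm
  have hd0 : d ≠ 0 := by
    rintro rfl
    exact hne hac (tri_zero_right.1 hd)
  have hx0 : x ≠ 0 := by
    rintro rfl
    exact hne hbc (tri_zero_right.1 hx)
  lift d to Hˣ using hd0.isUnit
  lift x to Hˣ using hx0.isUnit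
  have hbd : b ≠ d := by
    rintro rfl
    exact habc hd.rot.swap.col
  have hax : a ≠ x := by
    rintro rfl
    exact habc hx.rot.col
  refine ⟨{
    exists_point := ?_
    exists_line := ?_
    eq_or_eq := ?_
    mkPoint := fun {l₁ l₂} _ => P l₁ l₂
    mkPoint_ax := fun {l₁ l₂} _ => hP l₁ l₂
    mkLine := fun {x y} h => L x y h
    mkLine_ax := fun {x y} h => hL' x y h
    exists_config := ?_ }⟩
  · rintro ⟨l, h⟩
    obtain ⟨x, y, hxy, rfl⟩ := mem_lines_iff.1 h
    exact hoff x y hxy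
  · intro p
    obtain ⟨y, hy⟩ : ∃ y, p ≠ y := by
      by_cases hpa : p = a
      · exact ⟨b, hpa ▸ hab⟩
      · exact ⟨a, hpa⟩
    obtain ⟨q, hq⟩ := hoff p y hy
    have hyq : y ≠ q := fun e => hq (Or.inr (Or.inl (congrArg _ e)))
    exact ⟨lineThrough hyq, fun h => hq (Col.rot h)⟩
  · rintro p q ⟨l₁, h₁⟩ ⟨l₂, h₂⟩ hp hq hp' hq'
    obtain ⟨x, y, hxy, rfl⟩ := mem_lines_iff.1 h₁
    obtain ⟨x', y', hxy', rfl⟩ := mem_lines_iff.1 h₂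
    refine or_iff_not_imp_left.2 fun hpq => Subtype.ext (Set.ext fun z => ?_)
    have aux : ∀ {x y : Hˣ}, x ≠ y → Col (x : H) y p → Col (x : H) y q →
        (Col (x : H) y z ↔ Col (p : H) q z) := fun {x y} hxy hp hq =>
      ⟨fun h => Col.trans₃ (hne hxy) hp hq h, fun h =>
        Col.trans₃ (hne hpq) (Col.trans₃ (hne hxy) hp hq (by simp [Col]))
          (Col.trans₃ (hne hxy) hp hq (by simp [Col])) h⟩
    exact (aux hxy hp hq).trans (aux hxy' hp' hq').symm
  · refine ⟨a, b, c, lineThrough hax, lineThrough hbc, lineThrough hbd, ?_⟩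
    simp only [mem_lineThrough]
    refine ⟨fun h => habc h.rot, fun h => ?_, fun h => ?_, by simp [Col], by simp [Col],
      fun h => ?_, by simp [Col], fun h => ?_⟩
    · exact habc (h.rot.rot.swap.trans hd.rot.swap.col hda.1.symm)
    · exact habc (h.rot.rot.swap.trans hx.rot.swap.col hxb.1.symm).swap
    · exact habc (h.rot.rot.swap.trans hx.swap.rot.swap.col hxb.2.symm).rot.rot
    · exact habc (hd.swap.rot.swap.col.trans h.rot.rot.swap hda.2.symm).rot.rot

end

section

variable {H : Type u} [CommHyperfield H]

/-! ### Multiplications as collineations -/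

/-- The permutations of the points given by multiplications, a group isomorphic to `H^×`. -/
noncomputable def mulPerms : Hˣ ≃* (MulAction.toPermHom Hˣ Hˣ).range :=
  MonoidHom.ofInjective MulAction.toPerm_injective

theorem range_toPermHom_le_collineations [IsProjectiveHypergroup H] :
    (MulAction.toPermHom Hˣ Hˣ).range ≤ (hyperfieldGeometry H).collineations := by
  have key : ∀ (a : Hˣ) (l : Set Hˣ), l ∈ (hyperfieldGeometry H).lines →
      (a * ·) '' l ∈ (hyperfieldGeometry H).lines := by
    intro a l hl
    obtain ⟨x, y, hxy, rfl⟩ := mem_lines_iff.1 hl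
    refine mem_lines_iff.2 ⟨a * x, a * y, fun h => hxy (mul_left_cancel h), ?_⟩
    ext z
    obtain ⟨z, rfl⟩ : ∃ w, z = a * w := ⟨a⁻¹ * z, by simp⟩
    have : Tri ((a : H) * x) (a * y) (a * z) ↔ Tri (x : H) y z := tri_mul_iff a.ne_zero
    simp [Col, this, a.ne_zero]
  rintro _ ⟨a, rfl⟩ l
  refine ⟨fun h => ?_, key a l⟩
  have := key a⁻¹ _ h
  rw [Set.image_image] at this
  simpa using this

/-- If the geometry of `H` is a projective plane, then `H^×` is a group of collineations that is
simply transitive on the points. -/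
theorem exists_collineations [Finite H] [IsProjectiveHypergroup H]
    (hp : (hyperfieldGeometry H).IsProjectivePlane)
    (hd : ¬ (hyperfieldGeometry H).IsDesarguesian) :
    ∃ (P : Type u) (g : Geometry P) (G : Subgroup (Equiv.Perm P)),
      Finite P ∧ g.IsProjectivePlane ∧ ¬ g.IsDesarguesian ∧
      G ≤ g.collineations ∧ (∀ s ∈ G, ∀ t ∈ G, s * t = t * s) ∧
      (∀ p p' : P, ∃! s : Equiv.Perm P, s ∈ G ∧ s p = p') ∧
      ∃ (e : Hˣ ≃* G) (f : Hˣ ≃ P), (hyperfieldGeometry H).IsIso g f ∧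
        ∀ a b : Hˣ, f (a * b) = (e a : Equiv.Perm P) (f b) := by
  refine ⟨Hˣ, hyperfieldGeometry H, (MulAction.toPermHom Hˣ Hˣ).range, inferInstance, hp, hd,
    range_toPermHom_le_collineations, ?_, fun p p' => ?_, mulPerms, Equiv.refl _, fun l => ?_,
    fun a b => rfl⟩
  · rintro _ ⟨a, rfl⟩ _ ⟨b, rfl⟩
    rw [← map_mul, ← map_mul, mul_comm]
  · refine ⟨MulAction.toPermHom Hˣ Hˣ (p' * p⁻¹), ⟨⟨_, rfl⟩, by simp⟩, ?_⟩
    rintro _ ⟨⟨a, rfl⟩, rfl⟩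
    simp
  · simp

/-! ### The Desarguesian case -/

/-- In dimension at least two, Desargues' theorem makes `H` a quotient of a finite field. -/
theorem isFiniteFieldQuotient_of_desargues [Finite H] [IsProjectiveHypergroup H]
    (hD : Desargues H) {a b c : H} (ha : a ≠ 0) (hb : b ≠ 0) (hc : c ≠ 0) (habc : ¬ Col a b c) :
    IsFiniteFieldQuotient H := by
  have hab : a ≠ b := fun h => habc (Or.inl h)
  obtain ⟨M, hM, hM'⟩ := exists_isHyperplane (isSubspace_line a b) fun h => by
    rcases (mem_line hab).1 (h ▸ Set.mem_univ c) with h | h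
    exacts [hc h, habc h]
  obtain ⟨K, V, _, _, _, π, hV, hπ⟩ := exists_isCoord hM' hD
    ⟨a, hM (left_mem_line a b), b, hM (right_mem_line a b), ha, hb, hab⟩
  refine hπ.isFiniteFieldQuotient (fun u v huv => ?_) fun u hu => ?_
  · have h := (hπ.linearIndependent_pair_iff).1 huv
    obtain ⟨z, hz, hcol⟩ := exists_not_col ha hb hc habc h.2.2
    obtain ⟨w, rfl⟩ := hπ.surjective z
    refine ⟨w, hπ.linearIndependent_triple_iff.2 ⟨huv, ?_, ?_, ?_⟩⟩
    · exact hπ.linearIndependent_pair_iff.2 ⟨h.2.1, hz, fun e => hcol (Or.inr (Or.inl e))⟩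
    · exact hπ.linearIndependent_pair_iff.2 ⟨h.1, hz, fun e => hcol (by simp [Col, e])⟩
    · exact fun e => hcol e.col
  · have hu' : π u ≠ 0 := fun h => hu (hπ.map_eq_zero.1 h)
    obtain ⟨z, hz, hne⟩ : ∃ z : H, z ≠ 0 ∧ π u ≠ z := by
      by_cases h : π u = a
      · exact ⟨b, hb, h ▸ hab⟩
      · exact ⟨a, ha, h⟩
    obtain ⟨v, rfl⟩ := hπ.surjective z
    exact ⟨v, hπ.linearIndependent_pair_iff.2 ⟨hu', hz, hne⟩⟩

end

end ProjHyper

open ProjHyper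

theorem theorem3p9 (H : Type u) [CommHyperfield H] [Finite H] (hK : IsKrasnerExtension H) :
    (∃ (G : Type u) (_ : CommGroup G) (_ : Finite G) (hG : 4 ≤ ENat.card G),
      letI := krasnerGroupHyperfield G hG
      Nonempty (HyperringIso H (WithZero G))) ∨
    (∃ (q m : ℕ) (K F : Type u) (_ : Field K) (_ : Field F) (_ : Algebra K F),
      0 < q ∧ 0 < m ∧ Nat.card K = q ∧ Nat.card F = q ^ m ∧
      Nonempty (HyperringIso H (KrasnerQuotient (unitsSubgroup K F)))) ∨
    (∃ (P : Type u) (g : Geometry P) (G : Subgroup (Equiv.Perm P)),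
      Finite P ∧ g.IsProjectivePlane ∧ ¬ g.IsDesarguesian ∧
      G ≤ g.collineations ∧ (∀ s ∈ G, ∀ t ∈ G, s * t = t * s) ∧
      (∀ p p' : P, ∃! s : Equiv.Perm P, s ∈ G ∧ s p = p') ∧
      ∃ (e : Hˣ ≃* G) (f : Hˣ ≃ P), (hyperfieldGeometry H).IsIso g f ∧
        ∀ a b : Hˣ, f (a * b) = (e a : Equiv.Perm P) (f b)) := by
  have := isProjectiveHypergroup hK
  by_cases h1 : ∀ x : H, x ≠ 0 → x = 1
  · exact Or.inr (Or.inl (isFiniteFieldQuotient_of_forall_eq h1))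
  push Not at h1
  obtain ⟨x, hx, hx1⟩ := h1
  by_cases h2 : ∀ x y z : H, x ≠ 0 → y ≠ 0 → z ≠ 0 → Col x y z
  · exact Or.inl (exists_hyperringIso_withZero hx one_ne_zero hx1 h2)
  push Not at h2
  obtain ⟨a, b, c, ha, hb, hc, habc⟩ := h2
  by_cases hD : Desargues H
  · exact Or.inr (Or.inl (isFiniteFieldQuotient_of_desargues hD ha hb hc habc))
  have hL : LinesMeet H := not_not.1 fun h => hD (desargues_of_not_linesMeet h)
  exact Or.inr (Or.inr (exists_collineations (isProjectivePlane hL ha hb hc habc)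
    fun h => hD (desargues_of_isDesarguesian h)))
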